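/- Let $S^5\subset\mathbb{C}^3$ be the unit sphere. For $\theta\in\mathbb{R}$, a smooth immersion $u:\mathbb{R}^2\to S^5$, $(s,t)\mapsto u(s,t)$, is called \emph{$\theta$-special Legendrian} if, for one of the two orientations of $\mathbb{R}^2$, the $2$-form $\iota_X\,\mathrm{Re}(e^{i\theta}dz^1\wedge dz^2\wedge dz^3)$ ($X$ the Euler vector field) pulls back under $u$ to the area form of the induced metric; that is, for a constant sign $\varepsilon=\pm1$, $\mathrm{Re}\big(e^{i\theta}\det_{\mathbb{C}}(u,u_s,u_t)\big)=\varepsilon\sqrt{|u_s|^2|u_t|^2-\langle u_s,u_t\rangle^2}$. For $\varphi\in\mathbb{R}$ let $T_\varphi=\{z\in\mathbb{C}^3: |z_1|^2=|z_2|^2=|z_3|^2=1/3,\ \arg z_1+\arg z_2+\arg z_3\equiv\varphi \bmod 2\pi\}$ be the generalized Clifford torus. \textbf{Theorem.} For each $\theta$ there is a two-parameter family $u_{\alpha,J}$, $(\alpha,J)\in[0,1]\times[0,\tfrac{1}{3\sqrt3}]$, of conformal $\theta$-special Legendrian immersions $\mathbb{R}^2\to S^5$, in which $J$ is the angular momentum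 parameter: the components $x_j+iy_j$ of $u_{\alpha,J}$ satisfy $x_j\,\partial_t y_j-y_j\,\partial_t x_j=J\mu_j$ with $\mu=(-1-2\alpha,\,2+\alpha,\,\alpha-1)$. The family has the following properties. (i) $u_{\alpha,J}$ is invariant under the one-parameter subgroup of $\mathrm{SU}(3)$ generated by $A=i\,\mathrm{diag}(1,\alpha,-1-\alpha)$: $e^{\sigma A}u_{\alpha,J}(s,t)=u_{\alpha,J}(s+\sigma,t)$ for all $\sigma,s,t\in\mathbb{R}$. (ii) If $\alpha=1$ or $J=\tfrac1{3\sqrt3}$, then $u_{\alpha,J}(\mathbb{R}^2)$ is a Clifford torus, i.e. it equals $B(T_\varphi)$ for some $B\in\mathrm{SU}(3)$ and $\varphi\in\mathbb{R}$. Otherwise the immersions are geometrically distinct: if $\alpha\neq1$, $J\neq\tfrac1{3\sqrt3}$ and $(\alpha',J')\in[0,1]\times[0,\tfrac{1}{3\sqrt3}]$ is different from $(\alpha,J)$, then no isometry of $S^5$ carries $u_{\alpha,J}(\mathbb{R}^2)$ onto $u_{\alpha',J'}(\mathbb{R}^2)$. (iii) The family contains, up to reparametrization and unitary motions of determinant $\pm1$,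 every $\theta$-special Legendrian immersion of the form $w(s,t)=e^{As}z(t)$, $A\in\mathfrak{so}(6)$, which covers a torus (i.e. factors through a smooth covering of a $2$-torus by $\mathbb{R}^2$): for each such $w$ there are $(\alpha,J)\in[0,1]\times[0,\tfrac{1}{3\sqrt3}]$, a unitary $B\in\mathrm{U}(3)$ with $\det B=\pm1$, and a diffeomorphism $\phi$ of $\mathbb{R}^2$ such that $w=B\circ u_{\alpha,J}\circ\phi$. -/

import Mathlib

open scoped ContDiff

/-- The Hermitian space `ℂ³`; its unit sphere is `S⁵`. -/
abbrev C3 : Type := EuclideanSpace ℂ (Fin 3)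

/-- The partial derivative `u_s`. -/
noncomputable def partialS (u : ℝ × ℝ → C3) (p : ℝ × ℝ) : C3 := fderiv ℝ u p (1, 0)

/-- The partial derivative `u_t`. -/
noncomputable def partialT (u : ℝ × ℝ → C3) (p : ℝ × ℝ) : C3 := fderiv ℝ u p (0, 1)

/-- The `θ`-special Lagrangian calibration `Re (e^{iθ} dz¹ ∧ dz² ∧ dz³)` evaluated on `(a, b, c)`. -/
noncomputable def slagForm (θ : ℝ) (a b c : C3) : ℝ :=
  (Complex.exp (θ * Complex.I) *
    Matrix.det (Matrix.of ![fun j => a j, fun j => b j, fun j => c j])).re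

/-- The normal part of the calibration: its contraction with the Euler field, at the point `x`. -/
noncomputable def slagNormal (θ : ℝ) (x v w : C3) : ℝ := slagForm θ x v w

/-- The density of the induced area form with respect to `ds ∧ dt`. -/
noncomputable def areaDensity (u : ℝ × ℝ → C3) (p : ℝ × ℝ) : ℝ :=
  Real.sqrt (‖partialS u p‖ ^ 2 * ‖partialT u p‖ ^ 2 - (inner ℝ (partialS u p) (partialT u p)) ^ 2)

/-- `u` is a smooth immersion of the plane into `S⁵` which is `θ`-special Legendrian: for one of the
two orientations of the plane (the sign `ε`), the normal part of the `θ`-special Lagrangian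
calibration pulls back to the induced area form. -/
structure IsSpecialLegendrianImmersion (θ : ℝ) (u : ℝ × ℝ → C3) : Prop where
  smooth : ContDiff ℝ ∞ u
  mem_sphere : ∀ p, ‖u p‖ = 1
  immersion : ∀ p, Function.Injective (fderiv ℝ u p)
  calibrated : ∃ ε : ℝ, (ε = 1 ∨ ε = -1) ∧
    ∀ p, slagNormal θ (u p) (partialS u p) (partialT u p) = ε * areaDensity u p

/-- `u` is conformal for the standard metrics. -/
def IsConformalParam (u : ℝ × ℝ → C3) : Prop :=
  ∀ p, ‖partialS u p‖ = ‖partialT u p‖ ∧ inner ℝ (partialS u p) (partialT u p) = 0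

/-- The action of a complex matrix on `ℂ³`, as a real-linear map. -/
noncomputable def matAct (M : Matrix (Fin 3) (Fin 3) ℂ) : C3 →L[ℝ] C3 :=
  (Matrix.toEuclideanCLM (n := Fin 3) (𝕜 := ℂ) M).restrictScalars ℝ

/-- The generator `A = i diag(1, α, -1 - α) ∈ su(3)`. -/
noncomputable def generator (α : ℝ) : C3 →L[ℝ] C3 :=
  matAct (Matrix.diagonal ![Complex.I, Complex.I * α, Complex.I * (-1 - α)])

/-- The vector `μ = (1, 1, 1) × (1, α, -1 - α)`. -/
def momentVector (α : ℝ) : Fin 3 → ℝ := ![-1 - 2 * α, 2 + α, α - 1]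

/-- The angular momenta `x_j ∂_t y_j - y_j ∂_t x_j` of the components of `u` are the constants
`m j`. -/
def HasAngularMomenta (u : ℝ × ℝ → C3) (m : Fin 3 → ℝ) : Prop :=
  ∀ p j, (u p j).re * (partialT u p j).im - (u p j).im * (partialT u p j).re = m j

/-- `u` is invariant under the one-parameter group generated by `A`, which acts on the plane by
translations of `s`. -/
def IsInvariantUnder (A : C3 →L[ℝ] C3) (u : ℝ × ℝ → C3) : Prop :=
  ∀ σ s t : ℝ, NormedSpace.exp (σ • A) (u (s, t)) = u (s + σ, t)

/-- `u` has the form `u (s, t) = e^{As} z(t)` with `A ∈ so(6)`. -/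
def IsEquivariantForm (u : ℝ × ℝ → C3) : Prop :=
  ∃ A : C3 →L[ℝ] C3, (∀ x y, inner ℝ (A x) y = -inner ℝ x (A y)) ∧
    ∃ z : ℝ → C3, ∀ s t : ℝ, u (s, t) = NormedSpace.exp (s • A) (z t)

/-- A diffeomorphism of the plane. -/
def IsPlaneDiffeo (φ : ℝ × ℝ ≃ ℝ × ℝ) : Prop := ContDiff ℝ ∞ φ ∧ ContDiff ℝ ∞ φ.symm

/-- `u` covers a torus: it factors through a smooth covering of a torus by the plane, that is,
through `ψ⁻¹` followed by the projection `ℝ² → ℝ²/ℤ²`, for a diffeomorphism `ψ` of the plane.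
(Double periodicity with respect to a lattice is the case of a linear `ψ`.) -/
def CoversTorus (u : ℝ × ℝ → C3) : Prop :=
  ∃ ψ : ℝ × ℝ ≃ ℝ × ℝ, IsPlaneDiffeo ψ ∧
    ∀ (m n : ℤ) (x : ℝ × ℝ), u (ψ (x + ((m : ℝ), (n : ℝ)))) = u (ψ x)

/-- The generalized Clifford torus
`T_φ = {z : |z_j|² = 1/3, arg z₁ + arg z₂ + arg z₃ = φ mod 2π}`. -/
def cliffordTorus (φ : ℝ) : Set C3 :=
  {z | ∃ a : Fin 3 → ℝ, ∑ j, a j = φ ∧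
    ∀ j, z j = ((1 / Real.sqrt 3 : ℝ) : ℂ) * Complex.exp (a j * Complex.I)}

/-- The surfaces described by `u` and `v` are congruent: an isometry of `S⁵` (the restriction of an
element of `O(6)`) carries the image of `u` onto the image of `v`. -/
def AreCongruent (u v : ℝ × ℝ → C3) : Prop :=
  ∃ F : C3 ≃ₗᵢ[ℝ] C3, F '' Set.range u = Set.range v

/-- The upper end `1 / (3 √3)` of the interval of the parameter `J`. -/
noncomputable def maxJ : ℝ := 1 / (3 * Real.sqrt 3)

open scoped ComplexConjugate
open Complex (I normSq)

/-! Write V for `flowField`, P = z₀z₁z₂ for `coordProd`, μ for `momentVector` and q(v) = ∏ (1/3 +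
μ_j v) for `levelCubic`. Everything is first done for θ = 0; the scalar e^{-iθ/3} then changes the
phase.

Construction. Up to sign, V(z) is the conjugate cross product of z and Az (`conjCross_generator`).
On the unit sphere, where ⟨z, Az⟩ = 0, the vectors Az and V(z) are therefore orthogonal, of equal
length, and calibrated together with z. So the orbits under e^{sA} of a solution of z' = V(z) sweep
out a conformal special Legendrian surface. The flow is integrable: the norm, the moment ∑ `weight`
α j · |z_j|² and Re P are conserved. The first two give |z_j|² = 1/3 + μ_j v for a single function
v, the `level`, and then v' = 2 Im P, (Im P)' = q'(v), |P|² = q(v). A profile starts at a real point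
with v ≤ 0 and q(v) = J². As q increases on v ≤ 0, this v is determined by J and is the minimum of
the level.

Clifford tori. Maximal J forces v = 0 for all time, and for α = 1 the flow through the start point
is linear; in both cases the solution is explicit.

Congruence. An isometry pulls the moment form of one surface back to a real quadratic form that
vanishes on the other. Such a form must be a multiple of the moment form there
(`IsProfile.quadratic_forms`): its Fourier coefficients along the orbits vanish separately, and the
monomials in the profile that share a frequency are independent, by their moduli if 0 < α < 1 and by
a Wronskian argument if α = 0 and J ≠ 0. Comparing eigenvalues gives α = α', and comparing minimal
levels gives J = J' (`IsProfile.eq_of_image_eq`). The surface with α = J = 0 lies in a hyperplane,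
and only its comparison with Clifford tori needs a separate argument.

Classification. For w = e^{As}z(t), equality in the calibration inequality gives ⟨w, Aw⟩ = 0 and w_t
= β Aw + γ w × Aw (`IsSpecialLegendrianImmersion.exists_isEquivariantLegendrian`). Decompose A into
a skew-Hermitian map H and an antilinear map k × ·. The structure equations force tr H = 0 and Im
⟨k, w⟩ = 0, and if k ≠ 0 the second derivative of |Aw|² at a minimum would be negative
(`IsEquivariantLegendrian.eq_zero_of_coversTorus`). So A lies in su(3) and may be taken to be a
multiple of `generator α`. The curve z is then a rotated and reparametrized flow line of V, and its
point of minimal level is matched with the start of a profile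
(`IsEquivariantLegendrian.exists_eq_sweep`). Compactness is used once more to see that the new time
parameter runs through all of ℝ (`IsEquivariantLegendrian.surjective_primitive`). -/

open Complex in
theorem inner_real_C3 (x y : C3) : inner ℝ x y =
    ∑ j, ((x j).re * (y j).re + (x j).im * (y j).im) := by
  simp only [PiLp.inner_apply]
  refine Finset.sum_congr rfl fun j _ => ?_
  rw [real_inner_eq_re_inner ℂ, RCLike.inner_apply]
  simp
  ring

theorem norm_sq_C3 (x : C3) : ‖x‖ ^ 2 = ∑ j, Complex.normSq (x j) := by
  rw [EuclideanSpace.norm_sq_eq]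
  simp [Complex.normSq_eq_norm_sq]

/-! ### Integral curves: existence, uniqueness, smoothness. -/

/-- A bounded Lipschitz vector field has integral curves defined for all times. -/
theorem exists_integralCurve_of_bounded_lipschitz {E : Type*} [NormedAddCommGroup E]
    [NormedSpace ℝ E] [CompleteSpace E] {F : E → E} {K L : NNReal} (hK : LipschitzWith K F)
    (hL : ∀ x, ‖F x‖ ≤ L) (x₀ : E) :
    ∃ z : ℝ → E, z 0 = x₀ ∧ ∀ t, HasDerivAt z (F (z t)) t := by
  have hex : ∀ n : ℕ, ∃ z : ℝ → E, z 0 = x₀ ∧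
      ∀ t ∈ Set.Ioo (-(n + 1 : ℝ)) (n + 1), HasDerivAt z (F (z t)) t := by
    intro n
    have h0 : (0 : ℝ) ∈ Set.Icc (-(n + 1 : ℝ)) (n + 1) := by
      constructor <;> linarith [(Nat.cast_nonneg n : (0 : ℝ) ≤ n)]
    -- With the radius L(n + 1), a curve of speed at most L cannot leave the ball within time n + 1,
    -- so the interval is not shortened.
    have hPL : IsPicardLindelof (fun _ => F) (⟨0, h0⟩ : Set.Icc (-(n + 1 : ℝ)) (n + 1)) x₀
        (L * (n + 1)) 0 L K := by
      refine ⟨fun _ _ => hK.lipschitzOnWith, fun _ _ => continuousOn_const, fun _ _ x _ => hL x, ?_⟩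
      simp
    obtain ⟨z, hz0, hz⟩ := hPL.exists_eq_forall_mem_Icc_hasDerivWithinAt (x := x₀) (by simp)
    exact ⟨z, hz0, fun t ht => (hz t (Set.Ioo_subset_Icc_self ht)).hasDerivAt
      (Icc_mem_nhds ht.1 ht.2)⟩
  choose z hz0 hz using hex
  have heq : ∀ m n : ℕ, m ≤ n → Set.EqOn (z m) (z n) (Set.Ioo (-(m + 1 : ℝ)) (m + 1)) := by
    intro m n hmn
    have hc : (m : ℝ) ≤ n := by exact_mod_cast hmn
    have hm0 : (0 : ℝ) ≤ m := Nat.cast_nonneg m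
    refine ODE_solution_unique_of_mem_Ioo (v := fun _ => F) (s := fun _ => Set.univ) (K := K)
      (t₀ := 0) (fun _ _ => hK.lipschitzOnWith) ⟨by linarith, by linarith⟩
      (fun t ht => ⟨hz m t ht, trivial⟩)
      (fun t ht => ⟨hz n t ⟨by linarith [ht.1], by linarith [ht.2]⟩, trivial⟩) ?_
    rw [hz0, hz0]
  refine ⟨fun t => z ⌊|t|⌋₊ t, by simp [hz0], fun t => ?_⟩
  -- The index ⌊|t|⌋ jumps with t. Near t the glued curve equals the single solution with index N,
  -- whose interval contains a neighbourhood of t.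
  set N := ⌊|t|⌋₊ + 1 with hN
  have hloc : ∀ r ∈ Set.Ioo (-(N : ℝ)) N, z ⌊|r|⌋₊ r = z N r := by
    intro r hr
    have hlt : |r| < N := abs_lt.2 hr
    have hle : ⌊|r|⌋₊ ≤ N := by
      have := (Nat.floor_lt (abs_nonneg r)).2 hlt
      omega
    have h1 := Nat.lt_floor_add_one |r|
    exact heq _ _ hle (abs_lt.1 h1)
  have htN : t ∈ Set.Ioo (-(N : ℝ)) N := by
    have h1 := Nat.lt_floor_add_one |t|
    rw [hN]
    push_cast
    exact abs_lt.1 h1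
  have hd := hz N t ⟨by linarith [htN.1], by linarith [htN.2]⟩
  have hev : (fun r => z ⌊|r|⌋₊ r) =ᶠ[nhds t] z N :=
    Filter.eventuallyEq_of_mem (Ioo_mem_nhds htN.1 htN.2) hloc
  have := hd.congr_of_eventuallyEq hev
  simpa only [hloc t htN] using this

/-- A smooth vector field on a finite-dimensional Euclidean space that is tangent to the unit sphere
has integral curves on the sphere defined for all times. -/
theorem exists_integralCurve_on_sphere {E : Type*} [NormedAddCommGroup E]
    [InnerProductSpace ℝ E] [FiniteDimensional ℝ E] {F : E → E} (hF : ContDiff ℝ ∞ F)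
    (htan : ∀ x, inner ℝ x (F x) = 0) {x₀ : E} (hx₀ : ‖x₀‖ = 1) :
    ∃ z : ℝ → E, z 0 = x₀ ∧ (∀ t, HasDerivAt z (F (z t)) t) ∧ ∀ t, ‖z t‖ = 1 := by
  -- The cutoff makes the field bounded and Lipschitz. It keeps the field tangent to spheres and
  -- equals 1 near the unit sphere, so the solution does not notice it.
  let χ : ContDiffBump (0 : E) := ⟨2, 3, by norm_num, by norm_num⟩
  have hG : ContDiff ℝ ∞ (fun x => χ x • F x) := χ.contDiff.smul hF
  have hGs : HasCompactSupport (fun x => χ x • F x) := χ.hasCompactSupport.smul_right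
  obtain ⟨K, hK⟩ := hG.lipschitzWith_of_hasCompactSupport hGs (by simp)
  obtain ⟨C, hC⟩ := hGs.exists_bound_of_continuous hG.continuous
  have hC' : ∀ x, ‖χ x • F x‖ ≤ (C.toNNReal : ℝ) := fun x =>
    (hC x).trans (Real.le_coe_toNNReal C)
  obtain ⟨z, hz0, hz⟩ := exists_integralCurve_of_bounded_lipschitz hK hC' x₀
  have hnorm : ∀ t, ‖z t‖ = 1 := by
    have hd : ∀ t, HasDerivAt (fun t => ‖z t‖ ^ 2) 0 t := by
      intro t
      have := (hz t).norm_sq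
      rwa [inner_smul_right, htan, mul_zero, mul_zero] at this
    intro t
    have hc := is_const_of_deriv_eq_zero (fun t => (hd t).differentiableAt)
      (fun t => (hd t).deriv) t 0
    simp only [hz0, hx₀] at hc
    have := norm_nonneg (z t)
    nlinarith
  refine ⟨z, hz0, fun t => ?_, hnorm⟩
  have h1 : χ (z t) = 1 := χ.one_of_mem_closedBall (by simp [χ, hnorm t])
  simpa [h1] using hz t

/-- Two integral curves in a ball of a smooth vector field, multiplied by a continuous function of
time and perturbed by a time-dependent linear one, agree if they agree at one time. -/
theorem integralCurve_unique {E : Type*} [NormedAddCommGroup E] [NormedSpace ℝ E]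
    [FiniteDimensional ℝ E] {F : E → E} (hF : ContDiff ℝ ∞ F) (A : E →L[ℝ] E) {b c : ℝ → ℝ}
    (hb : Continuous b) (hc : Continuous c) {R : ℝ} {x y : ℝ → E}
    (hx : ∀ t, HasDerivAt x (b t • A (x t) + c t • F (x t)) t) (hxR : ∀ t, ‖x t‖ ≤ R)
    (hy : ∀ t, HasDerivAt y (b t • A (y t) + c t • F (y t)) t) (hyR : ∀ t, ‖y t‖ ≤ R)
    {t₀ : ℝ} (h : x t₀ = y t₀) : x = y := by
  obtain ⟨K, hK⟩ : ∃ K, LipschitzOnWith K F (Metric.closedBall 0 R) :=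
    (hF.of_le (by simp)).contDiffOn.exists_lipschitzOnWith (n := 1) (by simp)
      (convex_closedBall 0 R) (isCompact_closedBall 0 R)
  ext t
  set T := |t| + |t₀| + 1
  obtain ⟨B, hB⟩ := (isCompact_Icc (a := -T) (b := T)).exists_bound_of_continuousOn hb.continuousOn
  obtain ⟨C, hC⟩ := (isCompact_Icc (a := -T) (b := T)).exists_bound_of_continuousOn hc.continuousOn
  have hLip : ∀ r ∈ Set.Ioo (-T) T, LipschitzOnWith (B.toNNReal * ‖A‖₊ + C.toNNReal * K)
      (fun w => b r • A w + c r • F w) (Metric.closedBall 0 R) := by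
    intro r hr
    have hBr : ‖b r‖₊ ≤ B.toNNReal := by
      rw [← NNReal.coe_le_coe]
      exact (hB r (Set.Ioo_subset_Icc_self hr)).trans (Real.le_coe_toNNReal B)
    have hCr : ‖c r‖₊ ≤ C.toNNReal := by
      rw [← NNReal.coe_le_coe]
      exact (hC r (Set.Ioo_subset_Icc_self hr)).trans (Real.le_coe_toNNReal C)
    have h1 : LipschitzOnWith (‖b r‖₊ * ‖A‖₊) (fun w => b r • A w) (Metric.closedBall 0 R) :=
      ((lipschitzWith_smul (b r)).comp A.lipschitz).lipschitzOnWith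
    have h2 : LipschitzOnWith (‖c r‖₊ * K) (fun w => c r • F w) (Metric.closedBall 0 R) :=
      (lipschitzWith_smul (c r)).comp_lipschitzOnWith hK
    exact (h1.add h2).weaken (by gcongr)
  have ht : t ∈ Set.Ioo (-T) T := by
    have := abs_nonneg t₀
    exact abs_lt.1 (by simp only [T]; linarith)
  have ht₀ : t₀ ∈ Set.Ioo (-T) T := by
    have := abs_nonneg t
    exact abs_lt.1 (by simp only [T]; linarith)
  exact ODE_solution_unique_of_mem_Ioo (v := fun r w => b r • A w + c r • F w) (s := fun _ => _)
    hLip ht₀ (fun r _ => ⟨hx r, by simpa using hxR r⟩)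
    (fun r _ => ⟨hy r, by simpa using hyR r⟩) h ht

/-- Integral curves of smooth vector fields are smooth. -/
theorem contDiff_of_integralCurve {E : Type*} [NormedAddCommGroup E] [NormedSpace ℝ E]
    {F : E → E} (hF : ContDiff ℝ ∞ F) {z : ℝ → E} (hz : ∀ t, HasDerivAt z (F (z t)) t) :
    ContDiff ℝ ∞ z := by
  have hd : deriv z = F ∘ z := funext fun t => (hz t).deriv
  rw [contDiff_infty]
  intro n
  induction n with
  | zero => exact contDiff_zero.2 (continuous_iff_continuousAt.2 fun t => (hz t).continuousAt)
  | succ n ih =>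
    have : ((n + 1 : ℕ) : WithTop ℕ∞) = (n : WithTop ℕ∞) + 1 := by push_cast; rfl
    rw [this, contDiff_succ_iff_deriv]
    refine ⟨fun t => (hz t).differentiableAt, by simp, ?_⟩
    rw [hd]
    exact (hF.of_le (by exact_mod_cast le_top)).comp ih

/-- A solution of the linear equation with matrix `A` is given by the exponential of `A`. -/
theorem eq_exp_smul_of_hasDerivAt {E : Type*} [NormedAddCommGroup E] [NormedSpace ℝ E]
    [CompleteSpace E] (A : E →L[ℝ] E) {x : ℝ → E} (hx : ∀ s, HasDerivAt x (A (x s)) s) (s : ℝ) :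
    NormedSpace.exp (s • A) (x 0) = x s := by
  have hd : ∀ r, HasDerivAt (fun r => NormedSpace.exp (r • -A) (x r)) 0 r := by
    intro r
    have h1 := (hasDerivAt_exp_smul_const (𝕂 := ℝ) (-A) r).clm_apply (hx r)
    convert h1 using 1
    simp
  have hc := is_const_of_deriv_eq_zero (fun t => (hd t).differentiableAt)
      (fun t => (hd t).deriv) s 0
  simp only [zero_smul, NormedSpace.exp_zero, one_apply_eq_self] at hc
  let _ : NormedAlgebra ℚ (E →L[ℝ] E) := NormedAlgebra.restrictScalars ℚ ℝ (E →L[ℝ] E)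
  rw [← hc, ← mul_apply_eq_comp, ← NormedSpace.exp_add_of_commute]
  · simp
  · rw [smul_neg]
    exact (Commute.refl (s • A)).neg_right

theorem hasDerivAt_exp_smul_apply {E : Type*} [NormedAddCommGroup E] [NormedSpace ℝ E]
    [CompleteSpace E] (A : E →L[ℝ] E) (x : E) (s : ℝ) :
    HasDerivAt (fun s : ℝ => NormedSpace.exp (s • A) x) (A (NormedSpace.exp (s • A) x)) s := by
  have h1 := (hasDerivAt_exp_smul_const' (𝕂 := ℝ) A s).clm_apply (hasDerivAt_const s x)
  convert h1 using 1
  simp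

/-! ### The one-parameter group and the vector field in coordinates. -/

/-- The weights `(1, α, -1 - α)` of the one-parameter group generated by `generator α`. -/
def weight (α : ℝ) : Fin 3 → ℝ := ![1, α, -1 - α]

/-- The conjugate cross product on `ℂ³`. -/
noncomputable def conjCross (x y : C3) : C3 :=
  WithLp.toLp 2 fun j => conj (x (j + 1) * y (j + 2) - x (j + 2) * y (j + 1))

/-- The vector field whose integral curves are the profiles of the conformal equivariant special
Legendrian surfaces. -/
noncomputable def flowField (α : ℝ) (z : C3) : C3 :=
  WithLp.toLp 2 fun j => I * momentVector α j * conj (z (j + 1) * z (j + 2))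

/-- The product of the three coordinates. -/
noncomputable def coordProd (z : C3) : ℂ := z 0 * z 1 * z 2

/-- The one-parameter group generated by `generator α`. -/
noncomputable def rotate (α s : ℝ) (z : C3) : C3 :=
  WithLp.toLp 2 fun j => Complex.exp (I * (weight α j * s : ℝ)) * z j

@[simp] theorem conjCross_apply (x y : C3) (j : Fin 3) :
    conjCross x y j = conj (x (j + 1) * y (j + 2) - x (j + 2) * y (j + 1)) := rfl

@[simp] theorem flowField_apply (α : ℝ) (z : C3) (j : Fin 3) :
    flowField α z j = I * momentVector α j * conj (z (j + 1) * z (j + 2)) := rfl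

@[simp] theorem rotate_apply (α s : ℝ) (z : C3) (j : Fin 3) :
    rotate α s z j = Complex.exp (I * (weight α j * s : ℝ)) * z j := rfl

theorem matAct_apply (M : Matrix (Fin 3) (Fin 3) ℂ) (z : C3) (j : Fin 3) :
    matAct M z j = ∑ k, M j k * z k := by
  simp [matAct, Matrix.ofLp_toEuclideanCLM, Matrix.mulVec, dotProduct]

@[simp] theorem generator_apply (α : ℝ) (z : C3) (j : Fin 3) :
    generator α z j = I * weight α j * z j := by
  rw [generator, matAct_apply]
  fin_cases j <;> simp [Matrix.diagonal_apply, weight]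

theorem hasDerivAt_C3 {z : ℝ → C3} {z' : C3} {t : ℝ} :
    HasDerivAt z z' t ↔ ∀ j, HasDerivAt (fun t => z t j) (z' j) t := by
  simp only [hasDerivAt_iff_hasFDerivAt]
  rw [← hasFDerivWithinAt_univ, hasFDerivWithinAt_piLp]
  simp only [hasFDerivWithinAt_univ]
  rfl

theorem contDiff_C3 {E : Type*} [NormedAddCommGroup E] [NormedSpace ℝ E] {f : E → C3}
    {n : WithTop ℕ∞} : ContDiff ℝ n f ↔ ∀ j, ContDiff ℝ n fun x => f x j :=
  contDiff_piLp 2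

theorem contDiff_conj {n : WithTop ℕ∞} : ContDiff ℝ n (fun z : ℂ => conj z) :=
  Complex.conjCLE.contDiff

theorem contDiff_coord (j : Fin 3) {n : WithTop ℕ∞} : ContDiff ℝ n (fun z : C3 => z j) :=
  contDiff_piLp_apply 2

theorem contDiff_flowField (α : ℝ) : ContDiff ℝ ∞ (flowField α) := by
  rw [contDiff_C3]
  intro j
  simp only [flowField_apply]
  exact contDiff_const.mul (contDiff_conj.comp ((contDiff_coord _).mul (contDiff_coord _)))

theorem HasDerivAt.conj {f : ℝ → ℂ} {f' : ℂ} {t : ℝ} (h : HasDerivAt f f' t) :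
    HasDerivAt (fun t => conj (f t)) (conj f') t := h.star

theorem HasDerivAt.complex_re {f : ℝ → ℂ} {f' : ℂ} {t : ℝ} (h : HasDerivAt f f' t) :
    HasDerivAt (fun t => (f t).re) f'.re t :=
  Complex.reCLM.hasFDerivAt.comp_hasDerivAt t h

theorem HasDerivAt.complex_im {f : ℝ → ℂ} {f' : ℂ} {t : ℝ} (h : HasDerivAt f f' t) :
    HasDerivAt (fun t => (f t).im) f'.im t :=
  Complex.imCLM.hasFDerivAt.comp_hasDerivAt t h

theorem HasDerivAt.normSq {f : ℝ → ℂ} {f' : ℂ} {t : ℝ} (h : HasDerivAt f f' t) :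
    HasDerivAt (fun t => normSq (f t)) (2 * (conj (f t) * f').re) t := by
  have := (h.complex_re.mul h.complex_re).add (h.complex_im.mul h.complex_im)
  refine (this.congr_deriv ?_).congr_of_eventuallyEq (.of_forall fun r => ?_)
  · simp
    ring
  · simp [Complex.normSq_apply]

theorem hasDerivAt_rotate (α : ℝ) (z : C3) (s : ℝ) :
    HasDerivAt (fun s => rotate α s z) (generator α (rotate α s z)) s := by
  rw [hasDerivAt_C3]
  intro j
  have h1 : HasDerivAt (fun s : ℝ => I * ((weight α j * s : ℝ) : ℂ)) (I * (weight α j : ℝ)) s := by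
    have := ((hasDerivAt_id s).const_mul (weight α j)).ofReal_comp.const_mul I
    simpa using this
  have := (h1.cexp).mul_const (z j)
  refine this.congr_deriv ?_
  simp
  ring

@[simp] theorem rotate_zero (α : ℝ) (z : C3) : rotate α 0 z = z := by
  ext j
  simp

theorem exp_smul_generator (α s : ℝ) (z : C3) :
    NormedSpace.exp (s • generator α) z = rotate α s z := by
  have := eq_exp_smul_of_hasDerivAt (generator α) (fun s => hasDerivAt_rotate α z s) s
  simpa using this

theorem rotate_add (α s r : ℝ) (z : C3) : rotate α s (rotate α r z) = rotate α (r + s) z := by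
  ext j
  simp only [rotate_apply]
  rw [← mul_assoc, ← Complex.exp_add]
  congr 2
  push_cast
  ring

theorem normSq_exp_I_mul (x : ℝ) : normSq (Complex.exp (I * x)) = 1 := by
  rw [Complex.normSq_eq_norm_sq, mul_comm, Complex.norm_exp_ofReal_mul_I]
  norm_num

theorem conj_exp_I_mul (x : ℝ) : conj (Complex.exp (I * x)) = Complex.exp (-(I * x)) := by
  rw [← Complex.exp_conj]
  simp

theorem normSq_rotate (α s : ℝ) (z : C3) (j : Fin 3) : normSq (rotate α s z j) = normSq (z j) := by
  rw [rotate_apply, map_mul, normSq_exp_I_mul, one_mul]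

theorem norm_rotate (α s : ℝ) (z : C3) : ‖rotate α s z‖ = ‖z‖ := by
  have : ‖rotate α s z‖ ^ 2 = ‖z‖ ^ 2 := by simp only [norm_sq_C3, normSq_rotate]
  exact (sq_eq_sq₀ (norm_nonneg _) (norm_nonneg _)).1 this

theorem weight_sum (α : ℝ) : weight α 0 + weight α 1 + weight α 2 = 0 := by
  simp [weight]

/-- The three weights sum to zero, so the conjugate of the product of two of the phases is the third
phase. -/
theorem flowField_rotate (α s : ℝ) (z : C3) :
    flowField α (rotate α s z) = rotate α s (flowField α z) := by
  have key : ∀ j : Fin 3, weight α j * s = -(weight α (j + 1) * s) + -(weight α (j + 2) * s) := by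
    have h := weight_sum α
    intro j
    fin_cases j <;> simp <;> linear_combination s * h
  ext j
  simp only [flowField_apply, rotate_apply, map_mul, conj_exp_I_mul, key j]
  push_cast
  rw [mul_add, Complex.exp_add]
  simp only [mul_neg]
  ring

/-- Derivatives along a curve that moves in the directions `generator α` and `flowField α`. -/
theorem hasDerivAt_normSq_coord {α b c t : ℝ} {z : ℝ → C3}
    (hz : HasDerivAt z (b • generator α (z t) + c • flowField α (z t)) t) (j : Fin 3) :
    HasDerivAt (fun t => normSq (z t j))
      (2 * c * momentVector α j * (coordProd (z t)).im) t := by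
  refine ((hasDerivAt_C3.1 hz j).normSq).congr_deriv ?_
  fin_cases j <;> simp [coordProd] <;> ring

/-- The rotation drops out because the weights sum to zero, and the flow contributes i times a real
number. This is why Re P is a first integral. -/
theorem hasDerivAt_coordProd {α b c t : ℝ} {z : ℝ → C3}
    (hz : HasDerivAt z (b • generator α (z t) + c • flowField α (z t)) t) :
    HasDerivAt (fun t => coordProd (z t)) (I * ((c * ∑ j, momentVector α j *
      (normSq (z t (j + 1)) * normSq (z t (j + 2))) : ℝ) : ℂ)) t := by
  have h := hasDerivAt_C3.1 hz
  refine (((h 0).mul (h 1)).mul (h 2)).congr_deriv ?_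
  have hw : ((weight α 2 : ℝ) : ℂ) = -(weight α 0 : ℝ) - (weight α 1 : ℝ) := by
    have h := congrArg (fun x : ℝ => (x : ℂ)) (weight_sum α)
    push_cast at h
    linear_combination h
  simp [Fin.sum_univ_three, Complex.normSq_eq_conj_mul_self, hw]
  ring

/-! ### The level cubic. -/

/-- The cubic `∏ (1/3 + μ_j v)`. -/
noncomputable def levelCubic (α v : ℝ) : ℝ :=
  (1 / 3 + momentVector α 0 * v) * (1 / 3 + momentVector α 1 * v) * (1 / 3 + momentVector α 2 * v)

theorem levelCubic_eq (α v : ℝ) : levelCubic α v =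
    1 / 27 - (1 + α + α ^ 2) * v ^ 2 + (1 + 2 * α) * (2 + α) * (1 - α) * v ^ 3 := by
  simp [levelCubic, momentVector]
  ring

theorem maxJ_pos : 0 < maxJ := by
  unfold maxJ
  positivity

theorem maxJ_sq : maxJ ^ 2 = 1 / 27 := by
  unfold maxJ
  rw [div_pow, mul_pow, Real.sq_sqrt (by norm_num)]
  norm_num

/-- On v ≤ 0 both -v² and v³ increase; their coefficients in the cubic are positive and, as α ≤ 1,
nonnegative. Hence J determines the starting level. -/
theorem levelCubic_lt {α : ℝ} (hα : α ∈ Set.Icc (0 : ℝ) 1) {v w : ℝ} (hvw : v < w) (hw : w ≤ 0) :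
    levelCubic α v < levelCubic α w := by
  obtain ⟨h0, h1⟩ := hα
  rw [levelCubic_eq, levelCubic_eq]
  have hD : 0 ≤ (1 + 2 * α) * (2 + α) * (1 - α) :=
    mul_nonneg (by positivity) (by linarith)
  have h3 : v ^ 3 ≤ w ^ 3 := (Odd.strictMono_pow (n := 3) (by decide)).monotone hvw.le
  have h2 : w ^ 2 < v ^ 2 := by nlinarith
  have hE : 0 < 1 + α + α ^ 2 := by positivity
  nlinarith [mul_le_mul_of_nonneg_left h3 hD, mul_lt_mul_of_pos_left h2 hE]

theorem levelCubic_zero (α : ℝ) : levelCubic α 0 = 1 / 27 := by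
  rw [levelCubic_eq]
  ring

theorem levelCubic_injOn {α : ℝ} (hα : α ∈ Set.Icc (0 : ℝ) 1) {v w : ℝ} (hv : v ≤ 0) (hw : w ≤ 0)
    (h : levelCubic α v = levelCubic α w) : v = w := by
  rcases lt_trichotomy v w with hlt | heq | hlt
  · exact absurd h (levelCubic_lt hα hlt hw).ne
  · exact heq
  · exact absurd h (levelCubic_lt hα hlt hv).ne'

theorem exists_level {α J : ℝ} (hα : α ∈ Set.Icc (0 : ℝ) 1) (hJ : J ∈ Set.Icc (0 : ℝ) maxJ) :
    ∃ v ≤ 0, (∀ j, 0 ≤ 1 / 3 + momentVector α j * v) ∧ levelCubic α v = J ^ 2 := by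
  have hα0 := hα.1
  have hα1 := hα.2
  have hpos : 0 < 3 * (2 + α) := by positivity
  -- The zero of the factor 1/3 + μ₁ v. For v ≤ 0 it is the only factor that can vanish, since μ₀
  -- and μ₂ are not positive; between m and 0 the cubic runs from 0 to 1/27.
  set m := -(1 / (3 * (2 + α))) with hm
  have hm0 : m ≤ 0 := by
    rw [hm, neg_nonpos]
    positivity
  have hmm : momentVector α 1 * m = -(1 / 3) := by
    simp only [momentVector, hm, Matrix.cons_val_one, Matrix.cons_val_zero]
    field_simp
  have hcont : ContinuousOn (levelCubic α) (Set.Icc m 0) := by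
    unfold levelCubic
    fun_prop
  have hle : J ^ 2 ≤ 1 / 27 := by
    rw [← maxJ_sq]
    exact pow_le_pow_left₀ hJ.1 hJ.2 2
  have hmem : J ^ 2 ∈ Set.Icc (levelCubic α m) (levelCubic α 0) := by
    refine ⟨?_, by rwa [levelCubic_zero]⟩
    have : levelCubic α m = 0 := by simp [levelCubic, hmm]
    rw [this]
    positivity
  obtain ⟨v, hv, hvJ⟩ := intermediate_value_Icc hm0 hcont hmem
  refine ⟨v, hv.2, fun j => ?_, hvJ⟩
  fin_cases j
  · simp [momentVector]
    nlinarith [hv.2]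
  · have h : momentVector α 1 * m ≤ momentVector α 1 * v :=
      mul_le_mul_of_nonneg_left hv.1 (by simp [momentVector]; linarith)
    simp only [Fin.mk_one]
    linarith
  · simp [momentVector]
    nlinarith [hv.2]

/-! ### Profiles. -/

/-- The starting point with `|z_j|² = 1/3 + μ_j v`. -/
noncomputable def startPoint (α v : ℝ) : C3 :=
  WithLp.toLp 2 fun j => (√(1 / 3 + momentVector α j * v) : ℂ)

@[simp] theorem startPoint_apply (α v : ℝ) (j : Fin 3) :
    startPoint α v j = (√(1 / 3 + momentVector α j * v) : ℂ) := rfl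

/-- `Z` is the profile of the equivariant conformal special Legendrian surface with parameters
`α`, `J` and `θ = 0`: the integral curve that starts at a point with minimal level. -/
structure IsProfile (α J : ℝ) (Z : ℝ → C3) : Prop where
  flow : ∀ t, HasDerivAt Z (flowField α (Z t)) t
  start : ∃ v ≤ 0, (∀ j, 0 ≤ 1 / 3 + momentVector α j * v) ∧ levelCubic α v = J ^ 2 ∧
    Z 0 = startPoint α v

/-- As μ is the cross product of (1, 1, 1) with the weights, it is orthogonal to both. These two
relations make the norm and the moment constant along the flow. -/
theorem momentVector_sum (α : ℝ) :
    momentVector α 0 + momentVector α 1 + momentVector α 2 = 0 := by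
  simp [momentVector]
  ring

theorem weight_momentVector_sum (α : ℝ) : weight α 0 * momentVector α 0 +
    weight α 1 * momentVector α 1 + weight α 2 * momentVector α 2 = 0 := by
  simp [momentVector, weight]
  ring

theorem inner_flowField (α : ℝ) (z : C3) : inner ℝ z (flowField α z) = 0 := by
  rw [inner_real_C3]
  have h : momentVector α 2 = -momentVector α 0 - momentVector α 1 := by
    linarith [momentVector_sum α]
  simp [Fin.sum_univ_three, h]
  ring

theorem normSq_startPoint {α v : ℝ} (hv : ∀ j, 0 ≤ 1 / 3 + momentVector α j * v) (j : Fin 3) :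
    normSq (startPoint α v j) = 1 / 3 + momentVector α j * v := by
  rw [startPoint_apply, Complex.normSq_ofReal, Real.mul_self_sqrt (hv j)]

theorem norm_startPoint {α v : ℝ} (hv : ∀ j, 0 ≤ 1 / 3 + momentVector α j * v) :
    ‖startPoint α v‖ = 1 := by
  have : ‖startPoint α v‖ ^ 2 = 1 := by
    simp only [norm_sq_C3, normSq_startPoint hv, Fin.sum_univ_three]
    linear_combination v * momentVector_sum α
  nlinarith [norm_nonneg (startPoint α v)]

theorem exists_isProfile {α J : ℝ} (hα : α ∈ Set.Icc (0 : ℝ) 1) (hJ : J ∈ Set.Icc (0 : ℝ) maxJ) :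
    ∃ Z, IsProfile α J Z := by
  obtain ⟨v, hv0, hv, hvJ⟩ := exists_level hα hJ
  obtain ⟨Z, hZ0, hZ, -⟩ := exists_integralCurve_on_sphere (contDiff_flowField α)
    (inner_flowField α) (norm_startPoint hv)
  exact ⟨Z, hZ, v, hv0, hv, hvJ, hZ0⟩

/-- The profile with parameters `α`, `J`. -/
noncomputable def profile (α J : ℝ) : ℝ → C3 :=
  open Classical in if h : ∃ Z, IsProfile α J Z then h.choose else 0

theorem isProfile_profile {α J : ℝ} (hα : α ∈ Set.Icc (0 : ℝ) 1) (hJ : J ∈ Set.Icc (0 : ℝ) maxJ) :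
    IsProfile α J (profile α J) := by
  have h := exists_isProfile hα hJ
  rw [profile, dif_pos h]
  exact h.choose_spec

/-! ### The level and the conserved quantities. -/

/-- The level `v` of a point with `|z_j|² = 1/3 + μ_j v`. -/
noncomputable def level (α : ℝ) (z : C3) : ℝ := (normSq (z 1) - 1 / 3) / (2 + α)

/-- On the sphere, the points with vanishing moment for the weights are determined up to phases by
the level. -/
theorem normSq_eq_level {α : ℝ} (hα : 0 ≤ α) {z : C3} (h1 : ∑ j, normSq (z j) = 1)
    (h0 : ∑ j, weight α j * normSq (z j) = 0) (j : Fin 3) :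
    normSq (z j) = 1 / 3 + momentVector α j * level α z := by
  have hne : 2 + α ≠ 0 := by positivity
  simp only [Fin.sum_univ_three] at h1 h0
  simp [weight] at h0
  have hl : (2 + α) * level α z = normSq (z 1) - 1 / 3 := by
    rw [level]
    field_simp
  fin_cases j <;> simp [momentVector] <;> apply mul_left_cancel₀ hne
  · linear_combination (1 + α) * h1 + h0 + (1 + 2 * α) * hl
  · linear_combination -(2 + α) * hl
  · linear_combination h1 - h0 + (1 - α) * hl

theorem normSq_coordProd (z : C3) :
    normSq (coordProd z) = normSq (z 0) * normSq (z 1) * normSq (z 2) := by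
  simp [coordProd]

/-- Along a flow line, quantities of the form `normSq` weighted orthogonally to the moment vector
are conserved. -/
theorem sum_normSq_const {α : ℝ} {b c : ℝ → ℝ} {z : ℝ → C3}
    (hz : ∀ t, HasDerivAt z (b t • generator α (z t) + c t • flowField α (z t)) t) (m : Fin 3 → ℝ)
    (hm : ∑ j, m j * momentVector α j = 0) (t t' : ℝ) :
    ∑ j, m j * normSq (z t j) = ∑ j, m j * normSq (z t' j) := by
  have hd : ∀ t, HasDerivAt (fun t => ∑ j, m j * normSq (z t j)) 0 t := by
    intro t
    have := HasDerivAt.fun_sum (u := Finset.univ) fun j _ =>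
      (hasDerivAt_normSq_coord (hz t) j).const_mul (m j)
    refine this.congr_deriv ?_
    simp only [Fin.sum_univ_three] at hm ⊢
    linear_combination 2 * c t * (coordProd (z t)).im * hm
  exact is_const_of_deriv_eq_zero (fun t => (hd t).differentiableAt) (fun t => (hd t).deriv) t t'

theorem coordProd_re_const {α : ℝ} {b c : ℝ → ℝ} {z : ℝ → C3}
    (hz : ∀ t, HasDerivAt z (b t • generator α (z t) + c t • flowField α (z t)) t) (t t' : ℝ) :
    (coordProd (z t)).re = (coordProd (z t')).re := by
  have hd : ∀ t, HasDerivAt (fun t => (coordProd (z t)).re) 0 t := fun t =>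
    (hasDerivAt_coordProd (hz t)).complex_re.congr_deriv
      (by rw [Complex.mul_re, Complex.ofReal_re, Complex.ofReal_im]; simp)
  exact is_const_of_deriv_eq_zero (fun t => (hd t).differentiableAt) (fun t => (hd t).deriv) t t'

theorem hasDerivAt_level {α b c t : ℝ} (hα : 0 ≤ α) {z : ℝ → C3}
    (hz : HasDerivAt z (b • generator α (z t) + c • flowField α (z t)) t) :
    HasDerivAt (fun t => level α (z t)) (2 * c * (coordProd (z t)).im) t := by
  have hne : 2 + α ≠ 0 := by positivity
  refine (((hasDerivAt_normSq_coord hz 1).sub_const (1 / 3)).div_const (2 + α)).congr_deriv ?_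
  simp [momentVector]
  field_simp

/-- The derivative of the cubic `levelCubic α`. -/
noncomputable def levelCubicDeriv (α v : ℝ) : ℝ :=
  v * (3 * ((1 + 2 * α) * (2 + α) * (1 - α)) * v - 2 * (1 + α + α ^ 2))

/-- The sum of μ_j |z_{j+1}|² |z_{j+2}|² is the product rule for ∏ (1/3 + μ_j v). Together with the
derivative of the level this is Newton's equation for v. -/
theorem hasDerivAt_coordProd_im {α b c t : ℝ} {z : ℝ → C3}
    (hz : HasDerivAt z (b • generator α (z t) + c • flowField α (z t)) t)
    (hl : ∀ j, normSq (z t j) = 1 / 3 + momentVector α j * level α (z t)) :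
    HasDerivAt (fun t => (coordProd (z t)).im) (c * levelCubicDeriv α (level α (z t))) t := by
  refine (hasDerivAt_coordProd hz).complex_im.congr_deriv ?_
  rw [Complex.I_mul_im, Complex.ofReal_re]
  congr 1
  simp only [hl, Fin.sum_univ_three, levelCubicDeriv]
  simp [momentVector]
  ring

namespace IsProfile

variable {α J : ℝ} {Z : ℝ → C3}

theorem flow' (h : IsProfile α J Z) (t : ℝ) :
    HasDerivAt Z ((0 : ℝ) • generator α (Z t) + (1 : ℝ) • flowField α (Z t)) t := by
  simpa using h.flow t

theorem contDiff (h : IsProfile α J Z) : ContDiff ℝ ∞ Z :=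
  contDiff_of_integralCurve (contDiff_flowField α) h.flow

theorem sum_normSq (h : IsProfile α J Z) (t : ℝ) : ∑ j, normSq (Z t j) = 1 := by
  have := sum_normSq_const (b := fun _ => 0) (c := fun _ => 1) h.flow' (fun _ => 1)
    (by simpa [Fin.sum_univ_three] using momentVector_sum α) t 0
  obtain ⟨v, hv0, hv, hvJ, hst⟩ := h.start
  simp only [one_mul] at this
  rw [this, hst, ← norm_sq_C3, norm_startPoint hv, one_pow]

theorem norm_eq (h : IsProfile α J Z) (t : ℝ) : ‖Z t‖ = 1 := by
  have := h.sum_normSq t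
  rw [← norm_sq_C3] at this
  nlinarith [norm_nonneg (Z t)]

theorem sum_weight_normSq (h : IsProfile α J Z) (t : ℝ) :
    ∑ j, weight α j * normSq (Z t j) = 0 := by
  have := sum_normSq_const (b := fun _ => 0) (c := fun _ => 1) h.flow' (weight α)
    (by simpa [Fin.sum_univ_three] using weight_momentVector_sum α) t 0
  obtain ⟨v, hv0, hv, hvJ, hst⟩ := h.start
  rw [this, hst]
  simp only [normSq_startPoint hv, Fin.sum_univ_three]
  linear_combination (1 / 3) * weight_sum α + v * weight_momentVector_sum α

theorem normSq_eq (h : IsProfile α J Z) (hα : 0 ≤ α) (t : ℝ) (j : Fin 3) :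
    normSq (Z t j) = 1 / 3 + momentVector α j * level α (Z t) :=
  normSq_eq_level hα (h.sum_normSq t) (h.sum_weight_normSq t) j

theorem level_start (hα : 0 ≤ α) {v : ℝ} (hv : ∀ j, 0 ≤ 1 / 3 + momentVector α j * v) :
    level α (startPoint α v) = v := by
  have hne : 2 + α ≠ 0 := by positivity
  rw [level, normSq_startPoint hv]
  simp [momentVector]
  field_simp

theorem coordProd_start (hJ : 0 ≤ J) {v : ℝ} (hv : ∀ j, 0 ≤ 1 / 3 + momentVector α j * v)
    (hvJ : levelCubic α v = J ^ 2) : coordProd (startPoint α v) = J := by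
  simp only [coordProd, startPoint_apply]
  rw [← Complex.ofReal_mul, ← Complex.ofReal_mul, ← Real.sqrt_mul (hv 0),
    ← Real.sqrt_mul (mul_nonneg (hv 0) (hv 1)), ← levelCubic, hvJ, Real.sqrt_sq hJ]

theorem coordProd_zero (h : IsProfile α J Z) (hJ : 0 ≤ J) : coordProd (Z 0) = J := by
  obtain ⟨v, hv0, hv, hvJ, hst⟩ := h.start
  rw [hst, coordProd_start hJ hv hvJ]

theorem level_zero_nonpos (h : IsProfile α J Z) (hα : 0 ≤ α) : level α (Z 0) ≤ 0 := by
  obtain ⟨v, hv0, hv, hvJ, hst⟩ := h.start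
  rwa [hst, level_start hα hv]

theorem levelCubic_level_zero (h : IsProfile α J Z) (hα : 0 ≤ α) :
    levelCubic α (level α (Z 0)) = J ^ 2 := by
  obtain ⟨v, hv0, hv, hvJ, hst⟩ := h.start
  rwa [hst, level_start hα hv]

theorem start_eq (h : IsProfile α J Z) (hα : 0 ≤ α) : Z 0 = startPoint α (level α (Z 0)) := by
  obtain ⟨v, hv0, hv, hvJ, hst⟩ := h.start
  rw [hst, level_start hα hv]

theorem coordProd_re (h : IsProfile α J Z) (hJ : 0 ≤ J) (t : ℝ) : (coordProd (Z t)).re = J := by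
  rw [coordProd_re_const (b := fun _ => 0) (c := fun _ => 1) h.flow' t 0, h.coordProd_zero hJ,
    Complex.ofReal_re]

theorem levelCubic_level (h : IsProfile α J Z) (hα : 0 ≤ α) (t : ℝ) :
    levelCubic α (level α (Z t)) = normSq (coordProd (Z t)) := by
  rw [normSq_coordProd, h.normSq_eq hα, h.normSq_eq hα, h.normSq_eq hα, levelCubic]

/-- Since Re P = J, the cubic at any level reached is |P|² ≥ J², its value at the start, and the
cubic is increasing on v ≤ 0. So the starting level can be read off from the surface. -/
theorem level_zero_le (h : IsProfile α J Z) (hα : α ∈ Set.Icc (0 : ℝ) 1) (hJ : 0 ≤ J) (t : ℝ) :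
    level α (Z 0) ≤ level α (Z t) := by
  by_contra! hlt
  have h1 := levelCubic_lt hα hlt (h.level_zero_nonpos hα.1)
  rw [h.levelCubic_level_zero hα.1, h.levelCubic_level hα.1, Complex.normSq_apply,
    h.coordProd_re hJ] at h1
  nlinarith [mul_self_nonneg (coordProd (Z t)).im]

theorem hasDerivAt_level (h : IsProfile α J Z) (hα : 0 ≤ α) (t : ℝ) :
    HasDerivAt (fun t => level α (Z t)) (2 * (coordProd (Z t)).im) t := by
  simpa using _root_.hasDerivAt_level hα (h.flow' t)

theorem hasDerivAt_coordProd_im (h : IsProfile α J Z) (hα : 0 ≤ α) (t : ℝ) :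
    HasDerivAt (fun t => (coordProd (Z t)).im) (levelCubicDeriv α (level α (Z t))) t := by
  simpa using _root_.hasDerivAt_coordProd_im (h.flow' t) (h.normSq_eq hα t)

/-- Flow lines on the sphere are determined by their value at one time. -/
theorem eq_of_flow (h : IsProfile α J Z) {Y : ℝ → C3}
    (hY : ∀ t, HasDerivAt Y (flowField α (Y t)) t) (hY1 : ∀ t, ‖Y t‖ ≤ 1) {t₀ : ℝ}
    (h0 : Z t₀ = Y t₀) : Z = Y :=
  integralCurve_unique (b := fun _ => 0) (c := fun _ => 1) (R := 1) (contDiff_flowField α)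
    (generator α) continuous_const continuous_const h.flow' (fun t => (h.norm_eq t).le)
    (fun t => by simpa using hY t) hY1 h0

theorem coord_zero_ne (h : IsProfile α J Z) (hα : α ∈ Set.Icc (0 : ℝ) 1) : Z 0 0 ≠ 0 := by
  obtain ⟨v, hv0, hv, hvJ, hst⟩ := h.start
  have hn := normSq_startPoint hv 0
  rw [← hst] at hn
  intro h0
  rw [h0, map_zero] at hn
  simp [momentVector] at hn
  nlinarith [hα.1]

/-- A zero of the generator has z₀ = z₂ = 0. Every component of the flow field contains one of these
coordinates, so the profile would be constant there; but it starts with z₀ ≠ 0. -/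
theorem generator_ne_zero (h : IsProfile α J Z) (hα : α ∈ Set.Icc (0 : ℝ) 1) (t : ℝ) :
    generator α (Z t) ≠ 0 := by
  intro hA
  have h0 : Z t 0 = 0 := by
    have := congrArg (fun z : C3 => z 0) hA
    simpa [weight] using this
  have h2 : Z t 2 = 0 := by
    have := congrArg (fun z : C3 => z 2) hA
    have hne : (-1 - α : ℂ) ≠ 0 := by
      have : (-1 - α : ℝ) ≠ 0 := by linarith [hα.1]
      exact_mod_cast this
    simpa [weight, hne] using this
  have hV : flowField α (Z t) = 0 := by
    ext j
    fin_cases j <;> simp [h0, h2]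
  have := h.eq_of_flow (Y := fun _ => Z t) (t₀ := t)
    (fun r => by simpa [hV] using hasDerivAt_const r (Z t)) (fun _ => (h.norm_eq t).le) rfl
  exact h.coord_zero_ne hα (by rw [this, h0])

end IsProfile

/-! ### Partial derivatives and unitary motions. -/

theorem partialS_eq {u : ℝ × ℝ → C3} (hu : ContDiff ℝ ∞ u) {s t : ℝ} {x : C3}
    (h : HasDerivAt (fun s => u (s, t)) x s) : partialS u (s, t) = x := by
  have hd : HasFDerivAt u (fderiv ℝ u (s, t)) (s, t) :=
    (hu.differentiable (by simp) (s, t)).hasFDerivAt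
  have hl : HasDerivAt (fun s : ℝ => (s, t)) ((1 : ℝ), (0 : ℝ)) s :=
    (hasDerivAt_id s).prodMk (hasDerivAt_const s t)
  exact (HasFDerivAt.comp_hasDerivAt s hd hl).unique h

theorem partialT_eq {u : ℝ × ℝ → C3} (hu : ContDiff ℝ ∞ u) {s t : ℝ} {x : C3}
    (h : HasDerivAt (fun t => u (s, t)) x t) : partialT u (s, t) = x := by
  have hd : HasFDerivAt u (fderiv ℝ u (s, t)) (s, t) :=
    (hu.differentiable (by simp) (s, t)).hasFDerivAt
  have hl : HasDerivAt (fun t : ℝ => (s, t)) ((0 : ℝ), (1 : ℝ)) t :=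
    (hasDerivAt_const t s).prodMk (hasDerivAt_id t)
  exact (HasFDerivAt.comp_hasDerivAt t hd hl).unique h

theorem hasDerivAt_partialT {u : ℝ × ℝ → C3} (hu : ContDiff ℝ ∞ u) (s t : ℝ) :
    HasDerivAt (fun t => u (s, t)) (partialT u (s, t)) t := by
  have hd : HasFDerivAt u (fderiv ℝ u (s, t)) (s, t) :=
    (hu.differentiable (by simp) (s, t)).hasFDerivAt
  have hl : HasDerivAt (fun t : ℝ => (s, t)) ((0 : ℝ), (1 : ℝ)) t :=
    (hasDerivAt_const t s).prodMk (hasDerivAt_id t)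
  exact HasFDerivAt.comp_hasDerivAt t hd hl

theorem fderiv_apply_eq_partial (u : ℝ × ℝ → C3) (p : ℝ × ℝ) (x y : ℝ) :
    fderiv ℝ u p (x, y) = x • partialS u p + y • partialT u p := by
  rw [partialS, partialT, ← map_smul, ← map_smul, ← map_add]
  simp

theorem inner_matAct {B : Matrix (Fin 3) (Fin 3) ℂ} (hB : B ∈ Matrix.unitaryGroup (Fin 3) ℂ)
    (x y : C3) : inner ℝ (matAct B x) (matAct B y) = inner ℝ x y := by
  have h1 : ∀ a b : C3, inner ℝ a b = (inner ℂ a b).re := fun _ _ => rfl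
  rw [h1, h1]
  congr 1
  change inner ℂ (Matrix.toEuclideanCLM (n := Fin 3) (𝕜 := ℂ) B x)
    (Matrix.toEuclideanCLM (n := Fin 3) (𝕜 := ℂ) B y) = _
  rw [← ContinuousLinearMap.adjoint_inner_left, ← ContinuousLinearMap.star_eq_adjoint, ← map_star,
    ← mul_apply_eq_comp, ← map_mul, (Matrix.mem_unitaryGroup_iff').1 hB, map_one,
    one_apply_eq_self]

theorem norm_matAct {B : Matrix (Fin 3) (Fin 3) ℂ} (hB : B ∈ Matrix.unitaryGroup (Fin 3) ℂ)
    (x : C3) : ‖matAct B x‖ = ‖x‖ := by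
  have h := inner_matAct hB x x
  rw [real_inner_self_eq_norm_sq, real_inner_self_eq_norm_sq] at h
  exact (sq_eq_sq₀ (norm_nonneg _) (norm_nonneg _)).1 h

theorem matAct_mul (B C : Matrix (Fin 3) (Fin 3) ℂ) (x : C3) :
    matAct (B * C) x = matAct B (matAct C x) := by
  simp [matAct]

theorem matAct_one (x : C3) : matAct 1 x = x := by
  simp [matAct]

theorem matAct_smul_one (c : ℂ) (x : C3) : matAct (c • 1) x = c • x := by
  simp [matAct]

theorem slagForm_matAct {θ θ' : ℝ} {B : Matrix (Fin 3) (Fin 3) ℂ}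
    (hB : Complex.exp (θ' * I) * B.det = Complex.exp (θ * I)) (x y z : C3) :
    slagForm θ' (matAct B x) (matAct B y) (matAct B z) = slagForm θ x y z := by
  have h : Matrix.of ![fun j => matAct B x j, fun j => matAct B y j, fun j => matAct B z j] =
      Matrix.of ![fun j => x j, fun j => y j, fun j => z j] * B.transpose := by
    ext i j
    fin_cases i <;> simp [matAct_apply, Matrix.mul_apply, mul_comm]
  rw [slagForm, slagForm, h, Matrix.det_mul, Matrix.det_transpose, ← hB]
  congr 1
  ring

theorem fderiv_matAct_comp (B : Matrix (Fin 3) (Fin 3) ℂ) {u : ℝ × ℝ → C3} (hu : ContDiff ℝ ∞ u)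
    (p : ℝ × ℝ) : fderiv ℝ (fun p => matAct B (u p)) p = (matAct B).comp (fderiv ℝ u p) :=
  ((matAct B).hasFDerivAt.comp p (hu.differentiable (by simp) p).hasFDerivAt).fderiv

theorem partialS_matAct (B : Matrix (Fin 3) (Fin 3) ℂ) {u : ℝ × ℝ → C3} (hu : ContDiff ℝ ∞ u)
    (p : ℝ × ℝ) : partialS (fun p => matAct B (u p)) p = matAct B (partialS u p) := by
  rw [partialS, fderiv_matAct_comp B hu]
  rfl

theorem partialT_matAct (B : Matrix (Fin 3) (Fin 3) ℂ) {u : ℝ × ℝ → C3} (hu : ContDiff ℝ ∞ u)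
    (p : ℝ × ℝ) : partialT (fun p => matAct B (u p)) p = matAct B (partialT u p) := by
  rw [partialT, fderiv_matAct_comp B hu]
  rfl

/-- A unitary map of determinant `e^{i(θ - θ')}` carries `θ`-special Legendrian immersions to
`θ'`-special Legendrian ones. -/
theorem IsSpecialLegendrianImmersion.matAct {θ θ' : ℝ} {u : ℝ × ℝ → C3}
    (hu : IsSpecialLegendrianImmersion θ u) {B : Matrix (Fin 3) (Fin 3) ℂ}
    (hB : B ∈ Matrix.unitaryGroup (Fin 3) ℂ)
    (hdet : Complex.exp (θ' * I) * B.det = Complex.exp (θ * I)) :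
    IsSpecialLegendrianImmersion θ' (fun p => matAct B (u p)) where
  smooth := (_root_.matAct B).contDiff.comp hu.smooth
  mem_sphere p := by rw [norm_matAct hB, hu.mem_sphere]
  immersion p := by
    rw [fderiv_matAct_comp B hu.smooth]
    intro x y hxy
    have h0 : _root_.matAct B (fderiv ℝ u p (x - y)) = 0 := by
      rw [map_sub, map_sub]
      exact sub_eq_zero.2 hxy
    have h1 := norm_matAct hB (fderiv ℝ u p (x - y))
    rw [h0, norm_zero, eq_comm, norm_eq_zero, map_sub, sub_eq_zero] at h1
    exact hu.immersion p h1
  calibrated := by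
    obtain ⟨ε, hε, h⟩ := hu.calibrated
    refine ⟨ε, hε, fun p => ?_⟩
    rw [slagNormal, partialS_matAct B hu.smooth, partialT_matAct B hu.smooth,
      slagForm_matAct hdet, areaDensity, partialS_matAct B hu.smooth, partialT_matAct B hu.smooth,
      norm_matAct hB, norm_matAct hB, inner_matAct hB]
    exact h p

theorem IsConformalParam.matAct {u : ℝ × ℝ → C3} (hu : IsConformalParam u)
    (hs : ContDiff ℝ ∞ u) {B : Matrix (Fin 3) (Fin 3) ℂ}
    (hB : B ∈ Matrix.unitaryGroup (Fin 3) ℂ) : IsConformalParam (fun p => matAct B (u p)) := by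
  intro p
  rw [partialS_matAct B hs, partialT_matAct B hs, norm_matAct hB, norm_matAct hB, inner_matAct hB]
  exact hu p

/-! ### Swept surfaces are conformal and special Legendrian. -/

theorem coordProd_rotate (α s : ℝ) (z : C3) : coordProd (rotate α s z) = coordProd z := by
  have : Complex.exp (I * (weight α 0 * s : ℝ)) * Complex.exp (I * (weight α 1 * s : ℝ)) *
      Complex.exp (I * (weight α 2 * s : ℝ)) = 1 := by
    rw [← Complex.exp_add, ← Complex.exp_add, ← mul_add, ← mul_add, ← Complex.ofReal_add,
      ← Complex.ofReal_add, ← add_mul, ← add_mul, weight_sum]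
    simp
  simp only [coordProd, rotate_apply]
  linear_combination (z 0 * z 1 * z 2) * this

/-- The surface swept out by a profile under the one-parameter group. -/
noncomputable def sweep (α : ℝ) (Z : ℝ → C3) (p : ℝ × ℝ) : C3 := rotate α p.1 (Z p.2)

theorem contDiff_sweep (α : ℝ) {Z : ℝ → C3} (hZ : ContDiff ℝ ∞ Z) : ContDiff ℝ ∞ (sweep α Z) := by
  rw [contDiff_C3]
  intro j
  simp only [sweep, rotate_apply]
  have h1 : ContDiff ℝ ∞ fun p : ℝ × ℝ => Z p.2 j :=
    (contDiff_coord j).comp (hZ.comp contDiff_snd)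
  have h2 : ContDiff ℝ ∞ fun p : ℝ × ℝ => I * ((weight α j * p.1 : ℝ) : ℂ) :=
    contDiff_const.mul (Complex.ofRealCLM.contDiff.comp (contDiff_const.mul contDiff_fst))
  exact h2.cexp.mul h1

section pointwise

variable {α : ℝ} {x : C3}

/-- The j-th coordinate contributes Re P times the product of weight and μ_j, and weights and μ are
orthogonal. -/
theorem inner_generator_flowField (x : C3) : inner ℝ (generator α x) (flowField α x) = 0 := by
  have h := weight_momentVector_sum α
  rw [inner_real_C3]
  simp [Fin.sum_univ_three]
  linear_combination ((x 0).re * (x 1).re * (x 2).re - (x 0).re * (x 1).im * (x 2).im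
    - (x 0).im * (x 1).re * (x 2).im - (x 0).im * (x 1).im * (x 2).re) * h

theorem norm_generator_sq (x : C3) :
    ‖generator α x‖ ^ 2 = ∑ j, weight α j ^ 2 * normSq (x j) := by
  rw [norm_sq_C3]
  refine Finset.sum_congr rfl fun j _ => ?_
  rw [generator_apply, map_mul, map_mul, Complex.normSq_I, Complex.normSq_ofReal]
  ring

theorem norm_flowField_sq (x : C3) : ‖flowField α x‖ ^ 2 =
    ∑ j, momentVector α j ^ 2 * (normSq (x (j + 1)) * normSq (x (j + 2))) := by
  rw [norm_sq_C3]
  refine Finset.sum_congr rfl fun j _ => ?_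
  rw [flowField_apply, map_mul, map_mul, Complex.normSq_I, Complex.normSq_ofReal,
    Complex.normSq_conj, map_mul]
  ring

/-- This is Lagrange's identity |z × y|² = |z|²|y|² - |⟨z, y⟩|² for y = Az, where |z| = 1 and ⟨z,
Az⟩ = 0. -/
theorem norm_generator_eq (h1 : ∑ j, normSq (x j) = 1) (h0 : ∑ j, weight α j * normSq (x j) = 0) :
    ‖generator α x‖ = ‖flowField α x‖ := by
  refine (sq_eq_sq₀ (norm_nonneg _) (norm_nonneg _)).1 ?_
  rw [norm_generator_sq, norm_flowField_sq]
  simp only [Fin.sum_univ_three] at *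
  simp [weight, momentVector] at *
  linear_combination -(normSq (x 0) + α ^ 2 * normSq (x 1) + (-1 - α) ^ 2 * normSq (x 2)) * h1
    + (normSq (x 0) + α * normSq (x 1) + (-1 - α) * normSq (x 2)) * h0

/-- Re det(x, Ax, ·) is the inner product with the conjugate cross product of x and Ax, which is
minus the flow field. Hence the sweeps are calibrated with the sign -1. -/
theorem slagForm_generator_flowField (x : C3) :
    slagForm 0 x (generator α x) (flowField α x) = -‖flowField α x‖ ^ 2 := by
  rw [slagForm, norm_flowField_sq, Matrix.det_fin_three]
  have hμ : momentVector α 0 = weight α 2 - weight α 1 ∧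
      momentVector α 1 = weight α 0 - weight α 2 ∧ momentVector α 2 = weight α 1 - weight α 0 := by
    simp [momentVector, weight]
    constructor <;> ring
  simp [Fin.sum_univ_three, hμ.1, hμ.2.1, hμ.2.2, Complex.normSq_apply]
  ring

end pointwise

namespace IsProfile

variable {α J : ℝ} {Z : ℝ → C3}

theorem partialS_sweep (h : IsProfile α J Z) (p : ℝ × ℝ) :
    partialS (sweep α Z) p = generator α (sweep α Z p) :=
  partialS_eq (contDiff_sweep α h.contDiff) (hasDerivAt_rotate α (Z p.2) p.1)

theorem partialT_sweep (h : IsProfile α J Z) (p : ℝ × ℝ) :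
    partialT (sweep α Z) p = flowField α (sweep α Z p) := by
  refine partialT_eq (contDiff_sweep α h.contDiff) ?_
  rw [sweep, flowField_rotate, hasDerivAt_C3]
  intro j
  exact (hasDerivAt_C3.1 (h.flow p.2) j).const_mul (Complex.exp (I * (weight α j * p.1 : ℝ)))

theorem normSq_sweep (p : ℝ × ℝ) (j : Fin 3) : normSq (sweep α Z p j) = normSq (Z p.2 j) :=
  normSq_rotate _ _ _ _

theorem generator_rotate_ne_zero (h : IsProfile α J Z) (hα : α ∈ Set.Icc (0 : ℝ) 1) (p : ℝ × ℝ) :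
    generator α (sweep α Z p) ≠ 0 := by
  have hn : ‖generator α (sweep α Z p)‖ ^ 2 = ‖generator α (Z p.2)‖ ^ 2 := by
    simp only [norm_generator_sq, normSq_sweep]
  intro h0
  rw [h0, norm_zero, zero_pow two_ne_zero, eq_comm, sq_eq_zero_iff, norm_eq_zero] at hn
  exact h.generator_ne_zero hα p.2 hn

theorem norm_generator_sweep (h : IsProfile α J Z) (p : ℝ × ℝ) :
    ‖generator α (sweep α Z p)‖ = ‖flowField α (sweep α Z p)‖ :=
  norm_generator_eq (by simpa only [normSq_sweep] using h.sum_normSq p.2)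
    (by simpa only [normSq_sweep] using h.sum_weight_normSq p.2)

theorem isConformalParam (h : IsProfile α J Z) : IsConformalParam (sweep α Z) := by
  intro p
  rw [h.partialS_sweep, h.partialT_sweep]
  exact ⟨h.norm_generator_sweep p, inner_generator_flowField _⟩

theorem isSpecialLegendrianImmersion (h : IsProfile α J Z) (hα : α ∈ Set.Icc (0 : ℝ) 1) :
    IsSpecialLegendrianImmersion 0 (sweep α Z) where
  smooth := contDiff_sweep α h.contDiff
  mem_sphere p := by rw [sweep, norm_rotate, h.norm_eq]
  immersion p := by
    rw [injective_iff_map_eq_zero]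
    rintro ⟨x, y⟩ hxy
    rw [fderiv_apply_eq_partial, h.partialS_sweep, h.partialT_sweep] at hxy
    have hA := h.generator_rotate_ne_zero hα p
    have hn := h.norm_generator_sweep p
    set a := generator α (sweep α Z p)
    set b := flowField α (sweep α Z p)
    have hab : inner ℝ a b = 0 := inner_generator_flowField _
    have hb : b ≠ 0 := by
      rw [← norm_ne_zero_iff] at hA ⊢
      rwa [← hn]
    have h1 := congrArg (fun w => inner ℝ a w) hxy
    have h2 := congrArg (fun w => inner ℝ b w) hxy
    simp only [inner_add_right, inner_smul_right, hab, real_inner_comm a b, inner_zero_right,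
      mul_zero, add_zero, zero_add, mul_eq_zero, inner_self_eq_zero, hA, hb, or_false] at h1 h2
    rw [h1, h2]
    rfl
  calibrated := by
    refine ⟨-1, Or.inr rfl, fun p => ?_⟩
    rw [slagNormal, areaDensity, h.partialS_sweep, h.partialT_sweep, slagForm_generator_flowField,
      inner_generator_flowField, h.norm_generator_sweep]
    rw [show ∀ r : ℝ, r ^ 2 * r ^ 2 - 0 ^ 2 = (r ^ 2) ^ 2 by intro r; ring,
      Real.sqrt_sq (by positivity)]
    ring

end IsProfile

/-! ### The family for general θ. -/

/-- The phase `e^{-iθ/3}`, whose cube is `e^{-iθ}`. -/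
noncomputable def phase (θ : ℝ) : ℂ := Complex.exp (I * ((-(θ / 3) : ℝ) : ℂ))

theorem phase_cube (θ : ℝ) : Complex.exp (θ * I) * phase θ ^ 3 = 1 := by
  rw [phase, ← Complex.exp_nat_mul, ← Complex.exp_add, Complex.exp_eq_one_iff]
  refine ⟨0, ?_⟩
  push_cast
  ring

theorem conj_phase_mul (θ : ℝ) : conj (phase θ) * phase θ = 1 := by
  rw [← Complex.normSq_eq_conj_mul_self, phase, normSq_exp_I_mul, Complex.ofReal_one]

theorem smul_one_mem_unitary {c : ℂ} (hc : conj c * c = 1) :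
    c • (1 : Matrix (Fin 3) (Fin 3) ℂ) ∈ Matrix.unitaryGroup (Fin 3) ℂ := by
  rw [Matrix.mem_unitaryGroup_iff']
  ext i j
  simp only [star_smul, star_one, Matrix.mul_smul, mul_one, Matrix.smul_apply, smul_eq_mul,
    RCLike.star_def]
  linear_combination (1 : Matrix (Fin 3) (Fin 3) ℂ) i j * hc

theorem det_smul_one (c : ℂ) : (c • (1 : Matrix (Fin 3) (Fin 3) ℂ)).det = c ^ 3 := by
  simp

/-- The family of conformal equivariant `θ`-special Legendrian immersions. -/
noncomputable def legendrianFamily (θ α J : ℝ) (p : ℝ × ℝ) : C3 :=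
  matAct (phase θ • 1) (sweep α (profile α J) p)

theorem legendrianFamily_properties (θ : ℝ) {α J : ℝ} (hα : α ∈ Set.Icc (0 : ℝ) 1)
    (hJ : J ∈ Set.Icc (0 : ℝ) maxJ) :
    IsSpecialLegendrianImmersion θ (legendrianFamily θ α J) ∧
      IsInvariantUnder (generator α) (legendrianFamily θ α J) ∧
      IsConformalParam (legendrianFamily θ α J) ∧
      HasAngularMomenta (legendrianFamily θ α J) (fun j => J * momentVector α j) := by
  have h := isProfile_profile hα hJ
  have hs := contDiff_sweep α h.contDiff
  have hU := smul_one_mem_unitary (conj_phase_mul θ)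
  refine ⟨(h.isSpecialLegendrianImmersion hα).matAct hU ?_, fun σ s t => ?_,
    h.isConformalParam.matAct hs hU, fun p j => ?_⟩
  · rw [det_smul_one, phase_cube]
    simp
  · rw [exp_smul_generator, legendrianFamily, legendrianFamily, matAct_smul_one, matAct_smul_one,
      sweep, sweep]
    simp only
    rw [← rotate_add]
    ext j
    simp
    ring
  · unfold legendrianFamily
    rw [partialT_matAct _ hs, h.partialT_sweep, matAct_smul_one, matAct_smul_one]
    have hre : (coordProd (sweep α (profile α J) p)).re = J := by
      rw [sweep, coordProd_rotate, h.coordProd_re hJ.1]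
    set x := sweep α (profile α J) p
    have hn := Complex.normSq_apply (phase θ)
    rw [phase, normSq_exp_I_mul, ← phase] at hn
    -- The product is i μ_j times the conjugate of P, so its imaginary part is μ_j Re P. The phase
    -- has modulus one and cancels.
    have hx : (conj (x j) * flowField α x j).im = J * momentVector α j := by
      rw [← hre]
      fin_cases j <;> simp [coordProd] <;> ring
    refine Eq.trans ?_ hx
    simp only [PiLp.smul_apply, smul_eq_mul, Complex.mul_re, Complex.mul_im, Complex.conj_re,
      Complex.conj_im]
    linear_combination -((x j).re * (flowField α x j).im - (x j).im * (flowField α x j).re) * hn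

/-! ### The Clifford tori in the family. -/

theorem inv_sqrt_three_sq : (1 / √3 : ℝ) * (1 / √3) = 1 / 3 := by
  rw [div_mul_div_comm, Real.mul_self_sqrt (by norm_num)]
  norm_num

theorem hasDerivAt_cexp_I_mul (x t : ℝ) :
    HasDerivAt (fun t : ℝ => Complex.exp (I * ((x * t : ℝ) : ℂ)))
      (I * x * Complex.exp (I * ((x * t : ℝ) : ℂ))) t := by
  have h1 : HasDerivAt (fun t : ℝ => I * ((x * t : ℝ) : ℂ)) (I * (x : ℝ)) t := by
    have := ((hasDerivAt_id t).const_mul x).ofReal_comp.const_mul I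
    simpa using this
  exact h1.cexp.congr_deriv (by ring)

namespace IsProfile

variable {α J : ℝ} {Z : ℝ → C3}

/-- Only v = 0 has v ≤ 0 and cubic 1/27, so all moduli are 1/√3 at the start. From there each
coordinate rotates with constant speed, because μ sums to zero. -/
theorem eq_of_maxJ (h : IsProfile α maxJ Z) (hα : α ∈ Set.Icc (0 : ℝ) 1) (t : ℝ) (j : Fin 3) :
    Z t j = ((1 / √3 : ℝ) : ℂ) * Complex.exp (I * ((3 * maxJ * momentVector α j * t : ℝ) : ℂ)) := by
  have hv : level α (Z 0) = 0 := by
    refine levelCubic_injOn hα (h.level_zero_nonpos hα.1) le_rfl ?_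
    rw [h.levelCubic_level_zero hα.1, levelCubic_zero, maxJ_sq]
  have hJ : 3 * maxJ * (1 / √3) = 1 / 3 := by
    rw [maxJ, mul_one_div, mul_one_div, div_div, mul_assoc, Real.mul_self_sqrt (by norm_num)]
    norm_num
  let Y : ℝ → C3 := fun t => WithLp.toLp 2 fun j =>
    ((1 / √3 : ℝ) : ℂ) * Complex.exp (I * ((3 * maxJ * momentVector α j * t : ℝ) : ℂ))
  have hYj : ∀ t j, Y t j = ((1 / √3 : ℝ) : ℂ) *
    Complex.exp (I * ((3 * maxJ * momentVector α j * t : ℝ) : ℂ)) := fun _ _ => rfl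
  have hY : ∀ t, HasDerivAt Y (flowField α (Y t)) t := by
    intro t
    rw [hasDerivAt_C3]
    intro j
    have := (hasDerivAt_cexp_I_mul (3 * maxJ * momentVector α j) t).const_mul ((1 / √3 : ℝ) : ℂ)
    refine this.congr_deriv ?_
    have key : ∀ j : Fin 3, 3 * maxJ * momentVector α j * t =
        -(3 * maxJ * momentVector α (j + 1) * t) + -(3 * maxJ * momentVector α (j + 2) * t) := by
      have h := momentVector_sum α
      intro j
      fin_cases j <;> simp <;> linear_combination 3 * maxJ * t * h
    rw [flowField_apply, hYj, hYj]
    simp only [map_mul, Complex.conj_ofReal, conj_exp_I_mul]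
    rw [key j, Complex.ofReal_add, mul_add, Complex.exp_add]
    have h1 : ((3 * maxJ * (1 / √3) : ℝ) : ℂ) = ((1 / √3 * (1 / √3) : ℝ) : ℂ) := by
      rw [hJ, inv_sqrt_three_sq]
    simp only [Complex.ofReal_neg, mul_neg]
    push_cast at h1 ⊢
    linear_combination (I * momentVector α j *
      Complex.exp (-(I * (3 * maxJ * momentVector α (j + 1) * t))) *
      Complex.exp (-(I * (3 * maxJ * momentVector α (j + 2) * t)))) * h1
  have hY1 : ∀ t, ‖Y t‖ ≤ 1 := by
    intro t
    have : ‖Y t‖ ^ 2 = 1 := by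
      rw [norm_sq_C3]
      simp only [hYj, map_mul, normSq_exp_I_mul, Complex.normSq_ofReal, inv_sqrt_three_sq]
      norm_num
    nlinarith [norm_nonneg (Y t)]
  have h0 : Z 0 = Y 0 := by
    rw [h.start_eq hα.1, hv]
    ext j
    simp [hYj]
  rw [h.eq_of_flow hY hY1 h0]

theorem range_sweep_of_maxJ (h : IsProfile α maxJ Z) (hα : α ∈ Set.Icc (0 : ℝ) 1) :
    Set.range (sweep α Z) = cliffordTorus 0 := by
  have hval : ∀ s t j, sweep α Z (s, t) j = ((1 / √3 : ℝ) : ℂ) * Complex.exp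
      (((weight α j * s + 3 * maxJ * momentVector α j * t : ℝ) : ℂ) * I) := by
    intro s t j
    rw [sweep, rotate_apply, h.eq_of_maxJ hα, mul_left_comm, ← Complex.exp_add]
    congr 2
    push_cast
    ring
  ext x
  constructor
  · rintro ⟨⟨s, t⟩, rfl⟩
    refine ⟨fun j => weight α j * s + 3 * maxJ * momentVector α j * t, ?_, hval s t⟩
    rw [Fin.sum_univ_three]
    linear_combination s * weight_sum α + 3 * maxJ * t * momentVector_sum α
  · rintro ⟨b, hb, hx⟩
    have hE : 1 + α + α ^ 2 ≠ 0 := by nlinarith [hα.1]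
    have hJ := maxJ_pos.ne'
    rw [Fin.sum_univ_three] at hb
    -- The weights and μ form an orthogonal basis of the angle vectors with sum zero, with squared
    -- lengths 2(1 + α + α²) and 6(1 + α + α²); s and t are the coefficients of b in this basis.
    refine ⟨((b 0 + α * b 1 + (-1 - α) * b 2) / (2 * (1 + α + α ^ 2)),
      ((-1 - 2 * α) * b 0 + (2 + α) * b 1 + (α - 1) * b 2) / (18 * maxJ * (1 + α + α ^ 2))), ?_⟩
    ext j
    rw [hval, hx]
    congr 4
    have hb2 : b 2 = -b 0 - b 1 := by linarith
    fin_cases j <;> simp [weight, momentVector, hb2] <;> field_simp <;> ring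

/-- Here μ = (-3, 3, 0): the third coordinate stays 1/√3 and the other two solve a linear system
with solutions in e^{±i√3t}. The first two weights agree, so a real rotation of these coordinates
commutes with the group, and such a rotation carries the torus to the surface. -/
theorem range_sweep_of_one (h : IsProfile 1 J Z) :
    ∃ B ∈ Matrix.specialUnitaryGroup (Fin 3) ℂ,
      Set.range (sweep 1 Z) = matAct B '' cliffordTorus 0 := by
  obtain ⟨v, hv0, hv, hvJ, hst⟩ := h.start
  have e0 := hv 0
  have e1 := hv 1
  simp [momentVector] at e0 e1
  set r0 := √(1 / 3 + (-1 - 2) * v) with hr0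
  set r1 := √(1 / 3 + (2 + 1) * v) with hr1
  have hs0 : r0 * r0 = 1 / 3 - 3 * v := by
    rw [hr0, Real.mul_self_sqrt (by linarith)]
    ring
  have hs1 : r1 * r1 = 1 / 3 + 3 * v := by
    rw [hr1, Real.mul_self_sqrt (by linarith)]
    ring
  have h3 : √3 * √3 = (3 : ℝ) := Real.mul_self_sqrt (by norm_num)
  have h3' : ((√3 : ℝ) : ℂ) * (√3 : ℝ) = 3 := by
    rw [← Complex.ofReal_mul, h3]
    norm_num
  have h3ne : ((√3 : ℝ) : ℂ) ≠ 0 := by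
    have : √3 ≠ (0 : ℝ) := by positivity
    exact_mod_cast this
  let E : ℝ → ℂ := fun x => Complex.exp (I * ((√3 * x : ℝ) : ℂ))
  have hE : ∀ t, HasDerivAt E (I * √3 * E t) t := fun t => hasDerivAt_cexp_I_mul _ t
  let E' : ℝ → ℂ := fun x => Complex.exp (I * ((-√3 * x : ℝ) : ℂ))
  have hE' : ∀ t, HasDerivAt E' (I * (-√3 : ℝ) * E' t) t := fun t => hasDerivAt_cexp_I_mul _ t
  have hconj : ∀ t, conj (E t) = E' t := by
    intro t
    simp only [E, E', conj_exp_I_mul]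
    simp
  have hconj' : ∀ t, conj (E' t) = E t := by
    intro t
    simp only [E, E', conj_exp_I_mul]
    simp
  let Y : ℝ → C3 := fun t => WithLp.toLp 2 ![((r0 - r1) * E t + (r0 + r1) * E' t) / 2,
    ((r0 + r1) * E t + (r1 - r0) * E' t) / 2, ((1 / √3 : ℝ) : ℂ)]
  have hY : ∀ t, HasDerivAt Y (flowField 1 (Y t)) t := by
    intro t
    rw [hasDerivAt_C3]
    intro j
    fin_cases j
    · have := (((hE t).const_mul (r0 - r1 : ℂ)).add ((hE' t).const_mul (r0 + r1 : ℂ))).div_const 2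
      refine this.congr_deriv ?_
      simp [Y, momentVector, hconj, hconj', map_ofNat]
      field_simp
      linear_combination ((r0 - r1) * E t - (r0 + r1) * E' t) * h3'
    · have := (((hE t).const_mul (r0 + r1 : ℂ)).add ((hE' t).const_mul (r1 - r0 : ℂ))).div_const 2
      refine this.congr_deriv ?_
      simp [Y, momentVector, hconj, hconj', map_ofNat]
      field_simp
      linear_combination ((r0 + r1) * E t - (r1 - r0) * E' t) * h3'
    · simpa [Y, momentVector] using hasDerivAt_const t (((1 / √3 : ℝ) : ℂ))
  have hZ0 : Z 0 = Y 0 := by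
    rw [hst]
    ext j
    fin_cases j <;> simp [Y, E, E', momentVector, r0, r1] <;> ring
  have hZnorm : ∀ t, ‖Y t‖ ≤ 1 := by
    have hY' : ∀ t, HasDerivAt Y ((0 : ℝ) • generator 1 (Y t) + (1 : ℝ) • flowField 1 (Y t)) t :=
      fun t => by simpa using hY t
    intro t
    have := sum_normSq_const (b := fun _ => 0) (c := fun _ => 1) hY' (fun _ => 1)
      (by simpa [Fin.sum_univ_three] using momentVector_sum 1) t 0
    simp only [one_mul, ← norm_sq_C3] at this
    rw [← hZ0, h.norm_eq] at this
    nlinarith [norm_nonneg (Y t)]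
  have hZ := h.eq_of_flow hY hZnorm hZ0
  -- The rotation with entries p, q takes (e^{-i√3t}, e^{i√3t}, 1)/√3 to the profile; p² + q² = 1
  -- because r0² + r1² = 2/3.
  set p : ℝ := √3 * (r0 - r1) / 2 with hp
  set q : ℝ := √3 * (r0 + r1) / 2 with hq
  have hpq : p * p + q * q = 1 := by
    rw [hp, hq]
    linear_combination ((r0 * r0 + r1 * r1) / 2) * h3 + (3 / 2) * hs0 + (3 / 2) * hs1
  have hpqC : (p : ℂ) * p + q * q = 1 := by exact_mod_cast hpq
  let B : Matrix (Fin 3) (Fin 3) ℂ := !![(q : ℂ), p, 0; -p, q, 0; 0, 0, 1]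
  have hB : B ∈ Matrix.specialUnitaryGroup (Fin 3) ℂ := by
    rw [Matrix.mem_specialUnitaryGroup_iff, Matrix.mem_unitaryGroup_iff]
    constructor
    · ext i j
      fin_cases i <;> fin_cases j <;> simp [B, Matrix.mul_apply, Fin.sum_univ_three] <;>
        first | linear_combination hpqC | ring
    · simp [B, Matrix.det_fin_three]
      linear_combination hpqC
  have hval : ∀ s t (z : C3), (∀ j, z j = ((1 / √3 : ℝ) : ℂ) * Complex.exp
      (((![s - √3 * t, s + √3 * t, -2 * s] j : ℝ) : ℂ) * I)) → sweep 1 Z (s, t) = matAct B z := by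
    intro s t z hz
    have x0 : z 0 = ((1 / √3 : ℝ) : ℂ) * (Complex.exp (I * s) * E' t) := by
      rw [hz, ← Complex.exp_add]
      congr 2
      simp
      ring
    have x1 : z 1 = ((1 / √3 : ℝ) : ℂ) * (Complex.exp (I * s) * E t) := by
      rw [hz, ← Complex.exp_add]
      congr 2
      simp
      ring
    have x2 : z 2 = ((1 / √3 : ℝ) : ℂ) * Complex.exp (I * ((-2 * s : ℝ) : ℂ)) := by
      rw [hz]
      congr 2
      simp
      ring
    ext j
    rw [sweep, rotate_apply, matAct_apply, Fin.sum_univ_three, x0, x1, x2, hZ]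
    fin_cases j
    · simp [weight, Y, B, hp, hq]
      field_simp
      ring
    · simp [weight, Y, B, hp, hq]
      field_simp
      ring
    · simp [weight, Y, B, mul_comm]
      congr 1
      ring
  refine ⟨B, hB, ?_⟩
  ext x
  constructor
  · rintro ⟨⟨s, t⟩, rfl⟩
    refine ⟨WithLp.toLp 2 fun j => ((1 / √3 : ℝ) : ℂ) * Complex.exp
      (((![s - √3 * t, s + √3 * t, -2 * s] j : ℝ) : ℂ) * I), ⟨_, ?_, fun j => rfl⟩,
      (hval s t _ fun j => rfl).symm⟩
    simp [Fin.sum_univ_three]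
    ring
  · rintro ⟨z, ⟨b, hb, hz⟩, rfl⟩
    refine ⟨((b 0 + b 1) / 2, (b 1 - b 0) / (2 * √3)), hval _ _ z fun j => ?_⟩
    rw [hz]
    congr 4
    rw [Fin.sum_univ_three] at hb
    have hne : √3 ≠ (0 : ℝ) := by positivity
    fin_cases j <;> simp
    · field_simp
      ring
    · field_simp
      ring
    · linarith

end IsProfile

theorem smul_mem_cliffordTorus {θ φ : ℝ} {z : C3} (hz : z ∈ cliffordTorus φ) :
    phase θ • z ∈ cliffordTorus (φ - θ) := by
  obtain ⟨a, ha, hz⟩ := hz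
  refine ⟨fun j => a j - θ / 3, ?_, fun j => ?_⟩
  · rw [← ha]
    simp [Fin.sum_univ_three]
    ring
  · rw [PiLp.smul_apply, hz, phase, smul_eq_mul, mul_left_comm, ← Complex.exp_add]
    congr 2
    push_cast
    ring

theorem exists_range_eq_cliffordTorus (θ : ℝ) {α J : ℝ} (hα : α ∈ Set.Icc (0 : ℝ) 1)
    (hJ : J ∈ Set.Icc (0 : ℝ) maxJ) (h : α = 1 ∨ J = maxJ) :
    ∃ φ : ℝ, ∃ B ∈ Matrix.specialUnitaryGroup (Fin 3) ℂ,
      Set.range (legendrianFamily θ α J) = matAct B '' cliffordTorus φ := by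
  have hP := isProfile_profile hα hJ
  obtain ⟨B, hB, hr⟩ : ∃ B ∈ Matrix.specialUnitaryGroup (Fin 3) ℂ,
      Set.range (sweep α (profile α J)) = matAct B '' cliffordTorus 0 := by
    rcases h with rfl | rfl
    · exact hP.range_sweep_of_one
    · refine ⟨1, one_mem _, ?_⟩
      rw [hP.range_sweep_of_maxJ hα]
      simp [matAct_one]
  have hsm : ∀ x : C3, phase θ • matAct B x = matAct B (phase θ • x) := by
    intro x
    ext j
    simp [matAct_apply, Finset.mul_sum, mul_left_comm]
  refine ⟨0 - θ, B, hB, ?_⟩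
  have hfam : legendrianFamily θ α J = fun p => phase θ • sweep α (profile α J) p :=
    funext fun p => matAct_smul_one _ _
  rw [hfam]
  ext x
  constructor
  · rintro ⟨p, rfl⟩
    obtain ⟨z, hz, hzp⟩ : sweep α (profile α J) p ∈ matAct B '' cliffordTorus 0 :=
      hr ▸ Set.mem_range_self p
    refine ⟨phase θ • z, smul_mem_cliffordTorus hz, ?_⟩
    rw [← hsm, hzp]
  · rintro ⟨z, hz, rfl⟩
    have h1 := smul_mem_cliffordTorus (θ := -θ) hz
    rw [zero_sub, sub_self] at h1
    obtain ⟨p, hp⟩ : matAct B (phase (-θ) • z) ∈ Set.range (sweep α (profile α J)) :=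
      hr ▸ Set.mem_image_of_mem _ h1
    refine ⟨p, ?_⟩
    have h2 : phase θ * phase (-θ) = 1 := by
      rw [phase, phase, ← Complex.exp_add]
      simp [neg_div]
    simp only
    rw [hp, hsm, smul_smul, h2, one_smul]

/-! ### Quadratic forms along the orbits as trigonometric sums. -/

/-- Every real-linear endomorphism of `ℂ³` is the sum of a linear and an antilinear one. -/
theorem exists_linear_add_antilinear (L : C3 →L[ℝ] C3) : ∃ H G : Fin 3 → Fin 3 → ℂ,
    ∀ x j, L x j = ∑ k, (H j k * x k + G j k * conj (x k)) := by
  refine ⟨fun j k => (L (EuclideanSpace.single k 1) j - I * L (EuclideanSpace.single k I) j) / 2,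
    fun j k => (L (EuclideanSpace.single k 1) j + I * L (EuclideanSpace.single k I) j) / 2,
    fun x j => ?_⟩
  have hx : x = ∑ k, ((x k).re • EuclideanSpace.single k (1 : ℂ) +
      (x k).im • EuclideanSpace.single k I) := by
    ext j
    fin_cases j <;> simp [Fin.sum_univ_three, Complex.re_add_im]
  conv_lhs => rw [hx]
  simp only [map_sum, map_add, map_smul, WithLp.ofLp_sum, Finset.sum_apply]
  refine Finset.sum_congr rfl fun k _ => ?_
  have h1 : x k = (x k).re + (x k).im * I := (Complex.re_add_im _).symm
  have h2 : conj (x k) = (x k).re - (x k).im * I := by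
    apply Complex.ext <;> simp
  rw [h2]
  generalize (x k).re = a, (x k).im = b at *
  rw [h1]
  simp only [PiLp.add_apply, PiLp.smul_apply, Complex.real_smul]
  linear_combination (L (EuclideanSpace.single k I) j * b) * Complex.I_sq

theorem single_apply_of_repr {L : C3 →L[ℝ] C3} {H G : Fin 3 → Fin 3 → ℂ}
    (hL : ∀ x j, L x j = ∑ k, (H j k * x k + G j k * conj (x k))) (j k : Fin 3) (a : ℂ) :
    L (EuclideanSpace.single k a) j = H j k * a + G j k * conj a := by
  rw [hL, Finset.sum_eq_single k]
  · simp
  · intro l _ hl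
    simp [hl]
  · simp

/-- The linear and antilinear parts of a symmetric (`c = 1`) or skew-symmetric (`c = -1`)
real-linear endomorphism. -/
theorem parts_of_inner_eq {L : C3 →L[ℝ] C3} {H G : Fin 3 → Fin 3 → ℂ} {c : ℝ}
    (hL : ∀ x j, L x j = ∑ k, (H j k * x k + G j k * conj (x k)))
    (hc : ∀ x y, inner ℝ (L x) y = c * inner ℝ x (L y)) (j k : Fin 3) :
    conj (H j k) = c * H k j ∧ G j k = c * G k j := by
  have hl : ∀ (x : C3) (b : ℂ), inner ℝ x (EuclideanSpace.single j b) =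
      (x j).re * b.re + (x j).im * b.im := by
    intro x b
    rw [inner_real_C3, Finset.sum_eq_single j]
    · simp
    · intro l _ hl
      simp [hl]
    · simp
  have hr : ∀ (x : C3) (a : ℂ), inner ℝ (EuclideanSpace.single k a) x =
      a.re * (x k).re + a.im * (x k).im := by
    intro x a
    rw [inner_real_C3, Finset.sum_eq_single k]
    · simp
    · intro l _ hl
      simp [hl]
    · simp
  have key : ∀ a b : ℂ, (H j k * a + G j k * conj a).re * b.re +
      (H j k * a + G j k * conj a).im * b.im =
      c * (a.re * (H k j * b + G k j * conj b).re + a.im * (H k j * b + G k j * conj b).im) := by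
    intro a b
    have := hc (EuclideanSpace.single k a) (EuclideanSpace.single j b)
    rwa [hl, hr, single_apply_of_repr hL, single_apply_of_repr hL] at this
  have h11 := key 1 1
  have h1I := key 1 I
  have hI1 := key I 1
  have hII := key I I
  simp at h11 h1I hI1 hII
  constructor <;> apply Complex.ext <;> simp <;> linarith

theorem character_injective {r r' : ℝ}
    (h : ∀ s : ℝ, Complex.exp (I * ((r * s : ℝ) : ℂ)) = Complex.exp (I * ((r' * s : ℝ) : ℂ))) :
    r = r' := by
  have h1 := hasDerivAt_cexp_I_mul r 0
  have h2 := hasDerivAt_cexp_I_mul r' 0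
  rw [funext h] at h1
  have := h1.unique h2
  simpa using this

/-- Distinct frequencies are linearly independent. -/
theorem sum_eq_zero_of_exp_sum_eq_zero {ι : Type*} [Fintype ι] (fr : ι → ℝ) (c : ι → ℂ)
    (h : ∀ s : ℝ, ∑ i, c i * Complex.exp (I * ((fr i * s : ℝ) : ℂ)) = 0) (r : ℝ) :
    ∑ i with fr i = r, c i = 0 := by
  classical
  -- Each frequency is a character of the additive group of ℝ, and distinct characters are linearly
  -- independent.
  let χ : ℝ → (Multiplicative ℝ →* ℂ) := fun r =>
    { toFun := fun s => Complex.exp (I * ((r * s.toAdd : ℝ) : ℂ))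
      map_one' := by simp
      map_mul' := fun x y => by
        rw [← Complex.exp_add]
        congr 1
        simp
        ring }
  have hχ : Function.Injective χ := fun r r' hr =>
    character_injective fun s => DFunLike.congr_fun hr (Multiplicative.ofAdd s)
  have hli : LinearIndependent ℂ
      (fun r => ((χ r : Multiplicative ℝ →* ℂ) : Multiplicative ℝ → ℂ)) :=
    (linearIndependent_monoidHom (Multiplicative ℝ) ℂ).comp χ hχ
  rw [linearIndependent_iff'] at hli
  by_cases hr : r ∈ Finset.univ.image fr
  · refine hli (Finset.univ.image fr) (fun r => ∑ i with fr i = r, c i) ?_ r hr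
    ext s
    have hs := h s.toAdd
    rw [← Finset.sum_fiberwise_of_maps_to
      (fun i _ => Finset.mem_image_of_mem fr (Finset.mem_univ i))] at hs
    rw [Finset.sum_apply, Pi.zero_apply, ← hs]
    refine Finset.sum_congr rfl fun r _ => ?_
    rw [Pi.smul_apply, smul_eq_mul, Finset.sum_mul]
    refine Finset.sum_congr rfl fun i hi => ?_
    rw [← (Finset.mem_filter.1 hi).2]
    rfl
  · rw [Finset.filter_eq_empty_iff.2, Finset.sum_empty]
    intro i _ hi
    exact hr (Finset.mem_image.2 ⟨i, Finset.mem_univ i, hi⟩)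

/-- A real trigonometric sum with nonnegative frequencies vanishes only if it vanishes
frequency by frequency. -/
theorem trig_sum_eq_zero {ι : Type*} [Fintype ι] (fr : ι → ℝ) (hfr : ∀ i, 0 ≤ fr i) (c₀ : ℝ)
    (c : ι → ℂ)
    (h : ∀ s : ℝ, c₀ + (∑ i, c i * Complex.exp (I * ((fr i * s : ℝ) : ℂ))).re = 0) :
    (c₀ + (∑ i with fr i = 0, c i).re = 0) ∧ ∀ r > 0, ∑ i with fr i = r, c i = 0 := by
  -- Twice the real sum, written as an exponential sum: the three summands of the index type carry
  -- the frequencies 0, `fr` and -`fr`.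
  have hsum : ∀ s : ℝ, ∑ i : Unit ⊕ ι ⊕ ι, Sum.elim (fun _ => (2 * c₀ : ℂ))
      (Sum.elim c (fun i => conj (c i))) i * Complex.exp (I * ((Sum.elim (fun _ => (0 : ℝ))
      (Sum.elim fr (fun i => -fr i)) i * s : ℝ) : ℂ)) = 0 := by
    intro s
    have hc : ∑ i, conj (c i) * Complex.exp (I * ((-fr i * s : ℝ) : ℂ)) =
        conj (∑ i, c i * Complex.exp (I * ((fr i * s : ℝ) : ℂ))) := by
      rw [map_sum]
      refine Finset.sum_congr rfl fun i _ => ?_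
      rw [map_mul, conj_exp_I_mul]
      simp
    simp only [Fintype.sum_sum_type, Sum.elim_inl, Sum.elim_inr]
    rw [hc, Complex.add_conj]
    simp only [Finset.univ_unique, Finset.sum_singleton, zero_mul, Complex.ofReal_zero, mul_zero,
      Complex.exp_zero, mul_one]
    have := congrArg (fun x : ℝ => (x : ℂ)) (h s)
    push_cast at this ⊢
    linear_combination 2 * this
  have key : ∀ r : ℝ, (∑ _i : Unit, if (0 : ℝ) = r then (2 * c₀ : ℂ) else 0) +
      ((∑ i, if fr i = r then c i else 0) + ∑ i, if -fr i = r then conj (c i) else 0) = 0 := by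
    intro r
    have h := sum_eq_zero_of_exp_sum_eq_zero _ _ hsum r
    rw [Finset.sum_filter, Fintype.sum_sum_type, Fintype.sum_sum_type] at h
    exact h
  constructor
  · have h0 := key 0
    simp only [Finset.univ_unique, Finset.sum_singleton, if_true, neg_eq_zero] at h0
    have hc : ∑ i, (if fr i = 0 then conj (c i) else 0) =
        conj (∑ i, if fr i = 0 then c i else 0) := by
      rw [map_sum]
      refine Finset.sum_congr rfl fun i _ => ?_
      split_ifs <;> simp
    rw [hc, Complex.add_conj] at h0
    rw [Finset.sum_filter]
    have h1 := congrArg Complex.re h0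
    simp only [Complex.add_re, Complex.zero_re, Complex.ofReal_re, Complex.mul_re,
      Complex.re_ofNat, Complex.im_ofNat, zero_mul, sub_zero] at h1
    linarith
  · intro r hr
    have h0 := key r
    have hz : ∀ i, (if -fr i = r then conj (c i) else 0) = 0 := fun i =>
      if_neg (by have := hfr i; intro h; linarith)
    simp only [hz, hr.ne, if_false, Finset.sum_const_zero, zero_add, add_zero] at h0
    rw [Finset.sum_filter]
    exact h0

/-- The frequencies of the off-diagonal part of a quadratic form along an orbit of the
one-parameter group. -/
def quadFreq (α : ℝ) : Fin 9 → ℝ :=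
  ![1 - α, 2 + α, 1 + 2 * α, 1 + α, α, 1, 2, 2 * α, 2 + 2 * α]

/-- The Fourier coefficients of a quadratic form along an orbit of the one-parameter group. -/
noncomputable def quadCoeff (H G : Fin 3 → Fin 3 → ℂ) (z : C3) : Fin 9 → ℂ :=
  ![2 * H 1 0 * (z 0 * conj (z 1)), 2 * H 2 0 * (z 0 * conj (z 2)), 2 * H 2 1 * (z 1 * conj (z 2)),
    2 * conj (G 0 1) * (z 0 * z 1), 2 * G 0 2 * (conj (z 0) * conj (z 2)),
    2 * G 1 2 * (conj (z 1) * conj (z 2)),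
    conj (G 0 0) * (z 0 * z 0), conj (G 1 1) * (z 1 * z 1), G 2 2 * (conj (z 2) * conj (z 2))]

/-- Under the real part a monomial may be replaced by its conjugate. In `quadCoeff` the
representative is the one whose frequency is nonnegative for 0 ≤ α ≤ 1. -/
theorem inner_rotate_eq_trig_sum {M : C3 →L[ℝ] C3} {H G : Fin 3 → Fin 3 → ℂ}
    (hM : ∀ x j, M x j = ∑ k, (H j k * x k + G j k * conj (x k)))
    (hH : ∀ j k, conj (H j k) = H k j) (hG : ∀ j k, G j k = G k j) (α s : ℝ) (z : C3) :
    inner ℝ (rotate α s z) (M (rotate α s z)) = (∑ j, (H j j).re * normSq (z j)) +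
      (∑ i, quadCoeff H G z i * Complex.exp (I * ((quadFreq α i * s : ℝ) : ℂ))).re := by
  have e : ∀ j, rotate α s z j = Complex.exp (I * (weight α j * s : ℝ)) * z j := fun _ => rfl
  set x := rotate α s z with hx
  have hq : inner ℝ x (M x) = (∑ j, (H j j).re * normSq (x j)) + (∑ i, quadCoeff H G x i).re := by
    have r10 := hH 1 0
    have r20 := hH 2 0
    have r21 := hH 2 1
    rw [inner_real_C3]
    simp only [hM, Fin.sum_univ_three, ← r10, ← r20, ← r21, hG 1 0, hG 2 0, hG 2 1]
    simp [Fin.sum_univ_succ, quadCoeff, Complex.normSq_apply]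
    ring
  rw [hq]
  congr 1
  · simp only [hx, normSq_rotate]
  · congr 1
    refine Finset.sum_congr rfl fun i _ => ?_
    have hA : ∀ a b : ℝ, Complex.exp (I * (a : ℂ)) * Complex.exp (I * (b : ℂ)) =
        Complex.exp (I * ((a + b : ℝ) : ℂ)) := by
      intro a b
      rw [← Complex.exp_add]
      congr 1
      push_cast
      ring
    have hB : ∀ a : ℝ, Complex.exp (-(I * (a : ℂ))) = Complex.exp (I * ((-a : ℝ) : ℂ)) := by
      intro a
      congr 1
      push_cast
      ring
    have p1 : ∀ j k, x j * conj (x k) = (z j * conj (z k)) *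
        Complex.exp (I * ((weight α j * s + -(weight α k * s) : ℝ) : ℂ)) := by
      intro j k
      rw [e, e, map_mul, conj_exp_I_mul, hB, ← hA]
      ring
    have p2 : ∀ j k, x j * x k = (z j * z k) *
        Complex.exp (I * ((weight α j * s + weight α k * s : ℝ) : ℂ)) := by
      intro j k
      rw [e, e, ← hA]
      ring
    have p3 : ∀ j k, conj (x j) * conj (x k) = (conj (z j) * conj (z k)) *
        Complex.exp (I * ((-(weight α j * s) + -(weight α k * s) : ℝ) : ℂ)) := by
      intro j k
      rw [e, e, map_mul, map_mul, conj_exp_I_mul, conj_exp_I_mul, hB, hB, ← hA]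
      ring
    fin_cases i <;> simp only [quadCoeff, quadFreq, Fin.reduceFinMk, Fin.isValue, Matrix.cons_val,
      Fin.zero_eta, Fin.mk_one] <;> simp only [p1, p2, p3] <;> rw [← mul_assoc] <;> congr 3 <;>
      simp [weight] <;> ring

theorem quadratic_eq_zero {a b c x₀ ε : ℝ} (hε : 0 < ε)
    (h : ∀ x ∈ Set.Icc x₀ (x₀ + ε), a + b * x + c * x ^ 2 = 0) : a = 0 ∧ b = 0 ∧ c = 0 := by
  have h0 := h x₀ ⟨le_rfl, by linarith⟩
  have h1 := h (x₀ + ε / 2) ⟨by linarith, by linarith⟩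
  have h2 := h (x₀ + ε) ⟨by linarith, le_rfl⟩
  have hc : c = 0 := by
    have : c * ε ^ 2 = 0 := by linear_combination 2 * h2 - 4 * h1 + 2 * h0
    have hne : ε ^ 2 ≠ 0 := by positivity
    simpa [hne] using this
  subst hc
  have hb : b = 0 := by
    have : b * ε = 0 := by linear_combination h2 - h0
    simpa [hε.ne'] using this
  subst hb
  refine ⟨?_, rfl, rfl⟩
  linarith

/-! ### Quadratic forms vanishing on the surface: the case 0 < α < 1. -/

namespace IsProfile

variable {α J : ℝ} {Z : ℝ → C3}

theorem level_zero_neg (h : IsProfile α J Z) (hα : α ∈ Set.Icc (0 : ℝ) 1)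
    (hJ : J ∈ Set.Icc (0 : ℝ) maxJ) (hJ1 : J ≠ maxJ) : level α (Z 0) < 0 := by
  refine lt_of_le_of_ne (h.level_zero_nonpos hα.1) fun h0 => hJ1 ?_
  have := h.levelCubic_level_zero hα.1
  rw [h0, levelCubic_zero, ← maxJ_sq] at this
  exact ((sq_eq_sq₀ maxJ_pos.le hJ.1).1 this).symm

theorem continuous_level (h : IsProfile α J Z) (hα : 0 ≤ α) : Continuous fun t => level α (Z t) :=
  continuous_iff_continuousAt.2 fun t => (h.hasDerivAt_level hα t).continuousAt

/-- Otherwise the derivative of Im P, which is the derivative of the cubic at v, would vanish at the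
start; but it is positive for v < 0, and the starting level is negative when J is not maximal. -/
theorem exists_coordProd_im_ne_zero (h : IsProfile α J Z) (hα : α ∈ Set.Icc (0 : ℝ) 1)
    (hJ : J ∈ Set.Icc (0 : ℝ) maxJ) (hJ1 : J ≠ maxJ) : ∃ t, (coordProd (Z t)).im ≠ 0 := by
  by_contra! him
  have h2 := h.hasDerivAt_coordProd_im hα.1 0
  rw [funext him] at h2
  have h3 := h2.unique (hasDerivAt_const 0 _)
  have hv := h.level_zero_neg hα hJ hJ1
  unfold levelCubicDeriv at h3
  have hD : 0 ≤ (1 + 2 * α) * (2 + α) * (1 - α) :=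
    mul_nonneg (mul_nonneg (by linarith [hα.1]) (by linarith [hα.1])) (by linarith [hα.2])
  have hneg : 3 * ((1 + 2 * α) * (2 + α) * (1 - α)) * level α (Z 0) - 2 * (1 + α + α ^ 2) < 0 := by
    nlinarith [hα.1, mul_nonneg hD (neg_nonneg.2 hv.le)]
  exact (mul_pos_of_neg_of_neg hv hneg).ne' h3

/-- The level takes all values in an interval. -/
theorem exists_level_eq (h : IsProfile α J Z) (hα : α ∈ Set.Icc (0 : ℝ) 1)
    (hJ : J ∈ Set.Icc (0 : ℝ) maxJ) (hJ1 : J ≠ maxJ) :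
    ∃ ε > 0, ∀ x ∈ Set.Icc (level α (Z 0)) (level α (Z 0) + ε), ∃ t, level α (Z t) = x := by
  obtain ⟨t₁, ht₁⟩ : ∃ t, level α (Z t) ≠ level α (Z 0) := by
    by_contra! hc
    obtain ⟨t, ht⟩ := h.exists_coordProd_im_ne_zero hα hJ hJ1
    have h1 := h.hasDerivAt_level hα.1 t
    rw [funext hc] at h1
    have := h1.unique (hasDerivAt_const t _)
    exact ht (by linarith)
  have hlt : level α (Z 0) < level α (Z t₁) :=
    lt_of_le_of_ne (h.level_zero_le hα hJ.1 t₁) ht₁.symm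
  refine ⟨level α (Z t₁) - level α (Z 0), by linarith, fun x hx => ?_⟩
  have := mem_range_of_exists_le_of_exists_ge (h.continuous_level hα.1) ⟨0, hx.1⟩
    ⟨t₁, by linarith [hx.2]⟩
  exact this

/-- Two monomials of degree two whose moduli have different derivatives at level zero are linearly
independent along the profile. -/
theorem coeff_eq_zero_of_add (h : IsProfile α J Z) (hα : α ∈ Set.Icc (0 : ℝ) 1)
    (hJ : J ∈ Set.Icc (0 : ℝ) maxJ) (hJ1 : J ≠ maxJ) {c d : ℂ} {f g : ℝ → ℂ} {i j k l : Fin 3}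
    (hf : ∀ t, normSq (f t) = normSq (Z t i) * normSq (Z t j))
    (hg : ∀ t, normSq (g t) = normSq (Z t k) * normSq (Z t l))
    (hfg : ∀ t, c * f t + d * g t = 0)
    (hμ : momentVector α i + momentVector α j ≠ momentVector α k + momentVector α l) :
    c = 0 ∧ d = 0 := by
  obtain ⟨ε, hε, hv⟩ := h.exists_level_eq hα hJ hJ1
  -- |c f|² = |d g|² is a polynomial identity in v. The constant terms give |c| = |d|, and the
  -- linear ones then compare the two sums of μ.
  obtain ⟨h0, h1, -⟩ := quadratic_eq_zero (a := (normSq c - normSq d) / 9)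
    (b := (normSq c * (momentVector α i + momentVector α j) -
      normSq d * (momentVector α k + momentVector α l)) / 3)
    (c := normSq c * (momentVector α i * momentVector α j) -
      normSq d * (momentVector α k * momentVector α l)) hε (by
    intro x hx
    obtain ⟨t, rfl⟩ := hv x hx
    have e : normSq (c * f t) = normSq (d * g t) := by
      rw [eq_neg_of_add_eq_zero_left (hfg t), Complex.normSq_neg]
    rw [map_mul, map_mul, hf, hg] at e
    simp only [h.normSq_eq hα.1] at e
    linear_combination e)
  have hcd : normSq c = normSq d := by linarith
  rw [hcd] at h1
  have hd : normSq d * (momentVector α i + momentVector α j -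
      (momentVector α k + momentVector α l)) = 0 := by linarith
  rcases mul_eq_zero.1 hd with hd | hd
  · rw [hd] at hcd
    exact ⟨Complex.normSq_eq_zero.1 hcd, Complex.normSq_eq_zero.1 hd⟩
  · exact absurd (sub_eq_zero.1 hd) hμ

theorem coeff_eq_zero (h : IsProfile α J Z) (hα : α ∈ Set.Icc (0 : ℝ) 1)
    (hJ : J ∈ Set.Icc (0 : ℝ) maxJ) (hJ1 : J ≠ maxJ) {c : ℂ} {f : ℝ → ℂ} {i j : Fin 3}
    (hf : ∀ t, normSq (f t) = normSq (Z t i) * normSq (Z t j)) (hcf : ∀ t, c * f t = 0) :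
    c = 0 := by
  obtain ⟨ε, hε, hv⟩ := h.exists_level_eq hα hJ hJ1
  obtain ⟨h0, -, -⟩ := quadratic_eq_zero (a := normSq c / 9)
    (b := normSq c * (momentVector α i + momentVector α j) / 3)
    (c := normSq c * (momentVector α i * momentVector α j)) hε (by
    intro x hx
    obtain ⟨t, rfl⟩ := hv x hx
    have e : normSq (c * f t) = 0 := by rw [hcf t, map_zero]
    rw [map_mul, hf] at e
    simp only [h.normSq_eq hα.1] at e
    linear_combination e)
  exact Complex.normSq_eq_zero.1 (by linarith)

/-- The constant and the linear term in v say that m is orthogonal to (1, 1, 1) and to μ; the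
orthogonal complement of these two is spanned by the weights. -/
theorem diag_of_sum_eq_zero (h : IsProfile α J Z) (hα : α ∈ Set.Icc (0 : ℝ) 1)
    (hJ : J ∈ Set.Icc (0 : ℝ) maxJ) (hJ1 : J ≠ maxJ) {m : Fin 3 → ℝ}
    (hm : ∀ t, ∑ j, m j * normSq (Z t j) = 0) (j : Fin 3) : m j = m 0 * weight α j := by
  obtain ⟨ε, hε, hv⟩ := h.exists_level_eq hα hJ hJ1
  obtain ⟨h0, h1, -⟩ := quadratic_eq_zero (a := (m 0 + m 1 + m 2) / 3)
    (b := m 0 * momentVector α 0 + m 1 * momentVector α 1 + m 2 * momentVector α 2)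
    (c := 0) hε (by
    intro x hx
    obtain ⟨t, rfl⟩ := hv x hx
    have e := hm t
    simp only [h.normSq_eq hα.1, Fin.sum_univ_three] at e
    linear_combination e)
  simp [momentVector] at h1
  fin_cases j <;> simp [weight]
  · linear_combination (1 - α) * h0 + (1 / 3) * h1
  · linear_combination (2 + α) * h0 - (1 / 3) * h1

theorem trig_coeffs (hα : α ∈ Set.Icc (0 : ℝ) 1) {M : C3 →L[ℝ] C3}
    {H G : Fin 3 → Fin 3 → ℂ} (hM : ∀ x j, M x j = ∑ k, (H j k * x k + G j k * conj (x k)))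
    (hH : ∀ j k, conj (H j k) = H k j) (hG : ∀ j k, G j k = G k j)
    (hq : ∀ p, inner ℝ (sweep α Z p) (M (sweep α Z p)) = 0) (t : ℝ) :
    ((∑ j, (H j j).re * normSq (Z t j)) +
      (∑ i with quadFreq α i = 0, quadCoeff H G (Z t) i).re = 0) ∧
    ∀ r > 0, ∑ i with quadFreq α i = r, quadCoeff H G (Z t) i = 0 := by
  refine trig_sum_eq_zero _ ?_ _ _ fun s => ?_
  · have h0 := hα.1
    have h1 := hα.2
    intro i
    fin_cases i <;> simp [quadFreq] <;> linarith
  · rw [← inner_rotate_eq_trig_sum hM hH hG α s]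
    exact hq (s, t)

theorem diagonal_of_coeffs {M : C3 →L[ℝ] C3} {H G : Fin 3 → Fin 3 → ℂ}
    (hM : ∀ x j, M x j = ∑ k, (H j k * x k + G j k * conj (x k)))
    (hH : ∀ j k, conj (H j k) = H k j) (hG : ∀ j k, G j k = G k j)
    (hd : ∀ j, (H j j).re = (H 0 0).re * weight α j)
    (hall : 2 * H 1 0 = 0 ∧ 2 * H 2 0 = 0 ∧ 2 * H 2 1 = 0 ∧ 2 * conj (G 0 1) = 0 ∧
      2 * G 0 2 = 0 ∧ 2 * G 1 2 = 0 ∧ conj (G 0 0) = 0 ∧ conj (G 1 1) = 0 ∧ G 2 2 = 0) :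
    ∃ c : ℝ, ∀ x j, M x j = (c * weight α j : ℝ) * x j := by
  simp only [mul_eq_zero, OfNat.ofNat_ne_zero, false_or, map_eq_zero] at hall
  obtain ⟨a10, a20, a21, g01, g02, g12, g00, g11, g22⟩ := hall
  have a01 : H 0 1 = 0 := by rw [← hH, a10, map_zero]
  have a02 : H 0 2 = 0 := by rw [← hH, a20, map_zero]
  have a12 : H 1 2 = 0 := by rw [← hH, a21, map_zero]
  have g10 : G 1 0 = 0 := by rw [hG, g01]
  have g20 : G 2 0 = 0 := by rw [hG, g02]
  have g21 : G 2 1 = 0 := by rw [hG, g12]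
  refine ⟨(H 0 0).re, fun x j => ?_⟩
  have hr : H j j = ((H j j).re : ℂ) := (Complex.conj_eq_iff_re.1 (hH j j)).symm
  rw [← hd, ← hr, hM]
  fin_cases j <;> simp [Fin.sum_univ_three, *]

/-- For `0 < α < 1` and `J` not maximal, the quadratic forms that vanish on the surface are the
multiples of the moment of the one-parameter group. -/
theorem quadratic_forms_of_pos (h : IsProfile α J Z) (hα : α ∈ Set.Ioo (0 : ℝ) 1)
    (hJ : J ∈ Set.Icc (0 : ℝ) maxJ) (hJ1 : J ≠ maxJ) {M : C3 →L[ℝ] C3}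
    (hM : ∀ x y, inner ℝ (M x) y = inner ℝ x (M y))
    (hq : ∀ p, inner ℝ (sweep α Z p) (M (sweep α Z p)) = 0) :
    ∃ c : ℝ, ∀ x j, M x j = (c * weight α j : ℝ) * x j := by
  have hα' : α ∈ Set.Icc (0 : ℝ) 1 := ⟨hα.1.le, hα.2.le⟩
  obtain ⟨h0, h1⟩ := hα
  obtain ⟨H, G, hMr⟩ := exists_linear_add_antilinear M
  have hpart := parts_of_inner_eq (c := 1) hMr (by simpa using hM)
  have hH : ∀ j k, conj (H j k) = H k j := fun j k => by simpa using (hpart j k).1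
  have hG : ∀ j k, G j k = G k j := fun j k => by simpa using (hpart j k).2
  have hF := trig_coeffs hα' hMr hH hG hq
  have hd : ∀ t, ∑ j, (H j j).re * normSq (Z t j) = 0 := by
    intro t
    have := (hF t).1
    rwa [Finset.filter_eq_empty_iff.2, Finset.sum_empty, Complex.zero_re, add_zero] at this
    intro i _
    apply ne_of_gt
    fin_cases i <;> simp [quadFreq] <;> linarith
  have hpair : ∀ (i : Fin 9) (t : ℝ), ∑ k, (if quadFreq α k = quadFreq α i then
      quadCoeff H G (Z t) k else 0) = 0 := by
    intro i t
    have := (hF t).2 (quadFreq α i) (by fin_cases i <;> simp [quadFreq] <;> linarith)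
    rwa [Finset.sum_filter] at this
  have n11 : ∀ i j t, normSq (Z t i * Z t j) = normSq (Z t i) * normSq (Z t j) := by simp
  have n12 : ∀ i j t, normSq (Z t i * conj (Z t j)) = normSq (Z t i) * normSq (Z t j) := by simp
  have n22 : ∀ i j t, normSq (conj (Z t i) * conj (Z t j)) = normSq (Z t i) * normSq (Z t j) := by
    simp
  have hall : 2 * H 1 0 = 0 ∧ 2 * H 2 0 = 0 ∧ 2 * H 2 1 = 0 ∧ 2 * conj (G 0 1) = 0 ∧
      2 * G 0 2 = 0 ∧ 2 * G 1 2 = 0 ∧ conj (G 0 0) = 0 ∧ conj (G 1 1) = 0 ∧ G 2 2 = 0 := by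
    have one : ∀ {c : ℂ} {f : ℝ → ℂ} {i j : Fin 3}, (∀ t, c * f t = 0) →
        (∀ t, normSq (f t) = normSq (Z t i) * normSq (Z t j)) → c = 0 :=
      fun hcf hf => h.coeff_eq_zero hα' hJ hJ1 hf hcf
    have hiso : ∀ i : Fin 9, (∀ k, k ≠ i → quadFreq α k ≠ quadFreq α i) →
        ∀ t, quadCoeff H G (Z t) i = 0 := by
      intro i hi t
      rw [← hpair i t, Finset.sum_eq_single i (fun k _ hk => if_neg (hi k hk)) (by simp),
        if_pos rfl]
    have htwo : ∀ i l : Fin 9, i ≠ l → quadFreq α l = quadFreq α i →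
        (∀ k, k ≠ i → k ≠ l → quadFreq α k ≠ quadFreq α i) →
        ∀ t, quadCoeff H G (Z t) i + quadCoeff H G (Z t) l = 0 := by
      intro i l hil hl hi t
      rw [← hpair i t, Finset.sum_eq_add i l hil (fun k _ hk => if_neg (hi k hk.1 hk.2))
        (by simp) (by simp), if_pos rfl, if_pos hl]
    -- For 0 < α < 1 the frequencies 2 + α, 1 + α and 2 + 2α are isolated. The others collide only
    -- at α = 1/2, in three pairs, and at α = 1/3, where 1 - α = 2α.
    have i1 : ∀ t, 2 * H 2 0 * (Z t 0 * conj (Z t 2)) = 0 := hiso 1 (by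
      intro k hk
      fin_cases k <;> simp [quadFreq] at hk ⊢ <;> intro h <;> linarith)
    have i3 : ∀ t, 2 * conj (G 0 1) * (Z t 0 * Z t 1) = 0 := hiso 3 (by
      intro k hk
      fin_cases k <;> simp [quadFreq] at hk ⊢ <;> linarith)
    have i8 : ∀ t, G 2 2 * (conj (Z t 2) * conj (Z t 2)) = 0 := hiso 8 (by
      intro k hk
      fin_cases k <;> simp [quadFreq] at hk ⊢ <;> linarith)
    by_cases h12 : α = 1 / 2
    · have p04 : ∀ t, 2 * H 1 0 * (Z t 0 * conj (Z t 1)) +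
          2 * G 0 2 * (conj (Z t 0) * conj (Z t 2)) = 0 := htwo 0 4 (by decide)
        (by simp [quadFreq]; linarith) (by
          intro k hk hk'
          fin_cases k <;> simp [quadFreq] at hk hk' ⊢ <;> linarith)
      have p26 : ∀ t, 2 * H 2 1 * (Z t 1 * conj (Z t 2)) +
          conj (G 0 0) * (Z t 0 * Z t 0) = 0 := htwo 2 6 (by decide)
        (by simp [quadFreq]; linarith) (by
          intro k hk hk'
          fin_cases k <;> simp [quadFreq] at hk hk' ⊢ <;> linarith)
      have p57 : ∀ t, 2 * G 1 2 * (conj (Z t 1) * conj (Z t 2)) +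
          conj (G 1 1) * (Z t 1 * Z t 1) = 0 := htwo 5 7 (by decide)
        (by simp [quadFreq]; linarith) (by
          intro k hk hk'
          fin_cases k <;> simp [quadFreq] at hk hk' ⊢ <;> linarith)
      have c04 := h.coeff_eq_zero_of_add hα' hJ hJ1 (n12 0 1) (n22 0 2) p04
        (by simp [momentVector]; intro h; linarith)
      have c26 := h.coeff_eq_zero_of_add hα' hJ hJ1 (n12 1 2) (n11 0 0) p26
        (by simp [momentVector]; intro h; linarith)
      have c57 := h.coeff_eq_zero_of_add hα' hJ hJ1 (n22 1 2) (n11 1 1) p57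
        (by simp [momentVector]; intro h; linarith)
      exact ⟨c04.1, one i1 (n12 0 2), c26.1, one i3 (n11 0 1), c04.2, c57.1, c26.2, c57.2,
        one i8 (n22 2 2)⟩
    · have h12' : 2 * α ≠ 1 := fun h => h12 (by linarith)
      have i2 : ∀ t, 2 * H 2 1 * (Z t 1 * conj (Z t 2)) = 0 := hiso 2 (by
        intro k hk
        fin_cases k <;> simp [quadFreq] at hk ⊢ <;> intro h <;>
          first | linarith | exact h12' (by linarith))
      have i4 : ∀ t, 2 * G 0 2 * (conj (Z t 0) * conj (Z t 2)) = 0 := hiso 4 (by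
        intro k hk
        fin_cases k <;> simp [quadFreq] at hk ⊢ <;>
          first | linarith | (intro h; first | linarith | exact h12' (by linarith)))
      have i5 : ∀ t, 2 * G 1 2 * (conj (Z t 1) * conj (Z t 2)) = 0 := hiso 5 (by
        intro k hk
        fin_cases k <;> simp [quadFreq] at hk ⊢ <;>
          first | linarith | (intro h; first | linarith | exact h12' (by linarith)))
      have i6 : ∀ t, conj (G 0 0) * (Z t 0 * Z t 0) = 0 := hiso 6 (by
        intro k hk
        fin_cases k <;> simp [quadFreq] at hk ⊢ <;>
          first | linarith | (intro h; first | linarith | exact h12' (by linarith)))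
      have c07 : 2 * H 1 0 = 0 ∧ conj (G 1 1) = 0 := by
        by_cases h13 : 2 * α = 1 - α
        · refine h.coeff_eq_zero_of_add hα' hJ hJ1 (n12 0 1) (n11 1 1)
            (htwo 0 7 (by decide) h13 ?_) ?_
          · intro k hk hk'
            fin_cases k <;> simp [quadFreq] at hk hk' ⊢ <;> linarith
          · simp [momentVector]
            intro h
            linarith
        · have i0 : ∀ t, 2 * H 1 0 * (Z t 0 * conj (Z t 1)) = 0 := hiso 0 (by
            intro k hk
            fin_cases k <;> simp [quadFreq] at hk ⊢ <;>
              first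
              | linarith
              | (intro h; first | linarith | exact h12' (by linarith) | exact h13 (by linarith)))
          have i7 : ∀ t, conj (G 1 1) * (Z t 1 * Z t 1) = 0 := hiso 7 (by
            intro k hk
            fin_cases k <;> simp [quadFreq] at hk ⊢ <;>
              first
              | linarith
              | (intro h; first | linarith | exact h12' (by linarith) | exact h13 (by linarith)))
          exact ⟨one i0 (n12 0 1), one i7 (n11 1 1)⟩
      exact ⟨c07.1, one i1 (n12 0 2), one i2 (n12 1 2), one i3 (n11 0 1), one i4 (n22 0 2),
        one i5 (n22 1 2), one i6 (n11 0 0), c07.2, one i8 (n22 2 2)⟩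
  exact diagonal_of_coeffs hMr hH hG (h.diag_of_sum_eq_zero hα' hJ hJ1 hd) hall

end IsProfile

/-! ### Quadratic forms vanishing on the surface: the case α = 0. -/

theorem HasDerivAt.eq_zero_of_forall {f : ℝ → ℂ} {f' : ℂ} {t : ℝ} (h : HasDerivAt f f' t)
    (hf : ∀ t, f t = 0) : f' = 0 := by
  rw [funext hf] at h
  exact h.unique (hasDerivAt_const t 0)

/-- A symmetric bilinear form on ℂ² is tested on the vectors (w, conj w) and (p, conj p), which form
a basis because the Wronskian is not zero. -/
theorem quadratic_coeffs_eq_zero {a b c w p : ℂ} (hD : w * conj p - conj w * p ≠ 0)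
    (h1 : a * (w * conj w) + b * (w * w) + c * (conj w * conj w) = 0)
    (h2 : a * (w * conj p + conj w * p) + b * (2 * w * p) + c * (2 * conj w * conj p) = 0)
    (h3 : a * (p * conj p) + b * (p * p) + c * (conj p * conj p) = 0) :
    a = 0 ∧ b = 0 ∧ c = 0 := by
  have hD2 := pow_ne_zero 2 hD
  refine ⟨(mul_eq_zero.1 ?_).resolve_left hD2, (mul_eq_zero.1 ?_).resolve_left hD2,
    (mul_eq_zero.1 ?_).resolve_left hD2⟩
  · linear_combination -(2 * p * conj p) * h1 + (p * conj w + conj p * w) * h2 -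
      (2 * w * conj w) * h3
  · linear_combination (conj p) ^ 2 * h1 - (conj p * conj w) * h2 + (conj w) ^ 2 * h3
  · linear_combination p ^ 2 * h1 - (p * w) * h2 + w ^ 2 * h3

section

variable {z p y q : ℝ → ℂ} {U : ℝ → ℝ}

theorem hasDerivAt_quadratic (a b c : ℂ) {z p : ℝ → ℂ} {z' p' : ℂ} {t : ℝ}
    (hz : HasDerivAt z z' t) (hp : HasDerivAt p p' t) :
    HasDerivAt (fun t => a * (z t * conj (p t) + conj (z t) * p t) + b * (2 * z t * p t) +
      c * (2 * conj (z t) * conj (p t)))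
      (a * (z' * conj (p t) + conj z' * p t) + b * (2 * z' * p t) + c * (2 * conj z' * conj (p t)) +
      (a * (z t * conj p' + conj (z t) * p') + b * (2 * z t * p') +
      c * (2 * conj (z t) * conj p'))) t := by
  refine HasDerivAt.congr_deriv (((((hz.mul hp.conj).add (hz.conj.mul hp)).const_mul a).add
    (((hz.const_mul 2).mul hp).const_mul b)).add
    (((hz.conj.const_mul 2).mul hp.conj).const_mul c)) ?_
  ring

/-- A quadratic form that vanishes along a solution of a second-order linear equation is zero. -/
theorem quadratic_coeffs_eq_zero_of_ode (hz : ∀ t, HasDerivAt z (p t) t)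
    (hp : ∀ t, HasDerivAt p (U t * z t) t) (hD : ∀ t, z t * conj (p t) - conj (z t) * p t ≠ 0)
    {a b c : ℂ}
    (h : ∀ t, a * (z t * conj (z t)) + b * (z t * z t) + c * (conj (z t) * conj (z t)) = 0) :
    a = 0 ∧ b = 0 ∧ c = 0 := by
  have h2 : ∀ t, a * (z t * conj (p t) + conj (z t) * p t) + b * (2 * z t * p t) +
      c * (2 * conj (z t) * conj (p t)) = 0 := by
    intro t
    have := (hasDerivAt_quadratic a b c (hz t) (hz t)).eq_zero_of_forall fun t => by
      linear_combination 2 * h t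
    linear_combination this / 2
  refine quadratic_coeffs_eq_zero (hD 0) (h 0) (h2 0) ?_
  have := (hasDerivAt_quadratic a b c (hz 0) (hp 0)).eq_zero_of_forall h2
  simp only [map_mul, Complex.conj_ofReal] at this
  linear_combination this / 2 - U 0 * h 0

/-- Differentiating C(z, y) = 0 gives in turn C(p, y) + C(z, q) = 0, C(p, q) = 0 and U C(z, q) + (U
- 1) C(p, y) = 0. As the potentials differ by 1, the mixed terms vanish separately, so C vanishes on
a basis. -/
theorem bilinear_coeffs_eq_zero_of_ode (hz : ∀ t, HasDerivAt z (p t) t)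
    (hp : ∀ t, HasDerivAt p (U t * z t) t) (hy : ∀ t, HasDerivAt y (q t) t)
    (hq : ∀ t, HasDerivAt q ((U t - 1) * y t) t)
    (hD : ∀ t, z t * conj (p t) - conj (z t) * p t ≠ 0)
    (hD' : ∀ t, y t * conj (q t) - conj (y t) * q t ≠ 0)
    {a b c d : ℂ}
    (h : ∀ t, a * (z t * conj (y t)) + b * (y t * conj (z t)) + c * (z t * y t) +
      d * (conj (y t) * conj (z t)) = 0) :
    a = 0 ∧ b = 0 ∧ c = 0 ∧ d = 0 := by
  let C : ℂ → ℂ → ℂ := fun z y => a * (z * conj y) + b * (y * conj z) + c * (z * y) +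
    d * (conj y * conj z)
  have hC : ∀ {z y : ℝ → ℂ} {z' y' : ℂ} {t : ℝ}, HasDerivAt z z' t → HasDerivAt y y' t →
      HasDerivAt (fun t => C (z t) (y t)) (C z' (y t) + C (z t) y') t := by
    intro z y z' y' t hz hy
    refine HasDerivAt.congr_deriv (((((hz.mul hy.conj).const_mul a).add
      ((hy.mul hz.conj).const_mul b)).add ((hz.mul hy).const_mul c)).add ((hy.conj.mul hz.conj).const_mul d)) ?_
    simp only [C]
    ring
  have hs1 : ∀ (r : ℝ) (z y : ℂ), C (r * z) y = r * C z y := by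
    intro r z y
    simp only [C, map_mul, Complex.conj_ofReal]
    ring
  have hs2 : ∀ (r : ℝ) (z y : ℂ), C z ((r - 1) * y) = (r - 1) * C z y := by
    intro r z y
    simp only [C, map_mul, map_sub, map_one, Complex.conj_ofReal]
    ring
  have c1 : ∀ t, C (z t) (y t) = 0 := h
  have c2 : ∀ t, C (p t) (y t) + C (z t) (q t) = 0 := fun t =>
    (hC (hz t) (hy t)).eq_zero_of_forall c1
  have c3 : ∀ t, C (p t) (q t) = 0 := fun t => by
    have := ((hC (hp t) (hy t)).add (hC (hz t) (hq t))).eq_zero_of_forall c2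
    rw [hs1, hs2, c1] at this
    linear_combination this / 2
  have c4 : C (z 0) (q 0) = 0 := by
    have := (hC (hp 0) (hq 0)).eq_zero_of_forall c3
    rw [hs1, hs2] at this
    linear_combination this + (1 - (U 0 : ℂ)) * c2 0
  have c5 : C (p 0) (y 0) = 0 := by linear_combination c2 0 - c4
  have e1 := c1 0
  have e3 := c3 0
  have hDD := mul_ne_zero (hD 0) (hD' 0)
  generalize z 0 = z, p 0 = p, y 0 = y, q 0 = q at *
  simp only [C] at e1 e3 c4 c5
  refine ⟨(mul_eq_zero.1 ?_).resolve_left hDD, (mul_eq_zero.1 ?_).resolve_left hDD,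
    (mul_eq_zero.1 ?_).resolve_left hDD, (mul_eq_zero.1 ?_).resolve_left hDD⟩
  · linear_combination -(conj p * q) * e1 + (conj p * y) * c4 + (conj z * q) * c5 -
      (conj z * y) * e3
  · linear_combination -(p * conj q) * e1 + (p * conj y) * c4 + (z * conj q) * c5 -
      (z * conj y) * e3
  · linear_combination (conj p * conj q) * e1 - (conj p * conj y) * c4 - (conj z * conj q) * c5 +
      (conj z * conj y) * e3
  · linear_combination (p * q) * e1 - (p * y) * c4 - (z * q) * c5 + (z * y) * e3

/-- Differentiating B(z, z) + B'(y, y) = 0 and using that the potentials differ by 1 leads to B(z,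
p) = 0, then to B(p, p) + U B(z, z) = 0. The derivative of the latter is U' B(z, z) = 0, so at a
time where U' ≠ 0 all values of both forms vanish. -/
theorem two_quadratic_coeffs_eq_zero_of_ode (hz : ∀ t, HasDerivAt z (p t) t)
    (hp : ∀ t, HasDerivAt p (U t * z t) t) (hy : ∀ t, HasDerivAt y (q t) t)
    (hq : ∀ t, HasDerivAt q ((U t - 1) * y t) t)
    (hD : ∀ t, z t * conj (p t) - conj (z t) * p t ≠ 0)
    (hD' : ∀ t, y t * conj (q t) - conj (y t) * q t ≠ 0)
    {t₀ : ℝ} {U' : ℂ} (hU : HasDerivAt (fun t => (U t : ℂ)) U' t₀) (hU' : U' ≠ 0)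
    {a b c a' b' c' : ℂ}
    (h : ∀ t, a * (z t * conj (z t)) + b * (z t * z t) + c * (conj (z t) * conj (z t)) +
      (a' * (y t * conj (y t)) + b' * (y t * y t) + c' * (conj (y t) * conj (y t))) = 0) :
    (a = 0 ∧ b = 0 ∧ c = 0) ∧ a' = 0 ∧ b' = 0 ∧ c' = 0 := by
  let B : ℂ → ℂ → ℂ := fun z p => a * (z * conj p + conj z * p) + b * (2 * z * p) +
      c * (2 * conj z * conj p)
  let B' : ℂ → ℂ → ℂ := fun z p => a' * (z * conj p + conj z * p) + b' * (2 * z * p) +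
      c' * (2 * conj z * conj p)
  have hB : ∀ {z y : ℝ → ℂ} {z' y' : ℂ} {t : ℝ}, HasDerivAt z z' t → HasDerivAt y y' t →
      HasDerivAt (fun t => B (z t) (y t)) (B z' (y t) + B (z t) y') t :=
    fun hz hy => hasDerivAt_quadratic a b c hz hy
  have hB' : ∀ {z y : ℝ → ℂ} {z' y' : ℂ} {t : ℝ}, HasDerivAt z z' t → HasDerivAt y y' t →
      HasDerivAt (fun t => B' (z t) (y t)) (B' z' (y t) + B' (z t) y') t :=
    fun hz hy => hasDerivAt_quadratic a' b' c' hz hy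
  have symm : ∀ z y, B y z = B z y := fun z y => by simp only [B]; ring
  have symm' : ∀ z y, B' y z = B' z y := fun z y => by simp only [B']; ring
  have hs : ∀ (r : ℝ) (z y : ℂ), B z (r * y) = r * B z y := by
    intro r z y
    simp only [B, map_mul, Complex.conj_ofReal]
    ring
  have hs' : ∀ (r : ℝ) (z y : ℂ), B' z ((r - 1) * y) = (r - 1) * B' z y := by
    intro r z y
    simp only [B', map_mul, map_sub, map_one, Complex.conj_ofReal]
    ring
  have e0 : ∀ t, B (z t) (z t) + B' (y t) (y t) = 0 := fun t => by
    simp only [B, B']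
    linear_combination 2 * h t
  have e1 : ∀ t, B (z t) (p t) + B' (y t) (q t) = 0 := fun t => by
    have := ((hB (hz t) (hz t)).add (hB' (hy t) (hy t))).eq_zero_of_forall e0
    rw [symm (z t), symm' (y t)] at this
    linear_combination this / 2
  have e2 : ∀ t, B (p t) (p t) + B' (q t) (q t) + B (z t) (z t) = 0 := fun t => by
    have := ((hB (hz t) (hp t)).add (hB' (hy t) (hq t))).eq_zero_of_forall e1
    rw [hs, hs'] at this
    linear_combination this - (U t - 1 : ℂ) * e0 t
  have e3 : ∀ t, B (z t) (p t) = 0 := fun t => by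
    have := (((hB (hp t) (hp t)).add (hB' (hq t) (hq t))).add
      (hB (hz t) (hz t))).eq_zero_of_forall e2
    rw [symm (p t) (_ * _), symm' (q t) (_ * _), hs, hs', symm (z t) (p t), symm' (y t) (q t)]
      at this
    linear_combination this / 4 - (U t - 1 : ℂ) / 2 * e1 t
  have e4 : ∀ t, B (p t) (p t) + U t * B (z t) (z t) = 0 := fun t => by
    have := (hB (hz t) (hp t)).eq_zero_of_forall e3
    rwa [hs] at this
  have e5 : B (z t₀) (z t₀) = 0 := by
    have := ((hB (hp t₀) (hp t₀)).add (hU.mul (hB (hz t₀) (hz t₀)))).eq_zero_of_forall e4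
    rw [symm (p t₀) (_ * _), hs, symm (z t₀) (p t₀), e3] at this
    refine (mul_eq_zero.1 ?_).resolve_left hU'
    linear_combination this
  have e6 : B (p t₀) (p t₀) = 0 := by linear_combination e4 t₀ - U t₀ * e5
  have e7 : B' (y t₀) (y t₀) = 0 := by linear_combination e0 t₀ - e5
  have e8 : B' (y t₀) (q t₀) = 0 := by linear_combination e1 t₀ - e3 t₀
  have e9 : B' (q t₀) (q t₀) = 0 := by linear_combination e2 t₀ - e5 - e6
  have e3' := e3 t₀
  simp only [B] at e5 e6 e3'
  simp only [B'] at e7 e8 e9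
  refine ⟨quadratic_coeffs_eq_zero (hD t₀) ?_ e3' ?_, quadratic_coeffs_eq_zero (hD' t₀) ?_ e8 ?_⟩
  · linear_combination e5 / 2
  · linear_combination e6 / 2
  · linear_combination e7 / 2
  · linear_combination e9 / 2

end

namespace IsProfile

variable {J : ℝ} {Z : ℝ → C3}

/-- Here μ = (-1, 2, -1), so the flow and the start point are invariant under exchanging the
coordinates 0 and 2. -/
theorem coord_two_eq_of_zero (h : IsProfile 0 J Z) (t : ℝ) : Z t 2 = Z t 0 := by
  have hd := fun t j => (hasDerivAt_C3.1 (h.flow t)) j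
  have : Z = fun t => WithLp.toLp 2 ![Z t 2, Z t 1, Z t 0] := by
    refine h.eq_of_flow (t₀ := 0) (fun t => hasDerivAt_C3.2 fun j => ?_) (fun t => ?_) ?_
    · fin_cases j
      · simpa [momentVector, mul_comm] using hd t 2
      · simpa [momentVector, mul_comm] using hd t 1
      · simpa [momentVector, mul_comm] using hd t 0
    · refine le_of_eq ((sq_eq_sq₀ (norm_nonneg _) zero_le_one).1 ?_)
      rw [norm_sq_C3, one_pow, ← h.sum_normSq t, Fin.sum_univ_three, Fin.sum_univ_three]
      simp
      ring
    · rw [h.start_eq le_rfl]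
      ext j
      fin_cases j <;> simp [momentVector]
  exact congrArg (fun z : C3 => z 0) (congrFun this t).symm

/-- For `α = 0` and `J` neither zero nor maximal, the quadratic forms that vanish on the surface are
the multiples of the moment of the one-parameter group. -/
theorem quadratic_forms_of_zero (h : IsProfile 0 J Z)
    (hJ : J ∈ Set.Ioo (0 : ℝ) maxJ) {M : C3 →L[ℝ] C3}
    (hM : ∀ x y, inner ℝ (M x) y = inner ℝ x (M y))
    (hq : ∀ p, inner ℝ (sweep 0 Z p) (M (sweep 0 Z p)) = 0) :
    ∃ c : ℝ, ∀ x j, M x j = (c * weight 0 j : ℝ) * x j := by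
  have hα : (0 : ℝ) ∈ Set.Icc (0 : ℝ) 1 := ⟨le_rfl, zero_le_one⟩
  obtain ⟨H, G, hMr⟩ := exists_linear_add_antilinear M
  have hpart := parts_of_inner_eq (c := 1) hMr (by simpa using hM)
  have hH : ∀ j k, conj (H j k) = H k j := fun j k => by simpa using (hpart j k).1
  have hG : ∀ j k, G j k = G k j := fun j k => by simpa using (hpart j k).2
  have hF := trig_coeffs hα hMr hH hG hq
  have h2 := h.coord_two_eq_of_zero
  have hd := fun t j => (hasDerivAt_C3.1 (h.flow t)) j
  have hc2 : conj (2 : ℂ) = 2 := map_ofNat _ 2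
  have hz : ∀ t, HasDerivAt (fun t => Z t 0) (-I * conj (Z t 0 * Z t 1)) t := fun t => by
    simpa [momentVector, h2, mul_comm] using hd t 0
  have hy : ∀ t, HasDerivAt (fun t => Z t 1) (2 * I * conj (Z t 0 * Z t 0)) t := fun t => by
    simpa [momentVector, h2, mul_comm] using hd t 1
  have hP : ∀ t, Z t 0 * Z t 1 * Z t 0 + conj (Z t 0 * Z t 1 * Z t 0) = 2 * J := fun t => by
    have := h.coordProd_re hJ.1.le t
    rw [coordProd, h2] at this
    rw [Complex.add_conj, this]
    push_cast
    ring
  have hsum : ∀ t, 2 * (Z t 0 * conj (Z t 0)) + Z t 1 * conj (Z t 1) = 1 := fun t => by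
    have := h.sum_normSq t
    rw [Fin.sum_univ_three, h2] at this
    rw [Complex.mul_conj, Complex.mul_conj]
    have e : 2 * normSq (Z t 0) + normSq (Z t 1) = 1 := by linarith
    simpa using congrArg (fun r : ℝ => (r : ℂ)) e
  -- This is |z₁|² - 2|z₀|². Differentiating the flow twice gives z₀'' = U z₀ and z₁'' = -4|z₀|² z₁,
  -- and 2|z₀|² + |z₁|² = 1 turns the second potential into U - 1.
  let U : ℝ → ℝ := fun t => 4 * level 0 (Z t) - 1 / 3
  have hU : ∀ t, (U t : ℂ) = Z t 1 * conj (Z t 1) - 2 * (Z t 0 * conj (Z t 0)) := fun t => by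
    rw [Complex.mul_conj, Complex.mul_conj, h.normSq_eq le_rfl, h.normSq_eq le_rfl]
    simp [U, momentVector]
    ring
  have hp : ∀ t, HasDerivAt (fun t => -I * conj (Z t 0 * Z t 1)) (U t * Z t 0) t := fun t => by
    refine (((hz t).mul (hy t)).conj.const_mul (-I)).congr_deriv ?_
    rw [hU]
    simp [hc2]
    linear_combination (-(Z t 0 * Z t 1 * conj (Z t 1)) + 2 * Z t 0 ^ 2 * conj (Z t 0)) *
      Complex.I_sq
  have hq' : ∀ t, HasDerivAt (fun t => 2 * I * conj (Z t 0 * Z t 0)) ((U t - 1) * Z t 1) t :=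
    fun t => by
    refine (((hz t).mul (hz t)).conj.const_mul (2 * I)).congr_deriv ?_
    rw [hU]
    simp
    linear_combination (4 * Z t 0 * Z t 1 * conj (Z t 0)) * Complex.I_sq - Z t 1 * hsum t
  have hJ0 : (J : ℂ) ≠ 0 := by exact_mod_cast hJ.1.ne'
  -- The two Wronskians are 2iJ and -4iJ; here J ≠ 0 enters.
  have hD : ∀ t, Z t 0 * conj (-I * conj (Z t 0 * Z t 1)) -
      conj (Z t 0) * (-I * conj (Z t 0 * Z t 1)) ≠ 0 := fun t => by
    rw [show Z t 0 * conj (-I * conj (Z t 0 * Z t 1)) -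
      conj (Z t 0) * (-I * conj (Z t 0 * Z t 1)) = 2 * I * J by
        have := hP t
        simp at this ⊢
        linear_combination I * this]
    simp [hJ0]
  have hD' : ∀ t, Z t 1 * conj (2 * I * conj (Z t 0 * Z t 0)) -
      conj (Z t 1) * (2 * I * conj (Z t 0 * Z t 0)) ≠ 0 := fun t => by
    rw [show Z t 1 * conj (2 * I * conj (Z t 0 * Z t 0)) -
      conj (Z t 1) * (2 * I * conj (Z t 0 * Z t 0)) = -4 * I * J by
        have := hP t
        simp [hc2] at this ⊢
        linear_combination -2 * I * this]
    simp [hJ0]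
  -- At α = 0 the nine frequencies collapse to 0, 1, 2. With z₂ = z₀, frequency 1 is bilinear in z₀
  -- and z₁, frequency 2 is quadratic in z₀, and frequency 0 is a quadratic in z₀ plus one in z₁.
  obtain ⟨b1, b2, b3, b4⟩ := bilinear_coeffs_eq_zero_of_ode hz hp hy hq' hD hD'
    (a := 2 * H 1 0) (b := 2 * H 2 1) (c := 2 * conj (G 0 1)) (d := 2 * G 1 2) fun t => by
      have := (hF t).2 1 one_pos
      rw [Finset.sum_filter] at this
      norm_num [Fin.sum_univ_succ, quadFreq, quadCoeff, h2] at this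
      linear_combination this
  obtain ⟨c1, c2, c3⟩ := quadratic_coeffs_eq_zero_of_ode hz hp hD
    (a := 2 * H 2 0) (b := conj (G 0 0)) (c := G 2 2) fun t => by
      have := (hF t).2 2 two_pos
      rw [Finset.sum_filter] at this
      norm_num [Fin.sum_univ_succ, quadFreq, quadCoeff, h2] at this
      linear_combination this
  obtain ⟨t₀, ht₀⟩ := h.exists_coordProd_im_ne_zero hα ⟨hJ.1.le, hJ.2.le⟩ hJ.2.ne
  obtain ⟨⟨d1, d2, d3⟩, d4, d5, d6⟩ := two_quadratic_coeffs_eq_zero_of_ode hz hp hy hq' hD hD'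
    (t₀ := t₀) (U' := (4 * (2 * (coordProd (Z t₀)).im) : ℝ))
    (((h.hasDerivAt_level le_rfl t₀).const_mul 4).sub_const (1 / 3)).ofReal_comp
    (by simpa using ht₀)
    (a := (H 0 0).re + (H 2 2).re) (b := conj (G 0 2)) (c := G 0 2)
    (a' := (H 1 1).re) (b' := conj (G 1 1) / 2) (c' := G 1 1 / 2) fun t => by
      have := (hF t).1
      rw [Finset.sum_filter] at this
      norm_num [Fin.sum_univ_succ, quadFreq, quadCoeff, h2] at this
      rw [Complex.mul_conj, Complex.mul_conj]
      apply Complex.ext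
      · simp [h2] at this ⊢
        linear_combination this
      · simp
        ring
  refine diagonal_of_coeffs hMr hH hG (fun j => ?_) ⟨b1, c1, b2, b3, by simp [d3], b4, c2,
    by simpa using d5, c3⟩
  have d1' : (H 0 0).re + (H 2 2).re = 0 := by exact_mod_cast d1
  have d4' : (H 1 1).re = 0 := by exact_mod_cast d4
  fin_cases j <;> simp [weight]
  · exact d4'
  · linarith

end IsProfile

/-! ### Congruent members of the family. -/

/-- The isometry of `ℂ³` given by a unitary matrix. -/
noncomputable def unitaryIsometry {B : Matrix (Fin 3) (Fin 3) ℂ}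
    (hB : B ∈ Matrix.unitaryGroup (Fin 3) ℂ) : C3 ≃ₗᵢ[ℝ] C3 :=
  LinearIsometry.toLinearIsometryEquiv
    ({ (matAct B : C3 →ₗ[ℝ] C3) with norm_map' := norm_matAct hB } : C3 →ₗᵢ[ℝ] C3) rfl

theorem sum_single (x : C3) : x = EuclideanSpace.single 0 (x 0) + EuclideanSpace.single 1 (x 1) +
    EuclideanSpace.single 2 (x 2) := by
  ext j
  fin_cases j <;> simp

/-- The real-linear forms on `ℂ³` that vanish on a Clifford torus are zero. -/
theorem eq_zero_of_forall_cliffordTorus {φ : ℝ} {L : C3 →ₗ[ℝ] ℝ}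
    (hL : ∀ x ∈ cliffordTorus φ, L x = 0) : L = 0 := by
  have hs3 : (1 / √3 : ℝ) ≠ 0 := by positivity
  have key : ∀ (j : Fin 3) (a : ℝ),
      L (EuclideanSpace.single j (((1 / √3 : ℝ) : ℂ) * Complex.exp (a * I))) = 0 := by
    intro j a
    have hpi : Complex.exp ((φ - a - Real.pi) * I) = -Complex.exp ((φ - a) * I) := by
      rw [sub_mul _ (Real.pi : ℂ), Complex.exp_sub, Complex.exp_pi_mul_I, div_neg, div_one]
    let f : (Fin 3 → ℝ) → C3 := fun b =>
      WithLp.toLp 2 fun j => ((1 / √3 : ℝ) : ℂ) * Complex.exp (b j * I)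
    have hf : ∀ b : Fin 3 → ℝ, ∑ j, b j = φ → L (f b) = 0 := fun b hb => hL _ ⟨b, hb, fun _ => rfl⟩
    -- Shifting the other two angles by π and -π keeps the sum and flips both signs, so adding the
    -- two points isolates the coordinate j.
    obtain ⟨b, b', hb, hb', hbb⟩ : ∃ b b' : Fin 3 → ℝ, ∑ j, b j = φ ∧ ∑ j, b' j = φ ∧
        f b + f b' = (2 : ℝ) • EuclideanSpace.single j
          (((1 / √3 : ℝ) : ℂ) * Complex.exp (a * I)) := by
      fin_cases j
      · refine ⟨![a, 0, φ - a], ![a, Real.pi, φ - a - Real.pi], by simp [Fin.sum_univ_three],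
          by simp [Fin.sum_univ_three], ?_⟩
        ext k
        fin_cases k <;> simp [f, hpi] <;> ring
      · refine ⟨![φ - a, a, 0], ![φ - a - Real.pi, a, Real.pi], by simp [Fin.sum_univ_three],
          by simp [Fin.sum_univ_three]; ring, ?_⟩
        ext k
        fin_cases k <;> simp [f, hpi] <;> ring
      · refine ⟨![0, φ - a, a], ![Real.pi, φ - a - Real.pi, a], by simp [Fin.sum_univ_three],
          by simp [Fin.sum_univ_three], ?_⟩
        ext k
        fin_cases k <;> simp [f, hpi] <;> ring
    have := congrArg L hbb
    rw [map_add, hf b hb, hf b' hb', map_smul, smul_eq_mul, add_zero] at this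
    linarith
  have key' : ∀ (j : Fin 3) (w : ℂ), L (EuclideanSpace.single j w) = 0 := by
    intro j w
    have hw : EuclideanSpace.single j w = (√3 * ‖w‖) • EuclideanSpace.single j
        (((1 / √3 : ℝ) : ℂ) * Complex.exp (w.arg * I)) := by
      have h3 : ((√3 : ℝ) : ℂ) ≠ 0 := by simp
      have e : w = ((√3 * ‖w‖ : ℝ) : ℂ) * (((1 / √3 : ℝ) : ℂ) * Complex.exp (w.arg * I)) := by
        conv_lhs => rw [← Complex.norm_mul_exp_arg_mul_I w]
        push_cast
        field_simp
      ext k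
      by_cases hk : k = j
      · subst hk
        simpa using e
      · simp [hk]
    rw [hw, map_smul, key, smul_zero]
  ext x
  rw [sum_single x, map_add, map_add, key', key', key']
  simp

namespace IsProfile

variable {α α' J J' : ℝ} {Z Z' : ℝ → C3}

/-- Conjugating all coordinates and changing the sign of the middle one preserves both the flow and
the start, which is real with z₁ = 0. The group acts trivially on z₁ since its weight is 0. Products
with Re z₁ are further quadratic forms vanishing on this surface, hence its exclusion below. -/
theorem coord_one_re_eq_zero (h : IsProfile 0 0 Z) (p : ℝ × ℝ) : (sweep 0 Z p 1).re = 0 := by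
  have hα : (0 : ℝ) ∈ Set.Icc (0 : ℝ) 1 := ⟨le_rfl, zero_le_one⟩
  have hd := fun t j => (hasDerivAt_C3.1 (h.flow t)) j
  have h1 : Z 0 1 = 0 := by
    have := h.coordProd_zero le_rfl
    rw [coordProd, h.coord_two_eq_of_zero] at this
    simpa [h.coord_zero_ne hα] using this
  have : Z = fun t => WithLp.toLp 2 ![conj (Z t 0), -conj (Z t 1), conj (Z t 2)] := by
    refine h.eq_of_flow (t₀ := 0) (fun t => hasDerivAt_C3.2 fun j => ?_) (fun t => ?_) ?_
    · fin_cases j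
      · simpa [momentVector] using (hd t 0).conj
      · refine HasDerivAt.congr_deriv (f := fun t => -conj (Z t 1)) (hd t 1).conj.neg ?_
        simp [momentVector, map_ofNat]
      · simpa [momentVector] using (hd t 2).conj
    · refine le_of_eq ((sq_eq_sq₀ (norm_nonneg _) zero_le_one).1 ?_)
      rw [norm_sq_C3, one_pow, ← h.sum_normSq t, Fin.sum_univ_three, Fin.sum_univ_three]
      simp
    · ext j
      fin_cases j
      · rw [h.start_eq le_rfl]
        simp
      · simp [h1]
      · rw [h.start_eq le_rfl]
        simp
  have h2 := congrArg (fun z : C3 => (z 1).re) (congrFun this p.2)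
  simp at h2
  simp [sweep, weight]
  linarith

theorem quadratic_forms (h : IsProfile α J Z) (hα : α ∈ Set.Icc (0 : ℝ) 1)
    (hJ : J ∈ Set.Icc (0 : ℝ) maxJ) (hα1 : α ≠ 1) (hJ1 : J ≠ maxJ) (h0 : ¬ (α = 0 ∧ J = 0))
    {M : C3 →L[ℝ] C3} (hM : ∀ x y, inner ℝ (M x) y = inner ℝ x (M y))
    (hq : ∀ p, inner ℝ (sweep α Z p) (M (sweep α Z p)) = 0) :
    ∃ c : ℝ, ∀ x j, M x j = (c * weight α j : ℝ) * x j := by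
  rcases hα.1.eq_or_lt with rfl | hα0
  · have hJ0 : J ≠ 0 := fun h => h0 ⟨rfl, h⟩
    exact h.quadratic_forms_of_zero ⟨lt_of_le_of_ne hJ.1 hJ0.symm, lt_of_le_of_ne hJ.2 hJ1⟩ hM hq
  · exact h.quadratic_forms_of_pos ⟨hα0, lt_of_le_of_ne hα.2 hα1⟩ hJ hJ1 hM hq

/-- The extreme weights are 1 and -1 - α. For c > 0 they correspond in order, so c = 1; for c < 0
they are exchanged, which gives (1 + α)(1 + α') = 1. -/
theorem weights_eq_of_spectrum {c : ℝ} (hα : α ∈ Set.Ico (0 : ℝ) 1) (hα' : α' ∈ Set.Icc (0 : ℝ) 1)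
    (h1 : ∀ j, ∃ k, weight α' k = c * weight α j)
    (h2 : ∀ k, ∃ j, weight α' k = c * weight α j) : α = α' ∧ (c = 1 ∨ c = -1 ∧ α = 0) := by
  obtain ⟨a0, a1⟩ := hα
  obtain ⟨b0, b1⟩ := hα'
  have hle : ∀ k, weight α' k ≤ 1 := by
    intro k
    fin_cases k <;> simp [weight] <;> linarith
  obtain ⟨k, hk⟩ := h1 0
  obtain ⟨j, hj⟩ := h2 0
  obtain ⟨i, hi⟩ := h2 2
  have hc1 : c ≤ 1 := by
    have := hle k
    rw [hk] at this
    simpa [weight] using this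
  have hj' : c = 1 ∨ c * (1 + α) = -1 := by
    fin_cases j <;> simp [weight] at hj
    · exact Or.inl hj.symm
    · nlinarith
    · right; linarith
  rcases hj' with rfl | hc
  · fin_cases i <;> simp [weight] at hi
    · linarith
    · linarith
    · exact ⟨by linarith, Or.inl rfl⟩
  · have hneg : c < 0 := by nlinarith
    fin_cases i <;> simp [weight] at hi
    · have : α = 0 ∧ α' = 0 := by
        constructor <;> nlinarith
      obtain ⟨rfl, rfl⟩ := this
      exact ⟨rfl, Or.inr ⟨by linarith, rfl⟩⟩
    · nlinarith
    · nlinarith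

/-- Among the surfaces which are not Clifford tori and not the exceptional one, congruent surfaces
have the same parameters. -/
theorem eq_of_image_eq (h : IsProfile α J Z) (h' : IsProfile α' J' Z')
    (hα : α ∈ Set.Icc (0 : ℝ) 1) (hJ : J ∈ Set.Icc (0 : ℝ) maxJ)
    (hα' : α' ∈ Set.Icc (0 : ℝ) 1) (hJ' : J' ∈ Set.Icc (0 : ℝ) maxJ)
    (hα1 : α ≠ 1) (hJ1 : J ≠ maxJ) (h0 : ¬ (α = 0 ∧ J = 0)) (F : C3 ≃ₗᵢ[ℝ] C3)
    (hF : F '' Set.range (sweep α Z) = Set.range (sweep α' Z')) : α = α' ∧ J = J' := by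
  let D : C3 →L[ℝ] C3 := matAct (Matrix.diagonal fun j => (weight α' j : ℂ))
  have hDa : ∀ x j, D x j = weight α' j * x j := fun x j => by
    simp [D, matAct_apply, Matrix.diagonal_apply]
  have hDs : ∀ x y, inner ℝ (D x) y = inner ℝ x (D y) := fun x y => by
    rw [inner_real_C3, inner_real_C3]
    refine Finset.sum_congr rfl fun j _ => ?_
    simp [hDa]
    ring
  -- The moment form of the second surface pulled back by F; it vanishes on the first surface.
  let M : C3 →L[ℝ] C3 := (F.symm : C3 →L[ℝ] C3) ∘L D ∘L (F : C3 →L[ℝ] C3)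
  have hMa : ∀ x, F (M x) = D (F x) := fun x => by simp [M]
  obtain ⟨c, hc⟩ := h.quadratic_forms hα hJ hα1 hJ1 h0 (M := M) (fun x y => by
    rw [← F.inner_map_map, ← F.inner_map_map x, hMa, hMa, hDs]) (fun p => by
    rw [← F.inner_map_map, hMa]
    obtain ⟨p', hp'⟩ : F (sweep α Z p) ∈ Set.range (sweep α' Z') :=
      hF ▸ Set.mem_image_of_mem _ ⟨p, rfl⟩
    rw [← hp', inner_real_C3, ← h'.sum_weight_normSq p'.2]
    refine Finset.sum_congr rfl fun j _ => ?_
    rw [← IsProfile.normSq_sweep p', hDa, Complex.normSq_apply]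
    simp
    ring)
  have hαlt : α < 1 := lt_of_le_of_ne hα.2 hα1
  have hsing : ∀ j a, M (EuclideanSpace.single j a) =
      (c * weight α j : ℝ) • EuclideanSpace.single j a := by
    intro j a
    ext k
    rw [hc]
    by_cases hk : k = j
    · subst hk
      simp
    · simp [hk]
  have heig : ∀ j a k, F (EuclideanSpace.single j a) k ≠ 0 → weight α' k = c * weight α j := by
    intro j a k hk
    have := hMa (EuclideanSpace.single j a)
    rw [hsing, map_smul] at this
    have := congrArg (fun z : C3 => z k) this
    simp only [hDa, PiLp.smul_apply, Complex.real_smul] at this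
    exact (Complex.ofReal_injective (mul_right_cancel₀ hk this)).symm
  obtain ⟨rfl, hcc⟩ := weights_eq_of_spectrum (c := c) ⟨hα.1, hαlt⟩ hα' (fun j => by
    have hne : F (EuclideanSpace.single j 1) ≠ 0 := by
      rw [Ne, map_eq_zero_iff F F.injective]
      simp
    obtain ⟨k, hk⟩ : ∃ k, F (EuclideanSpace.single j 1) k ≠ 0 := by
      by_contra! hall
      exact hne (by ext k; simp [hall k])
    exact ⟨k, heig j 1 k hk⟩) (fun k => by
    by_contra! hall
    have hz : ∀ x, F x k = 0 := by
      intro x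
      have e : ∀ j a, F (EuclideanSpace.single j a) k = 0 := fun j a => by
        by_contra hne
        exact hall j (heig j a k hne)
      rw [sum_single x, map_add, map_add]
      simp [e]
    have := hz (F.symm (EuclideanSpace.single k 1))
    simp at this)
  -- As α < 1, the middle weight is simple and corresponds to itself, so F preserves the middle
  -- coordinate line and its complement, hence |x₁| and the level.
  have hw1 : ∀ k, weight α k = c * weight α 1 ↔ k = 1 := by
    have := hα.1
    rcases hcc with rfl | ⟨rfl, rfl⟩ <;> intro k <;> fin_cases k <;> simp [weight] <;> intro h <;>
      linarith
  have hw1' : ∀ j, weight α 1 = c * weight α j ↔ j = 1 := by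
    have := hα.1
    rcases hcc with rfl | ⟨rfl, rfl⟩ <;> intro k <;> fin_cases k <;> simp [weight] <;> intro h <;>
      linarith
  have hF1 : ∀ x, F x 1 = F (EuclideanSpace.single 1 (x 1)) 1 := by
    intro x
    have e : ∀ j a, j ≠ 1 → F (EuclideanSpace.single j a) 1 = 0 := fun j a hj => by
      by_contra hne
      exact hj ((hw1' j).1 (heig j a 1 hne))
    conv_lhs => rw [sum_single x, map_add, map_add]
    simp [e]
  have hnorm : ∀ x, normSq (F x 1) = normSq (x 1) := by
    intro x
    have e : ∀ a k, k ≠ 1 → F (EuclideanSpace.single 1 a) k = 0 := fun a k hk => by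
      by_contra hne
      exact hk ((hw1 k).1 (heig 1 a k hne))
    have e1 : ‖F (EuclideanSpace.single 1 (x 1))‖ ^ 2 =
        ‖(EuclideanSpace.single 1 (x 1) : C3)‖ ^ 2 := by
      rw [F.norm_map]
    rw [norm_sq_C3, norm_sq_C3, Fin.sum_univ_three, Fin.sum_univ_three, e _ 0 (by simp),
      e _ 2 (by simp), ← hF1] at e1
    simpa using e1
  have hlev : level α (Z 0) = level α (Z' 0) := by
    have hsweep : ∀ {Z : ℝ → C3} (p : ℝ × ℝ), level α (sweep α Z p) = level α (Z p.2) := by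
      intro Z p
      simp only [level, sweep, normSq_rotate]
    have hFl : ∀ x, level α (F x) = level α x := fun x => by simp only [level, hnorm]
    have h00 : ∀ Z : ℝ → C3, sweep α Z (0, 0) = Z 0 := fun Z => rotate_zero _ _
    apply le_antisymm
    · obtain ⟨x, ⟨p, rfl⟩, hx⟩ : Z' 0 ∈ F '' Set.range (sweep α Z) := hF ▸ ⟨(0, 0), h00 Z'⟩
      rw [← hx, hFl, hsweep]
      exact h.level_zero_le hα hJ.1 _
    · obtain ⟨p, hp⟩ : F (Z 0) ∈ Set.range (sweep α Z') :=
        hF ▸ Set.mem_image_of_mem _ ⟨(0, 0), h00 Z⟩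
      rw [← hFl (Z 0), ← hp, hsweep]
      exact h'.level_zero_le hα hJ'.1 _
  refine ⟨rfl, (sq_eq_sq₀ hJ.1 hJ'.1).1 ?_⟩
  rw [← h.levelCubic_level_zero hα.1, ← h'.levelCubic_level_zero hα.1, hlev]

end IsProfile

/-- If the first surface is the one with α = J = 0, the inverse isometry is used, unless the second
is a Clifford torus; that one is contained in no hyperplane through the origin. -/
theorem not_areCongruent (θ : ℝ) {α J α' J' : ℝ} (hα : α ∈ Set.Icc (0 : ℝ) 1)
    (hJ : J ∈ Set.Icc (0 : ℝ) maxJ) (hα' : α' ∈ Set.Icc (0 : ℝ) 1) (hJ' : J' ∈ Set.Icc (0 : ℝ) maxJ)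
    (h : ¬ (α = 1 ∨ J = maxJ)) (hne : (α, J) ≠ (α', J')) :
    ¬ AreCongruent (legendrianFamily θ α J) (legendrianFamily θ α' J') := by
  rintro ⟨F, hF⟩
  push Not at h
  have hP := isProfile_profile hα hJ
  have hP' := isProfile_profile hα' hJ'
  let E := unitaryIsometry (smul_one_mem_unitary (conj_phase_mul θ))
  have hr : ∀ α J, Set.range (legendrianFamily θ α J) = E '' Set.range (sweep α (profile α J)) :=
    fun α J => Set.range_comp E _
  have hF' : (E.trans F) '' Set.range (sweep α (profile α J)) =
      Set.range (legendrianFamily θ α' J') := by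
    rw [← hF, hr, Set.image_image]
    rfl
  have hF'' : ((E.trans F).trans E.symm) '' Set.range (sweep α (profile α J)) =
      Set.range (sweep α' (profile α' J')) := by
    have : E.symm '' Set.range (legendrianFamily θ α' J') =
        Set.range (sweep α' (profile α' J')) := by
      rw [hr, Set.image_image]
      simp
    rw [← this, ← hF', Set.image_image]
    rfl
  by_cases h0 : α = 0 ∧ J = 0
  · obtain ⟨rfl, rfl⟩ := h0
    by_cases hC : α' = 1 ∨ J' = maxJ
    · obtain ⟨φ, B, hB, hrB⟩ := exists_range_eq_cliffordTorus θ hα' hJ' hC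
      let B' := unitaryIsometry (Matrix.mem_specialUnitaryGroup_iff.1 hB).1
      let L : C3 →ₗ[ℝ] ℝ := Complex.reLm ∘ₗ
        (EuclideanSpace.projₗ (1 : Fin 3) : C3 →ₗ[ℂ] ℂ).restrictScalars ℝ ∘ₗ
        ((B'.trans (E.trans F).symm).toLinearEquiv : C3 →ₗ[ℝ] C3)
      have hL : ∀ x, L x = ((E.trans F).symm (B' x) 1).re := fun x => rfl
      have hL0 : L = 0 := by
        refine eq_zero_of_forall_cliffordTorus (φ := φ) fun x hx => ?_
        obtain ⟨y, ⟨p, rfl⟩, hy⟩ : B' x ∈ (E.trans F) '' Set.range (sweep 0 (profile 0 0)) := by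
          rw [hF', hrB]
          exact Set.mem_image_of_mem _ hx
        rw [hL, ← hy, LinearIsometryEquiv.symm_apply_apply]
        exact hP.coord_one_re_eq_zero p
      have := hL (B'.symm ((E.trans F) (EuclideanSpace.single 1 1)))
      rw [hL0, LinearIsometryEquiv.apply_symm_apply, LinearIsometryEquiv.symm_apply_apply] at this
      simp at this
    · push Not at hC
      obtain ⟨e1, e2⟩ := hP'.eq_of_image_eq hP hα' hJ' hα hJ hC.1 hC.2
        (fun h => hne (by rw [h.1, h.2])) ((E.trans F).trans E.symm).symm (by
          rw [← hF'', Set.image_image]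
          simp)
      exact hne (by rw [e1, e2])
  · obtain ⟨e1, e2⟩ := hP.eq_of_image_eq hP' hα hJ hα' hJ' h.1 h.2 h0 _ hF''
    exact hne (by rw [e1, e2])

/-! ### The conjugate cross product and the calibration. -/

theorem inner_complex_C3 (x y : C3) : inner ℂ x y =
    conj (x 0) * y 0 + conj (x 1) * y 1 + conj (x 2) * y 2 := by
  simp only [PiLp.inner_apply, RCLike.inner_apply, Fin.sum_univ_three]
  ring

theorem inner_real_eq_re (x y : C3) : inner ℝ x y = (inner ℂ x y).re := rfl

theorem inner_conjCross_left (x y : C3) : inner ℂ x (conjCross x y) = 0 := by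
  rw [inner_complex_C3]
  simp
  ring

theorem inner_conjCross_right (x y : C3) : inner ℂ y (conjCross x y) = 0 := by
  rw [inner_complex_C3]
  simp
  ring

theorem conjCross_swap (x y : C3) : conjCross y x = -conjCross x y := by
  ext j
  simp
  ring

theorem conjCross_self (x : C3) : conjCross x x = 0 := by
  ext j
  simp
  ring

theorem conjCross_add_right (x y z : C3) : conjCross x (y + z) = conjCross x y + conjCross x z := by
  ext j
  simp
  ring

theorem conjCross_smul_right (c : ℂ) (x y : C3) : conjCross x (c • y) = conj c • conjCross x y := by
  ext j
  simp
  ring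

theorem conjCross_real_smul_right (r : ℝ) (x y : C3) : conjCross x (r • y) = r • conjCross x y := by
  ext j
  simp
  ring

theorem conjCross_add_left (x y z : C3) : conjCross (x + y) z = conjCross x z + conjCross y z := by
  rw [conjCross_swap, conjCross_add_right, neg_add, ← conjCross_swap, ← conjCross_swap]

theorem conjCross_real_smul_left (r : ℝ) (x y : C3) : conjCross (r • x) y = r • conjCross x y := by
  rw [conjCross_swap, conjCross_real_smul_right, ← smul_neg, ← conjCross_swap]

theorem conjCross_conjCross (x y z : C3) :
    conjCross x (conjCross y z) = (inner ℂ x z : ℂ) • y - (inner ℂ x y : ℂ) • z := by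
  ext j
  rw [inner_complex_C3, inner_complex_C3]
  fin_cases j <;> simp <;> ring

theorem inner_conjCross_conjCross (x y z : C3) : inner ℂ (conjCross x y) (conjCross x z) =
    inner ℂ x x * inner ℂ z y - inner ℂ x y * inner ℂ z x := by
  simp only [inner_complex_C3]
  simp
  ring

theorem norm_conjCross_sq (x y : C3) :
    ‖conjCross x y‖ ^ 2 = ‖x‖ ^ 2 * ‖y‖ ^ 2 - normSq (inner ℂ x y) := by
  have h := inner_conjCross_conjCross x y y
  rw [inner_self_eq_norm_sq_to_K, inner_self_eq_norm_sq_to_K, inner_self_eq_norm_sq_to_K,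
    ← inner_conj_symm y x, Complex.mul_conj] at h
  apply Complex.ofReal_injective
  push_cast
  exact h

theorem slagForm_zero_eq_inner (x y z : C3) : slagForm 0 x y z = inner ℝ (conjCross x y) z := by
  rw [inner_real_eq_re, inner_complex_C3, slagForm, Matrix.det_fin_three]
  simp
  ring

theorem HasDerivAt.conjCross {x y : ℝ → C3} {x' y' : C3} {t : ℝ} (hx : HasDerivAt x x' t)
    (hy : HasDerivAt y y' t) :
    HasDerivAt (fun t => conjCross (x t) (y t)) (conjCross x' (y t) + conjCross (x t) y') t := by
  rw [hasDerivAt_C3] at hx hy ⊢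
  intro j
  refine (((hx (j + 1)).mul (hy (j + 2))).sub ((hx (j + 2)).mul (hy (j + 1)))).conj.congr_deriv ?_
  simp
  ring

/-- The equality case of the calibration inequality. -/
theorem calibration_equality {a b c : C3} {ε : ℝ} (hε : ε = 1 ∨ ε = -1) (ha : ‖a‖ = 1)
    (hpos : 0 < ‖b‖ ^ 2 * ‖c‖ ^ 2 - (inner ℝ b c) ^ 2)
    (hcal : slagForm 0 a b c = ε * √(‖b‖ ^ 2 * ‖c‖ ^ 2 - (inner ℝ b c) ^ 2)) :
    inner ℂ a b = 0 ∧ c = (inner ℝ b c / ‖b‖ ^ 2) • b +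
      (slagForm 0 a b c / ‖b‖ ^ 2) • conjCross a b := by
  set N := conjCross a b with hN
  have hb : 0 < ‖b‖ ^ 2 := by
    by_contra! hb
    nlinarith [sq_nonneg ‖c‖, sq_nonneg (inner ℝ b c : ℝ)]
  have hb0 : ‖b‖ ≠ 0 := fun h => by simp [h] at hb
  have hNb : inner ℝ b N = 0 := by
    rw [inner_real_eq_re, hN, inner_conjCross_right, Complex.zero_re]
  have hsq : (inner ℝ N c) ^ 2 = ‖b‖ ^ 2 * ‖c‖ ^ 2 - (inner ℝ b c) ^ 2 := by
    rw [← slagForm_zero_eq_inner, hcal, mul_pow, Real.sq_sqrt hpos.le]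
    rcases hε with rfl | rfl <;> norm_num
  have hNn := norm_conjCross_sq a b
  rw [← hN, ha, one_pow, one_mul] at hNn
  -- For the part c' of c orthogonal to b, calibration says ⟨N, c'⟩² = |b|²|c'|². Cauchy-Schwarz
  -- gives |b| ≤ |N|, whereas |N|² = |b|² - |⟨a, b⟩|². So equality holds and c' is a multiple of N.
  set c' := c - (inner ℝ b c / ‖b‖ ^ 2) • b with hc'
  have h1 : inner ℝ N c' = inner ℝ N c := by
    rw [hc', inner_sub_right, inner_smul_right, real_inner_comm b N, hNb, mul_zero, sub_zero]
  have h2 : ‖b‖ ^ 2 * ‖c'‖ ^ 2 = ‖b‖ ^ 2 * ‖c‖ ^ 2 - (inner ℝ b c) ^ 2 := by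
    rw [hc', norm_sub_sq_real, inner_smul_right, norm_smul, mul_pow, real_inner_comm b c,
      Real.norm_eq_abs, sq_abs]
    field_simp
    ring
  have hcs := real_inner_mul_inner_self_le N c'
  rw [real_inner_self_eq_norm_sq, real_inner_self_eq_norm_sq, ← sq, h1, hsq, ← h2] at hcs
  have hc'pos : 0 < ‖c'‖ ^ 2 := by
    rw [← h2] at hpos
    exact pos_of_mul_pos_right hpos hb.le
  have hle : ‖b‖ ^ 2 ≤ ‖N‖ ^ 2 := le_of_mul_le_mul_right hcs hc'pos
  have h0 : normSq (inner ℂ a b) = 0 := le_antisymm (by linarith) (Complex.normSq_nonneg _)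
  rw [h0, sub_zero] at hNn
  refine ⟨Complex.normSq_eq_zero.1 h0, ?_⟩
  rw [slagForm_zero_eq_inner, ← hN]
  have h3 : ‖c' - (inner ℝ N c / ‖b‖ ^ 2) • N‖ ^ 2 = 0 := by
    rw [norm_sub_sq_real, inner_smul_right, norm_smul, mul_pow, hNn, real_inner_comm N c', h1,
      Real.norm_eq_abs, sq_abs]
    have : ‖c'‖ ^ 2 = (inner ℝ N c) ^ 2 / ‖b‖ ^ 2 := by
      rw [eq_div_iff hb.ne', hsq, ← h2]
      ring
    rw [this]
    field_simp
    ring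
  have h4 := sub_eq_zero.1 (norm_eq_zero.1 (pow_eq_zero_iff two_ne_zero |>.1 h3))
  rw [← h4, hc']
  abel

/-! ### Structure equations of equivariant special Legendrian surfaces. -/

/-- The structure equations of a special Legendrian immersion of the form `e^{As} z(t)`. -/
structure IsEquivariantLegendrian (A : C3 →L[ℝ] C3) (w : ℝ × ℝ → C3) (β γ : ℝ → ℝ) : Prop where
  skew : ∀ x y, inner ℝ (A x) y = -inner ℝ x (A y)
  smooth_left : ContDiff ℝ ∞ β
  smooth_right : ContDiff ℝ ∞ γ
  ne_zero : ∀ t, γ t ≠ 0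
  norm_eq : ∀ p, ‖w p‖ = 1
  generator_ne_zero : ∀ p, A (w p) ≠ 0
  inner_generator : ∀ p, inner ℂ (w p) (A (w p)) = 0
  hasDerivAt_fst : ∀ s t, HasDerivAt (fun s => w (s, t)) (A (w (s, t))) s
  hasDerivAt_snd : ∀ s t, HasDerivAt (fun t => w (s, t))
    (β t • A (w (s, t)) + γ t • conjCross (w (s, t)) (A (w (s, t)))) t
  generator_conjCross : ∀ p, A (conjCross (w p) (A (w p))) = conjCross (w p) (A (A (w p)))

@[simp] theorem exp_zero_smul_apply (A : C3 →L[ℝ] C3) (x : C3) :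
    NormedSpace.exp ((0 : ℝ) • A) x = x := by
  have h : (0 : ℝ) • A = 0 := by
    ext1 y
    exact zero_smul ℝ (A y)
  rw [h, NormedSpace.exp_zero]
  rfl

theorem generator_exp_smul (A : C3 →L[ℝ] C3) (s : ℝ) (x : C3) :
    A (NormedSpace.exp (s • A) x) = NormedSpace.exp (s • A) (A x) := by
  have := eq_exp_smul_of_hasDerivAt A (x := fun s => A (NormedSpace.exp (s • A) x))
    (fun s => A.hasFDerivAt.comp_hasDerivAt s (hasDerivAt_exp_smul_apply A x s)) s
  simpa using this.symm

theorem inner_exp_smul {A : C3 →L[ℝ] C3} (hA : ∀ x y, inner ℝ (A x) y = -inner ℝ x (A y))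
    (s : ℝ) (x y : C3) :
    inner ℝ (NormedSpace.exp (s • A) x) (NormedSpace.exp (s • A) y) = inner ℝ x y := by
  have hd : ∀ s, HasDerivAt (fun s : ℝ => (inner ℝ (NormedSpace.exp (s • A) x)
      (NormedSpace.exp (s • A) y) : ℝ)) 0 s := fun s =>
    ((hasDerivAt_exp_smul_apply A x s).inner ℝ (hasDerivAt_exp_smul_apply A y s)).congr_deriv (by
      rw [hA, add_neg_cancel])
  have := is_const_of_deriv_eq_zero (fun s => (hd s).differentiableAt) (fun s => (hd s).deriv) s 0
  simpa using this

theorem contDiff_conjCross {E : Type*} [NormedAddCommGroup E] [NormedSpace ℝ E] {f g : E → C3}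
    {n : WithTop ℕ∞} (hf : ContDiff ℝ n f) (hg : ContDiff ℝ n g) :
    ContDiff ℝ n fun x => conjCross (f x) (g x) := by
  rw [contDiff_C3] at hf hg ⊢
  intro j
  exact contDiff_conj.comp (((hf (j + 1)).mul (hg (j + 2))).sub ((hf (j + 2)).mul (hg (j + 1))))

theorem gram_pos_of_injective {u : ℝ × ℝ → C3} {p : ℝ × ℝ}
    (h : Function.Injective (fderiv ℝ u p)) :
    0 < ‖partialS u p‖ ^ 2 * ‖partialT u p‖ ^ 2 - (inner ℝ (partialS u p) (partialT u p)) ^ 2 := by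
  set b := partialS u p with hb
  set c := partialT u p with hc
  have hb0 : b ≠ 0 := by
    intro h0
    rw [hb, partialS, map_eq_zero_iff _ h] at h0
    simp at h0
  have hbp : 0 < ‖b‖ ^ 2 := by positivity
  have hx : fderiv ℝ u p (-inner ℝ b c, ‖b‖ ^ 2) ≠ 0 := by
    rw [Ne, map_eq_zero_iff _ h]
    intro h0
    exact hbp.ne' (congrArg Prod.snd h0)
  rw [fderiv_apply_eq_partial, ← hb, ← hc] at hx
  have hx2 : 0 < ‖-(inner ℝ b c : ℝ) • b + ‖b‖ ^ 2 • c‖ ^ 2 := by positivity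
  have e : ‖-(inner ℝ b c : ℝ) • b + ‖b‖ ^ 2 • c‖ ^ 2 =
      ‖b‖ ^ 2 * (‖b‖ ^ 2 * ‖c‖ ^ 2 - (inner ℝ b c) ^ 2) := by
    rw [norm_add_sq_real, norm_smul, norm_smul, inner_smul_left, inner_smul_right]
    simp only [norm_neg, mul_pow, Real.norm_eq_abs, sq_abs, map_neg, conj_trivial]
    ring
  rw [e] at hx2
  exact pos_of_mul_pos_right hx2 hbp.le

theorem IsSpecialLegendrianImmersion.exists_isEquivariantLegendrian {w : ℝ × ℝ → C3}
    (hw : IsSpecialLegendrianImmersion 0 w) {A : C3 →L[ℝ] C3}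
    (hA : ∀ x y, inner ℝ (A x) y = -inner ℝ x (A y)) {z : ℝ → C3}
    (hz : ∀ s t : ℝ, w (s, t) = NormedSpace.exp (s • A) (z t)) :
    ∃ β γ : ℝ → ℝ, IsEquivariantLegendrian A w β γ := by
  obtain ⟨ε, hε, hcal⟩ := hw.calibrated
  have hz0 : z = fun t => w (0, t) := by
    funext t
    simp [hz]
  have hzs : ContDiff ℝ ∞ z := by
    rw [hz0]
    exact hw.smooth.comp (contDiff_const.prodMk contDiff_id)
  have hzd : ∀ t, HasDerivAt z (deriv z t) t := fun t =>
    (hzs.differentiable (by simp) t).hasDerivAt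
  have hds : ∀ s t, HasDerivAt (fun s => w (s, t)) (A (w (s, t))) s := by
    intro s t
    simp only [hz]
    exact hasDerivAt_exp_smul_apply A (z t) s
  have hS : ∀ s t, partialS w (s, t) = NormedSpace.exp (s • A) (A (z t)) := fun s t => by
    rw [← generator_exp_smul, ← hz]
    exact partialS_eq hw.smooth (hds s t)
  have hT : ∀ s t, partialT w (s, t) = NormedSpace.exp (s • A) (deriv z t) := fun s t =>
    partialT_eq hw.smooth (by
      simp only [hz]
      exact (NormedSpace.exp (s • A)).hasFDerivAt.comp_hasDerivAt t (hzd t))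
  have hinner : ∀ s x y, inner ℝ (NormedSpace.exp (s • A) x) (NormedSpace.exp (s • A) y) =
      inner ℝ x y := inner_exp_smul hA
  have hnorm : ∀ (s : ℝ) x, ‖NormedSpace.exp (s • A) x‖ ^ 2 = ‖x‖ ^ 2 := fun s x => by
    rw [← real_inner_self_eq_norm_sq, hinner, real_inner_self_eq_norm_sq]
  have hgram := fun p => gram_pos_of_injective (hw.immersion p)
  have hAz : ∀ t, A (z t) ≠ 0 := by
    intro t h0
    have := hgram (0, t)
    rw [hS, h0] at this
    simp at this
  let β : ℝ → ℝ := fun t => inner ℝ (A (z t)) (deriv z t) / ‖A (z t)‖ ^ 2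
  let γ : ℝ → ℝ := fun t => inner ℝ (conjCross (z t) (A (z t))) (deriv z t) / ‖A (z t)‖ ^ 2
  -- The calibrated value is a constant sign times the area density, which is invariant under the
  -- isometries exp(sA). So it does not depend on s, although A is not known to be complex linear.
  have hslag : ∀ s t, slagForm 0 (w (s, t)) (partialS w (s, t)) (partialT w (s, t)) =
      inner ℝ (conjCross (z t) (A (z t))) (deriv z t) := by
    intro s t
    have h1 := hcal (s, t)
    have h2 := hcal (0, t)
    rw [slagNormal] at h1 h2
    rw [← slagForm_zero_eq_inner, show A (z t) = partialS w (0, t) by simp [hS],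
      show deriv z t = partialT w (0, t) by simp [hT], hz0, h1, h2]
    simp only [areaDensity, hS, hT, hnorm, hinner]
  have hcase : ∀ s t, inner ℂ (w (s, t)) (A (w (s, t))) = 0 ∧
      NormedSpace.exp (s • A) (deriv z t) =
        β t • A (w (s, t)) + γ t • conjCross (w (s, t)) (A (w (s, t))) := by
    intro s t
    have hAw : A (w (s, t)) = partialS w (s, t) := by rw [hS, hz, generator_exp_smul]
    have h := calibration_equality hε (hw.mem_sphere (s, t)) (hgram (s, t)) (hcal (s, t))
    rw [hslag] at h
    rw [hAw]
    refine ⟨h.1, ?_⟩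
    have h2 := h.2
    rw [hT] at h2
    rw [h2]
    simp only [hS, hnorm, hinner, β, γ]
  have hγ0 : ∀ t, γ t ≠ 0 := by
    intro t
    refine div_ne_zero ?_ (by simpa using hAz t)
    rw [← hslag 0 t]
    have h2 := hcal (0, t)
    rw [slagNormal] at h2
    rw [h2]
    refine mul_ne_zero ?_ (Real.sqrt_pos.2 (hgram (0, t))).ne'
    rcases hε with rfl | rfl <;> norm_num
  have hz' : ContDiff ℝ ∞ (deriv z) := (contDiff_infty_iff_deriv.1 hzs).2
  have hAzs : ContDiff ℝ ∞ fun t => A (z t) := A.contDiff.comp hzs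
  have hden : ∀ t, ‖A (z t)‖ ^ 2 ≠ 0 := fun t => by simpa using hAz t
  -- The isometry exp(sA) carries both Aw and w_t along the orbit; since γ ≠ 0 it carries the normal
  -- as well. Differentiating in s gives the last structure equation.
  have hNexp : ∀ s t, NormedSpace.exp (s • A) (conjCross (z t) (A (z t))) =
      conjCross (w (s, t)) (A (w (s, t))) := by
    intro s t
    have h0 := (hcase 0 t).2
    have h1 := (hcase s t).2
    rw [hz 0 t] at h0
    simp only [exp_zero_smul_apply] at h0
    rw [h0, map_add, map_smul, map_smul, ← generator_exp_smul, ← hz] at h1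
    exact smul_right_injective _ (hγ0 t) (add_left_cancel h1)
  refine ⟨β, γ, hA, (hAzs.inner ℝ hz').div (hAzs.norm_sq ℝ) hden,
    ((contDiff_conjCross hzs hAzs).inner ℝ hz').div (hAzs.norm_sq ℝ) hden, hγ0, hw.mem_sphere,
    fun p h0 => ?_, fun p => (hcase p.1 p.2).1, hds, fun s t => ?_, fun p => ?_⟩
  · have := hnorm p.1 (A (z p.2))
    rw [← generator_exp_smul, ← hz, h0] at this
    exact hden p.2 (by simpa using this.symm)
  · rw [← (hcase s t).2, ← hT]
    exact hasDerivAt_partialT hw.smooth s t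
  · obtain ⟨s, t⟩ := p
    have h1 := hasDerivAt_exp_smul_apply A (conjCross (z t) (A (z t))) s
    simp only [hNexp] at h1
    have h2 := (hds s t).conjCross (y := fun s => A (w (s, t)))
      (A.hasFDerivAt.comp_hasDerivAt s (hds s t))
    have h3 := h1.unique h2
    rwa [conjCross_self, zero_add] at h3

/-! ### Compactness forces the generator into su(3). -/

/-- The second derivative test at a minimum. -/
theorem nonneg_of_hasDerivAt_of_forall_le {f f' : ℝ → ℝ} {t₀ c : ℝ}
    (hf : ∀ t, HasDerivAt f (f' t) t) (hmin : ∀ t, f t₀ ≤ f t) (h2 : HasDerivAt f' c t₀) :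
    f' t₀ = 0 ∧ 0 ≤ c := by
  have h0 : f' t₀ = 0 :=
    IsLocalMin.hasDerivAt_eq_zero (Filter.Eventually.of_forall hmin) (hf t₀)
  refine ⟨h0, ?_⟩
  by_contra! hc
  have h3 := hasDerivAt_iff_tendsto_slope.1 h2
  have h4 : ∀ᶠ t in nhdsWithin t₀ (Set.Ioi t₀), slope f' t₀ t < 0 :=
    (h3.eventually_lt_const hc).filter_mono (nhdsWithin_mono _ fun t ht => ne_of_gt ht)
  obtain ⟨u, hu, hlt⟩ := mem_nhdsGT_iff_exists_Ioo_subset.1 h4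
  have hu' : t₀ < u := hu
  have hanti : StrictAntiOn f (Set.Icc t₀ ((t₀ + u) / 2)) := by
    refine strictAntiOn_of_deriv_neg (convex_Icc _ _)
      (fun t _ => (hf t).continuousAt.continuousWithinAt) fun t ht => ?_
    rw [interior_Icc] at ht
    have h5 : slope f' t₀ t < 0 := hlt ⟨ht.1, by linarith [ht.2]⟩
    rw [slope_def_field, h0, sub_zero, div_lt_iff₀ (by linarith [ht.1]), zero_mul] at h5
    rwa [(hf t).deriv]
  have := hanti (Set.left_mem_Icc.2 (by linarith)) (Set.right_mem_Icc.2 (by linarith))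
    (by linarith : t₀ < (t₀ + u) / 2)
  exact absurd (hmin ((t₀ + u) / 2)) (not_le.2 this)

theorem exists_add_int_mem_Icc (x : ℝ × ℝ) :
    ∃ (y : ℝ × ℝ) (m n : ℤ), y ∈ Set.Icc (0 : ℝ) 1 ×ˢ Set.Icc (0 : ℝ) 1 ∧
      x = y + ((m : ℝ), (n : ℝ)) := by
  refine ⟨(Int.fract x.1, Int.fract x.2), ⌊x.1⌋, ⌊x.2⌋,
    ⟨⟨Int.fract_nonneg _, (Int.fract_lt_one _).le⟩, ⟨Int.fract_nonneg _, (Int.fract_lt_one _).le⟩⟩,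
    ?_⟩
  ext <;> simp

theorem CoversTorus.exists_forall_le {w : ℝ × ℝ → C3} (hw : CoversTorus w) (hc : Continuous w)
    {f : C3 → ℝ} (hf : Continuous f) : ∃ p, ∀ q, f (w p) ≤ f (w q) := by
  obtain ⟨ψ, hψ, hper⟩ := hw
  have hcont : Continuous fun x => f (w (ψ x)) := hf.comp (hc.comp hψ.1.continuous)
  obtain ⟨x, -, hx⟩ := (isCompact_Icc.prod isCompact_Icc :
    IsCompact (Set.Icc (0 : ℝ) 1 ×ˢ Set.Icc (0 : ℝ) 1)).exists_isMinOn
    ⟨(0, 0), by simp⟩ hcont.continuousOn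
  refine ⟨ψ x, fun q => ?_⟩
  obtain ⟨y, m, n, hy, hq⟩ := exists_add_int_mem_Icc (ψ.symm q)
  have := hx hy
  rw [← ψ.apply_symm_apply q, hq, hper]
  exact this

/-- The infinitesimal form of Bx × By = conj(det B) B(x × y) for unitary B. -/
theorem matAct_conjCross {H : Matrix (Fin 3) (Fin 3) ℂ} (hH : ∀ j k, conj (H j k) = -H k j)
    (x y : C3) : matAct H (conjCross x y) = conjCross (matAct H x) y + conjCross x (matAct H y) +
      H.trace • conjCross x y := by
  ext j
  simp only [PiLp.add_apply, PiLp.smul_apply, conjCross_apply, matAct_apply, Fin.sum_univ_three,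
    Matrix.trace_fin_three, smul_eq_mul, map_sub, map_add, map_mul, hH]
  fin_cases j <;> simp <;> ring

theorem inner_I_smul (k x : C3) : inner ℝ ((I : ℂ) • k) x = (inner ℂ k x).im := by
  rw [inner_real_eq_re, inner_smul_left]
  simp

/-- An infinitesimal isometry is the sum of a skew-Hermitian map and a cross product. -/
theorem exists_skewHermitian_add_conjCross {A : C3 →L[ℝ] C3}
    (hA : ∀ x y, inner ℝ (A x) y = -inner ℝ x (A y)) :
    ∃ (H : Matrix (Fin 3) (Fin 3) ℂ) (k : C3), (∀ i j, conj (H i j) = -H j i) ∧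
      ∀ x, A x = matAct H x + conjCross k x := by
  obtain ⟨H, G, hL⟩ := exists_linear_add_antilinear A
  have hp := parts_of_inner_eq (c := -1) hL (by simpa using hA)
  have hG : ∀ j k, G j k = -G k j := fun j k => by simpa using (hp j k).2
  have hG0 : ∀ j, G j j = 0 := fun j => by
    have := hG j j
    linear_combination this / 2
  refine ⟨Matrix.of H, WithLp.toLp 2 ![conj (G 2 1), conj (G 0 2), conj (G 1 0)],
    fun j k => by simpa using (hp j k).1, fun x => ?_⟩
  ext j
  rw [hL, PiLp.add_apply, matAct_apply, Finset.sum_add_distrib]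
  congr 1
  rw [Fin.sum_univ_three]
  have h01 := hG 0 1
  have h12 := hG 1 2
  have h20 := hG 2 0
  fin_cases j <;> simp [hG0]
  · linear_combination conj (x 1) * h01
  · linear_combination conj (x 2) * h12
  · linear_combination conj (x 0) * h20

/-- With p = Ax and N = x × p, substituting the decomposition of A in AN = x × Ap leaves tr H · N +
(⟨k, p⟩ - ⟨p, k⟩) x + (⟨x, k⟩ - ⟨k, x⟩) p = 0. The vectors N, x, p are Hermitian orthogonal, and the
components along N and p are read off. -/
theorem trace_eq_zero_and_inner_im {A : C3 →L[ℝ] C3} {H : Matrix (Fin 3) (Fin 3) ℂ} {k : C3}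
    (hH : ∀ i j, conj (H i j) = -H j i) (hA : ∀ x, A x = matAct H x + conjCross k x) {x : C3}
    (hx : ‖x‖ = 1) (hp : A x ≠ 0) (hxp : inner ℂ x (A x) = 0)
    (hN : A (conjCross x (A x)) = conjCross x (A (A x))) :
    H.trace = 0 ∧ (inner ℂ k x).im = 0 := by
  set p := A x with hpdef
  have hpx : inner ℂ p x = 0 := by rw [← inner_conj_symm, hxp, map_zero]
  have e1 : conjCross (matAct H x) p = -(inner ℂ p k : ℂ) • x := by
    have : matAct H x = p + -conjCross k x := by rw [hpdef, hA]; abel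
    rw [this, conjCross_add_left, conjCross_self, zero_add, conjCross_swap,
      ← neg_one_smul ℝ (conjCross k x), conjCross_real_smul_right, conjCross_conjCross, hpx]
    simp
  have e2 : conjCross x (A p) = conjCross x (matAct H p) - (inner ℂ x k : ℂ) • p := by
    rw [hA, conjCross_add_right, conjCross_conjCross, hxp, zero_smul, zero_sub, sub_eq_add_neg]
  rw [hA (conjCross x p), matAct_conjCross hH, e1, e2, conjCross_conjCross] at hN
  have hE : H.trace • conjCross x p + (inner ℂ k p - inner ℂ p k : ℂ) • x +
      (inner ℂ x k - inner ℂ k x : ℂ) • p = 0 := by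
    rw [sub_smul, sub_smul]
    rw [← sub_eq_zero] at hN
    rw [← hN]
    simp only [neg_smul]
    abel
  have hpn : ‖p‖ ^ 2 ≠ 0 := by positivity
  have hpp : inner ℂ p p ≠ 0 := inner_self_ne_zero.2 hp
  have hNN : inner ℂ (conjCross x p) (conjCross x p) ≠ 0 := by
    rw [inner_self_ne_zero]
    intro h0
    have := norm_conjCross_sq x p
    rw [h0, hxp, hx] at this
    simp at this
    exact hpn this.symm
  have n1 : inner ℂ (conjCross x p) x = 0 := by
    rw [← inner_conj_symm, inner_conjCross_left, map_zero]
  have n2 : inner ℂ (conjCross x p) p = 0 := by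
    rw [← inner_conj_symm, inner_conjCross_right, map_zero]
  constructor
  · have := congrArg (fun y => inner ℂ (conjCross x p) y) hE
    simp only [inner_add_right, inner_smul_right, n1, n2, mul_zero, add_zero, inner_zero_right]
      at this
    exact (mul_eq_zero.1 this).resolve_right hNN
  · have := congrArg (fun y => inner ℂ p y) hE
    simp only [inner_add_right, inner_smul_right, inner_conjCross_right, hpx, mul_zero, zero_add,
      inner_zero_right] at this
    have h2 := (mul_eq_zero.1 this).resolve_right hpp
    have := congrArg Complex.im h2
    rw [← inner_conj_symm x k, Complex.sub_im, Complex.conj_im, Complex.zero_im] at this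
    linarith

theorem eq_zero_of_inner_conjCross {x p y : C3} (hN : conjCross x p ≠ 0) (h1 : inner ℂ x y = 0)
    (h2 : inner ℂ p y = 0) (h3 : inner ℂ (conjCross x p) y = 0) : y = 0 := by
  have e := norm_conjCross_sq y (conjCross x p)
  rw [conjCross_conjCross, ← inner_conj_symm y x, ← inner_conj_symm y p, ← inner_conj_symm y, h1,
    h2, h3] at e
  simp [hN] at e
  exact e

theorem eq_sum_inner_smul {x p : C3} (hx : ‖x‖ = 1) (hp : p ≠ 0) (hxp : inner ℂ x p = 0) (y : C3) :
    y = (inner ℂ x y : ℂ) • x + (inner ℂ p y / (‖p‖ ^ 2 : ℝ) : ℂ) • p +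
      (inner ℂ (conjCross x p) y / (‖p‖ ^ 2 : ℝ) : ℂ) • conjCross x p := by
  have hpx : inner ℂ p x = 0 := by rw [← inner_conj_symm, hxp, map_zero]
  have hpn : ‖p‖ ≠ 0 := by positivity
  have hnn : ‖conjCross x p‖ ^ 2 = ‖p‖ ^ 2 := by
    rw [norm_conjCross_sq, hxp, hx]
    simp
  have hN : conjCross x p ≠ 0 := by
    intro h0
    rw [h0] at hnn
    simp at hnn
    exact hpn (pow_eq_zero_iff two_ne_zero |>.1 hnn.symm)
  have n1 : inner ℂ (conjCross x p) x = 0 := by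
    rw [← inner_conj_symm, inner_conjCross_left, map_zero]
  have n2 : inner ℂ (conjCross x p) p = 0 := by
    rw [← inner_conj_symm, inner_conjCross_right, map_zero]
  have sx : inner ℂ x x = 1 := by rw [inner_self_eq_norm_sq_to_K, hx]; simp
  have sp : inner ℂ p p = ((‖p‖ ^ 2 : ℝ) : ℂ) := by rw [inner_self_eq_norm_sq_to_K]; simp
  have sN : inner ℂ (conjCross x p) (conjCross x p) = ((‖p‖ ^ 2 : ℝ) : ℂ) := by
    rw [inner_self_eq_norm_sq_to_K, ← hnn]; simp
  have hc : ((‖p‖ ^ 2 : ℝ) : ℂ) ≠ 0 := by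
    rw [Complex.ofReal_ne_zero]
    positivity
  refine sub_eq_zero.1 (eq_zero_of_inner_conjCross hN ?_ ?_ ?_)
  · simp only [inner_sub_right, inner_add_right, inner_smul_right, sx, hxp, inner_conjCross_left]
    ring
  · simp only [inner_sub_right, inner_add_right, inner_smul_right, hpx, inner_conjCross_right, sp]
    field_simp
    ring
  · simp only [inner_sub_right, inner_add_right, inner_smul_right, n1, n2, sN]
    field_simp
    ring

theorem inner_eq_zero_of_hasDerivAt {n : C3} {g : ℝ → C3} {g' : C3} {s : ℝ} (hg : HasDerivAt g g' s)
    (h : ∀ s, inner ℝ n (g s) = 0) : inner ℝ n g' = 0 := by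
  have h1 := (hasDerivAt_const s n).inner ℝ hg
  rw [funext h, inner_zero_left, add_zero] at h1
  exact h1.unique (hasDerivAt_const s 0)

namespace IsEquivariantLegendrian

variable {A : C3 →L[ℝ] C3} {w : ℝ × ℝ → C3} {β γ : ℝ → ℝ}

theorem inner_self_generator (h : IsEquivariantLegendrian A w β γ) (x : C3) :
    inner ℝ x (A x) = 0 := by
  have := h.skew x x
  rw [real_inner_comm] at this
  linarith

theorem inner_generator_generator (h : IsEquivariantLegendrian A w β γ) (p : ℝ × ℝ) :
    inner ℂ (w p) (A (A (w p))) = -((‖A (w p)‖ ^ 2 : ℝ) : ℂ) := by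
  obtain ⟨s, t⟩ := p
  have h1 := (h.hasDerivAt_fst s t).inner ℂ
    (A.hasFDerivAt.comp_hasDerivAt s (h.hasDerivAt_fst s t))
  have h2 := h1.eq_zero_of_forall fun s => h.inner_generator (s, t)
  have h3 := inner_self_eq_norm_sq_to_K (𝕜 := ℂ) (A (w (s, t)))
  simp only [Function.comp_apply] at h2
  rw [h3] at h2
  simp at h2 ⊢
  linear_combination h2

theorem hasDerivAt_fst_conjCross (h : IsEquivariantLegendrian A w β γ) (s t : ℝ) :
    HasDerivAt (fun s => conjCross (w (s, t)) (A (w (s, t))))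
      (A (conjCross (w (s, t)) (A (w (s, t))))) s := by
  refine ((h.hasDerivAt_fst s t).conjCross (y := fun s => A (w (s, t)))
    (A.hasFDerivAt.comp_hasDerivAt s (h.hasDerivAt_fst s t))).congr_deriv ?_
  rw [conjCross_self, zero_add, h.generator_conjCross]

theorem norm_generator_eq (h : IsEquivariantLegendrian A w β γ) (s s' t : ℝ) :
    ‖A (w (s, t))‖ ^ 2 = ‖A (w (s', t))‖ ^ 2 := by
  have hd : ∀ s, HasDerivAt (fun s => ‖A (w (s, t))‖ ^ 2) 0 s := fun s =>
    (A.hasFDerivAt.comp_hasDerivAt s (h.hasDerivAt_fst s t)).norm_sq.congr_deriv (by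
      simp [h.inner_self_generator])
  exact is_const_of_deriv_eq_zero (fun s => (hd s).differentiableAt) (fun s => (hd s).deriv) s s'

/-- If `k` does not vanish and `Re ⟨i k, ·⟩` vanishes on the surface, then on every orbit there is a
point where the normal is mapped to a multiple of the tangent of the orbit. -/
theorem exists_generator_conjCross_eq (h : IsEquivariantLegendrian A w β γ) {k : C3} (hk : k ≠ 0)
    (him : ∀ p, (inner ℂ k (w p)).im = 0) (t : ℝ) :
    ∃ s κ : ℝ, A (conjCross (w (s, t)) (A (w (s, t)))) = κ • A (w (s, t)) := by
  -- Derivatives in both directions show that ik is real orthogonal to w, Aw, A²w, the normal and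
  -- its image under A.
  have f0 : ∀ p, inner ℝ ((I : ℂ) • k) (w p) = 0 := fun p => by rw [inner_I_smul, him]
  have f1 : ∀ s t, inner ℝ ((I : ℂ) • k) (A (w (s, t))) = 0 := fun s t =>
    inner_eq_zero_of_hasDerivAt (h.hasDerivAt_fst s t) fun s => f0 (s, t)
  have f2 : ∀ s t, inner ℝ ((I : ℂ) • k) (A (A (w (s, t)))) = 0 := fun s t =>
    inner_eq_zero_of_hasDerivAt (A.hasFDerivAt.comp_hasDerivAt s (h.hasDerivAt_fst s t))
      fun s => f1 s t
  have f3 : ∀ s t, inner ℝ ((I : ℂ) • k) (conjCross (w (s, t)) (A (w (s, t)))) = 0 := fun s t => by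
    have := inner_eq_zero_of_hasDerivAt (h.hasDerivAt_snd s t) fun t => f0 (s, t)
    rw [inner_add_right, inner_smul_right, f1, mul_zero, zero_add, inner_smul_right] at this
    exact (mul_eq_zero.1 this).resolve_left (h.ne_zero t)
  have f4 : ∀ s t, inner ℝ ((I : ℂ) • k) (A (conjCross (w (s, t)) (A (w (s, t))))) = 0 :=
    fun s t => inner_eq_zero_of_hasDerivAt (h.hasDerivAt_fst_conjCross s t) fun s => f3 s t
  simp only [inner_I_smul] at f1 f2 f3 f4
  by_cases hall : ∀ s, inner ℂ k (A (w (s, t))) = 0 ∧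
      inner ℂ k (conjCross (w (s, t)) (A (w (s, t)))) = 0
  · exfalso
    -- Otherwise k is a complex multiple of w along the whole orbit, and the s-derivative of this
    -- relation forces k = 0.
    have hk2 : ∀ s, k - (inner ℂ (w (s, t)) k : ℂ) • w (s, t) = 0 := by
      intro s
      have := eq_sum_inner_smul (h.norm_eq (s, t)) (h.generator_ne_zero (s, t))
        (h.inner_generator (s, t)) k
      rw [← inner_conj_symm (A (w (s, t))), (hall s).1, ← inner_conj_symm (conjCross _ _) k,
        (hall s).2] at this
      rw [sub_eq_zero]
      simpa using this
    have hd : HasDerivAt (fun s => k - (inner ℂ (w (s, t)) k : ℂ) • w (s, t)) _ 0 :=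
      (((h.hasDerivAt_fst 0 t).inner ℂ (hasDerivAt_const 0 k)).smul
        (h.hasDerivAt_fst 0 t)).const_sub k
    rw [funext hk2] at hd
    have h0 := (hasDerivAt_const (0 : ℝ) (0 : C3)).unique hd
    rw [← inner_conj_symm (A (w (0, t))), (hall 0).1] at h0
    simp [h.generator_ne_zero] at h0
    have := hk2 0
    rw [h0] at this
    simp at this
    exact hk this
  · push Not at hall
    obtain ⟨s, hs⟩ := hall
    have e1 := f1 s t
    have e2 := f2 s t
    have e3 := f3 s t
    have e4 := f4 s t
    have hAp := eq_sum_inner_smul (h.norm_eq (s, t)) (h.generator_ne_zero (s, t))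
      (h.inner_generator (s, t)) (A (A (w (s, t))))
    have hAN := h.generator_conjCross (s, t)
    rw [h.inner_generator_generator] at hAp
    have hre : (inner ℂ (A (w (s, t))) (A (A (w (s, t))))).re = 0 := by
      rw [← inner_real_eq_re, h.inner_self_generator]
    have hx0 := him (s, t)
    have hxp := h.inner_generator (s, t)
    have hx := h.norm_eq (s, t)
    have hp := h.generator_ne_zero (s, t)
    generalize A (A (w (s, t))) = q at *
    generalize hpd : A (w (s, t)) = p at *
    generalize hxd : w (s, t) = x at *
    generalize hNd : conjCross x p = N at *
    have hxN : conjCross x N = -p := by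
      rw [← hNd, conjCross_conjCross, hxp, inner_self_eq_norm_sq_to_K, hx]
      simp
    have hp2 : ‖p‖ ^ 2 ≠ 0 := by positivity
    -- Ap = -|p|² x + ζp + ηN, hence AN = x × Ap = conj ζ · N - conj η · p. Orthogonality of ik to
    -- both is a linear system for Im ζ, Im η with determinant of absolute value P² + Q², and Re ζ =
    -- 0 by skewness.
    set ζ : ℂ := inner ℂ p q / (‖p‖ ^ 2 : ℝ) with hζ
    set η : ℂ := inner ℂ N q / (‖p‖ ^ 2 : ℝ) with hη
    have hζre : ζ.re = 0 := by rw [hζ, Complex.div_ofReal_re, hre, zero_div]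
    rw [hAp, conjCross_add_right, conjCross_add_right, conjCross_smul_right, conjCross_smul_right,
      conjCross_smul_right, conjCross_self, hNd, hxN] at hAN
    rw [hAp] at e2
    rw [hAN] at e4
    simp only [inner_add_right, inner_smul_right, smul_zero, zero_add, smul_neg,
      inner_neg_right, Complex.add_im, Complex.neg_im, Complex.mul_im, e1, e3, hx0, mul_zero,
      Complex.conj_im, Complex.conj_re, Complex.ofReal_im, neg_zero, zero_mul] at e2 e4
    set P := (inner ℂ k p).re with hP
    set Q := (inner ℂ k N).re with hQ
    have hPQ : P ^ 2 + Q ^ 2 ≠ 0 := by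
      intro h0
      have hP0 : P = 0 := by nlinarith [sq_nonneg P, sq_nonneg Q]
      have hQ0 : Q = 0 := by nlinarith [sq_nonneg P, sq_nonneg Q]
      exact hs (Complex.ext hP0 e1) (Complex.ext hQ0 e3)
    have hζim : ζ.im = 0 := by
      refine (mul_eq_zero.1 ?_).resolve_left hPQ
      linear_combination P * e2 - Q * e4
    have hηim : η.im = 0 := by
      refine (mul_eq_zero.1 ?_).resolve_left hPQ
      linear_combination Q * e2 + P * e4
    have hζ0 : ζ = 0 := Complex.ext hζre hζim
    have hη0 : conj η = (η.re : ℂ) := Complex.ext (by simp) (by simp [hηim])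
    refine ⟨s, -η.re, ?_⟩
    rw [hxd, hpd, hNd, hAN, hζ0, hη0]
    simp

/-- The antilinear part of the generator vanishes if the surface is compact. -/
theorem eq_zero_of_coversTorus (h : IsEquivariantLegendrian A w β γ) (hw : CoversTorus w)
    (hc : Continuous w) {k : C3} (him : ∀ p, (inner ℂ k (w p)).im = 0) : k = 0 := by
  by_contra hk
  obtain ⟨⟨s₀, t₀⟩, hmin⟩ := hw.exists_forall_le hc (f := fun x => ‖A x‖ ^ 2) (by fun_prop)
  obtain ⟨s, κ, hκ⟩ := h.exists_generator_conjCross_eq hk him t₀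
  have hmin' : ∀ t, ‖A (w (s, t₀))‖ ^ 2 ≤ ‖A (w (s, t))‖ ^ 2 := fun t => by
    rw [h.norm_generator_eq s s₀]
    exact hmin (s, t)
  let N : ℝ → C3 := fun t => conjCross (w (s, t)) (A (w (s, t)))
  let g : ℝ → ℝ := fun t => inner ℝ (A (w (s, t))) (A (N t))
  have hAw : ∀ t, HasDerivAt (fun t => A (w (s, t)))
      (A (β t • A (w (s, t)) + γ t • N t)) t := fun t =>
    A.hasFDerivAt.comp_hasDerivAt t (h.hasDerivAt_snd s t)
  have hd : ∀ t, HasDerivAt (fun t => ‖A (w (s, t))‖ ^ 2) (2 * γ t * g t) t := fun t => by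
    refine (hAw t).norm_sq.congr_deriv ?_
    rw [map_add, map_smul, map_smul, inner_add_right, inner_smul_right, inner_smul_right,
      h.inner_self_generator]
    simp only [g]
    ring
  have hN : HasDerivAt N _ t₀ := (h.hasDerivAt_snd s t₀).conjCross (hAw t₀)
  have hg : HasDerivAt g _ t₀ := (hAw t₀).inner ℝ (A.hasFDerivAt.comp_hasDerivAt t₀ hN)
  have hγ : HasDerivAt γ (deriv γ t₀) t₀ :=
    (h.smooth_right.differentiable (by simp) t₀).hasDerivAt
  obtain ⟨h1, h2⟩ := nonneg_of_hasDerivAt_of_forall_le hd hmin' ((hγ.const_mul 2).mul hg)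
  have hp := h.generator_ne_zero (s, t₀)
  have hp2 : 0 < ‖A (w (s, t₀))‖ ^ 2 := by positivity
  have hg0 : g t₀ = 0 := by simpa [h.ne_zero t₀] using h1
  have hκ0 : κ = 0 := by
    simp only [g, N, hκ, inner_smul_right, real_inner_self_eq_norm_sq] at hg0
    exact (mul_eq_zero.1 hg0).resolve_right hp2.ne'
  have hAN : A (N t₀) = 0 := by simp only [N, hκ, hκ0, zero_smul]
  -- Since A annihilates the normal at the minimum, the t-derivative of the normal is -γ|Aw|² w. The
  -- second derivative of |Aw|² there is then -2γ²|Aw|⁴ < 0.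
  have hN' : conjCross (β t₀ • A (w (s, t₀)) + γ t₀ • N t₀) (A (w (s, t₀))) +
      conjCross (w (s, t₀)) (A (β t₀ • A (w (s, t₀)) + γ t₀ • N t₀)) =
      -(γ t₀ * ‖A (w (s, t₀))‖ ^ 2) • w (s, t₀) := by
    have hAN2 : conjCross (w (s, t₀)) (A (A (w (s, t₀)))) = 0 := by
      rw [← h.generator_conjCross]
      exact hAN
    have hpx : inner ℂ (A (w (s, t₀))) (w (s, t₀)) = 0 := by
      rw [← inner_conj_symm, h.inner_generator, map_zero]
    rw [map_add, map_smul, map_smul, hAN, smul_zero, add_zero, conjCross_real_smul_right, hAN2,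
      conjCross_add_left, conjCross_real_smul_left, conjCross_self, conjCross_real_smul_left,
      conjCross_swap, conjCross_conjCross, hpx, inner_self_eq_norm_sq_to_K]
    ext j
    simp
    ring
  have hgd : inner ℝ (A (w (s, t₀))) (A (conjCross (β t₀ • A (w (s, t₀)) + γ t₀ • N t₀)
      (A (w (s, t₀))) + conjCross (w (s, t₀)) (A (β t₀ • A (w (s, t₀)) + γ t₀ • N t₀)))) =
      -(γ t₀ * (‖A (w (s, t₀))‖ ^ 2) ^ 2) := by
    rw [hN', map_smul, inner_smul_right, real_inner_self_eq_norm_sq]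
    ring
  have hz : 0 < γ t₀ ^ 2 * (‖A (w (s, t₀))‖ ^ 2) ^ 2 :=
    mul_pos (sq_pos_of_ne_zero (h.ne_zero t₀)) (by positivity)
  simp only [N] at hAN hgd
  simp only [hg0, N, hgd, hAN, inner_zero_right, mul_zero, add_zero, zero_add] at h2
  nlinarith

/-- The generator of a compact surface belongs to the Lie algebra of the special unitary group. -/
theorem exists_skewHermitian (h : IsEquivariantLegendrian A w β γ) (hw : CoversTorus w)
    (hc : Continuous w) : ∃ H : Matrix (Fin 3) (Fin 3) ℂ, (∀ i j, conj (H i j) = -H j i) ∧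
      H.trace = 0 ∧ A = matAct H := by
  obtain ⟨H, k, hH, hA⟩ := exists_skewHermitian_add_conjCross h.skew
  have hp := fun p => trace_eq_zero_and_inner_im hH hA (h.norm_eq p) (h.generator_ne_zero p)
    (h.inner_generator p) (h.generator_conjCross p)
  have hk := h.eq_zero_of_coversTorus hw hc fun p => (hp p).2
  refine ⟨H, hH, (hp 0).1, ?_⟩
  ext1 x
  rw [hA, hk, show conjCross 0 x = 0 by ext j; simp, add_zero]

end IsEquivariantLegendrian

/-! ### Normal form of the generator. -/

/-- Three real numbers with sum zero are, up to order, proportional to the weights of a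
one-parameter group with `0 ≤ α ≤ 1`. -/
theorem exists_perm_eq_weight {f : Fin 3 → ℝ} (hsum : ∑ j, f j = 0) (hne : f ≠ 0) :
    ∃ σ : Equiv.Perm (Fin 3), ∃ α ∈ Set.Icc (0 : ℝ) 1, ∃ k : ℝ, k ≠ 0 ∧
      ∀ j, f (σ j) = k * weight α j := by
  -- The positions 1, 0, 2 receive the smallest, middle and largest absolute value. As the sum is
  -- zero, the largest is opposite in sign to the others, so the ratio of smallest to middle lies in
  -- [0, 1].
  let σ : Equiv.Perm (Fin 3) := (Equiv.swap 0 1).trans (Tuple.sort fun j => |f j|)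
  have hm := Tuple.monotone_sort fun j => |f j|
  have h1 : |f (σ 1)| ≤ |f (σ 0)| := by
    have := hm (show (0 : Fin 3) ≤ 1 by decide)
    simpa [σ] using this
  have h2 : |f (σ 0)| ≤ |f (σ 2)| := by
    have := hm (show (1 : Fin 3) ≤ 2 by decide)
    simpa [σ, Equiv.swap_apply_of_ne_of_ne] using this
  have hs : f (σ 0) + f (σ 1) + f (σ 2) = 0 := by
    rw [← hsum, ← Equiv.sum_comp σ, Fin.sum_univ_three]
  have hk : f (σ 0) ≠ 0 := by
    intro h0
    rw [h0, abs_zero] at h1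
    have e1 : f (σ 1) = 0 := abs_eq_zero.1 (le_antisymm h1 (abs_nonneg _))
    have e2 : f (σ 2) = 0 := by linarith
    refine hne (funext fun j => ?_)
    obtain ⟨i, rfl⟩ := σ.surjective j
    fin_cases i
    · exact h0
    · exact e1
    · exact e2
  set k := f (σ 0) with hkd
  have hα : f (σ 1) = k * (f (σ 1) / k) := by field_simp
  set α := f (σ 1) / k with hαd
  have h3 : f (σ 2) = k * (-1 - α) := by linarith
  have hk0 : 0 < |k| := abs_pos.2 hk
  rw [hα, abs_mul] at h1
  rw [h3, abs_mul] at h2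
  have a1 : |α| ≤ 1 := by
    by_contra! hlt
    nlinarith
  have a2 : 1 ≤ |-1 - α| := by
    by_contra! hlt
    nlinarith
  have a3 := abs_le.1 a1
  refine ⟨σ, α, ⟨?_, a3.2⟩, k, hk, fun j => ?_⟩
  · rw [abs_of_nonpos (by linarith)] at a2
    linarith
  · fin_cases j
    · simp [weight, hkd]
    · simpa [weight] using hα
    · simpa [weight] using h3

theorem exists_smul_mem_specialUnitaryGroup {V : Matrix (Fin 3) (Fin 3) ℂ}
    (hV : V ∈ Matrix.unitaryGroup (Fin 3) ℂ) :
    ∃ c : ℂ, c • V ∈ Matrix.specialUnitaryGroup (Fin 3) ℂ := by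
  have hd := Matrix.det_of_mem_unitary hV
  have hn : ‖V.det‖ = 1 := CStarRing.norm_of_mem_unitary hd
  obtain ⟨c, hc⟩ := IsAlgClosed.exists_pow_nat_eq (V.det)⁻¹ (n := 3) (by norm_num)
  have hcn : ‖c‖ = 1 := by
    have : ‖c‖ ^ 3 = 1 := by rw [← norm_pow, hc, norm_inv, hn, inv_one]
    exact (pow_eq_one_iff_of_nonneg (norm_nonneg c) (by norm_num)).1 this
  have hcc : conj c * c = 1 := by
    rw [← Complex.normSq_eq_conj_mul_self, Complex.normSq_eq_norm_sq, hcn]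
    simp
  have hV0 : V.det ≠ 0 := fun h => by simp [h] at hn
  refine ⟨c, Matrix.mem_specialUnitaryGroup_iff.2 ⟨?_, ?_⟩⟩
  · have : c • V = (c • 1) * V := by simp
    rw [this]
    exact mul_mem (smul_one_mem_unitary hcc) hV
  · rw [Matrix.det_smul, Fintype.card_fin, hc, inv_mul_cancel₀ hV0]

/-- Every nonzero element of the Lie algebra of the special unitary group is conjugate to a multiple
of the generator of a one-parameter group with `0 ≤ α ≤ 1`. -/
theorem exists_conj_generator {H : Matrix (Fin 3) (Fin 3) ℂ} (hH : ∀ i j, conj (H i j) = -H j i)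
    (htr : H.trace = 0) (hne : H ≠ 0) :
    ∃ α ∈ Set.Icc (0 : ℝ) 1, ∃ k : ℝ, k ≠ 0 ∧ ∃ V ∈ Matrix.specialUnitaryGroup (Fin 3) ℂ,
      ∀ x, matAct (star V) (matAct H x) = k • generator α (matAct (star V) x) := by
  have hX : (-I • H).IsHermitian := by
    ext i j
    simp [hH]
  set f := hX.eigenvalues with hf
  have hsum : ∑ j, f j = 0 := by
    have := hX.trace_eq_sum_eigenvalues
    rw [Matrix.trace_smul, htr, smul_zero] at this
    have h2 : ((∑ j, f j : ℝ) : ℂ) = 0 := by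
      push_cast
      exact this.symm
    exact_mod_cast h2
  have hf0 : f ≠ 0 := by
    intro h0
    have := hX.eigenvalues_eq_zero_iff.1 h0
    exact hne (by simpa using this)
  obtain ⟨σ, α, hα, k, hk, hσ⟩ := exists_perm_eq_weight hsum hf0
  let U : Matrix (Fin 3) (Fin 3) ℂ := hX.eigenvectorUnitary
  have hU : U ∈ Matrix.unitaryGroup (Fin 3) ℂ := hX.eigenvectorUnitary.2
  have hHU : ∀ i j, (H * U) i j = I * f j * U i j := by
    intro i j
    have h1 := congrFun (hX.mulVec_eigenvectorBasis j) i
    have h2 : ((-I • H) * U) i j = f j * U i j := by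
      simpa [Matrix.mul_apply, Matrix.mulVec, dotProduct, U, hf] using h1
    rw [Matrix.smul_mul, Matrix.smul_apply, smul_eq_mul] at h2
    linear_combination I * h2 + (H * U) i j * Complex.I_sq
  let V₀ : Matrix (Fin 3) (Fin 3) ℂ := U.submatrix id σ
  have hV₀ : V₀ ∈ Matrix.unitaryGroup (Fin 3) ℂ := by
    rw [Matrix.mem_unitaryGroup_iff'] at hU ⊢
    have : star V₀ * V₀ = (star U * U).submatrix σ σ := by
      ext i j
      simp [Matrix.mul_apply, V₀]
    rw [this, hU]
    simp
  obtain ⟨c, hc⟩ := exists_smul_mem_specialUnitaryGroup hV₀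
  have hHV : H * (c • V₀) = (c • V₀) * Matrix.diagonal fun j => I * (k * weight α j : ℝ) := by
    ext i j
    have := hHU i (σ j)
    rw [hσ] at this
    rw [Matrix.mul_diagonal, Matrix.mul_smul, Matrix.smul_apply, Matrix.smul_apply]
    have e : (H * V₀) i j = (H * U) i (σ j) := by simp [Matrix.mul_apply, V₀]
    rw [e, this]
    simp [V₀]
    ring
  have hVu := (Matrix.mem_specialUnitaryGroup_iff.1 hc).1
  generalize c • V₀ = V at *
  refine ⟨α, hα, k, hk, V, hc, fun x => ?_⟩
  have h1 : star V * H = (Matrix.diagonal fun j => I * (k * weight α j : ℝ)) * star V := by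
    calc star V * H = star V * (H * V) * star V := by
          rw [Matrix.mul_assoc, Matrix.mul_assoc, Matrix.mem_unitaryGroup_iff.1 hVu, mul_one]
      _ = _ := by rw [hHV, ← Matrix.mul_assoc, Matrix.mem_unitaryGroup_iff'.1 hVu, one_mul]
  rw [← matAct_mul, h1, matAct_mul]
  ext j
  rw [matAct_apply]
  simp [Matrix.diagonal_apply]
  ring

/-! ### Completeness of the profile of a compact surface. -/

theorem IsPlaneDiffeo.injective_fderiv {ψ : ℝ × ℝ ≃ ℝ × ℝ} (hψ : IsPlaneDiffeo ψ) (x : ℝ × ℝ) :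
    Function.Injective (fderiv ℝ ψ x) := by
  have h1 : HasFDerivAt ψ (fderiv ℝ ψ x) x := (hψ.1.differentiable (by simp) x).hasFDerivAt
  have h2 : HasFDerivAt ψ.symm (fderiv ℝ ψ.symm (ψ x)) (ψ x) :=
    (hψ.2.differentiable (by simp) (ψ x)).hasFDerivAt
  have h3 := h2.comp x h1
  have h4 : ψ.symm ∘ ψ = id := by
    funext y
    simp
  rw [h4] at h3
  have h5 := h3.unique (hasFDerivAt_id x)
  intro ξ η hξ
  have h6 := congrArg (fun L : ℝ × ℝ →L[ℝ] ℝ × ℝ => L (ξ - η)) h5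
  simp [hξ] at h6
  exact (sub_eq_zero.1 h6.symm)

/-- The differential of a periodic immersion is bounded below. -/
theorem exists_le_norm_fderiv {f : ℝ × ℝ → C3} (hf : ContDiff ℝ ∞ f)
    (hinj : ∀ x, Function.Injective (fderiv ℝ f x))
    (hper : ∀ (m n : ℤ) (x : ℝ × ℝ), f (x + ((m : ℝ), (n : ℝ))) = f x) :
    ∃ m > 0, ∀ x ξ, m * ‖ξ‖ ≤ ‖fderiv ℝ f x ξ‖ := by
  have hcont : Continuous fun q : (ℝ × ℝ) × (ℝ × ℝ) => ‖fderiv ℝ f q.1 q.2‖ :=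
    (((hf.continuous_fderiv (by simp)).comp continuous_fst).clm_apply continuous_snd).norm
  obtain ⟨⟨x₀, ξ₀⟩, hx₀, hmin⟩ := ((isCompact_Icc.prod isCompact_Icc :
    IsCompact (Set.Icc (0 : ℝ) 1 ×ˢ Set.Icc (0 : ℝ) 1)).prod
    (isCompact_sphere (0 : ℝ × ℝ) 1)).exists_isMinOn
    ⟨((0, 0), (1, 0)), by simp [Prod.norm_def]⟩ hcont.continuousOn
  have hξ₀ : ‖ξ₀‖ = 1 := by simpa using hx₀.2
  refine ⟨‖fderiv ℝ f x₀ ξ₀‖, ?_, fun x ξ => ?_⟩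
  · rw [gt_iff_lt, norm_pos_iff, Ne, map_eq_zero_iff _ (hinj x₀)]
    intro h0
    simp [h0] at hξ₀
  · obtain ⟨y, m, n, hy, rfl⟩ := exists_add_int_mem_Icc x
    have e : fderiv ℝ f (y + ((m : ℝ), (n : ℝ))) = fderiv ℝ f y := by
      rw [← fderiv_comp_add_right]
      congr 1
      funext z
      exact hper m n z
    rw [e]
    rcases eq_or_ne ξ 0 with rfl | hξ
    · simp
    · have hξn : 0 < ‖ξ‖ := norm_pos_iff.2 hξ
      have h1 : ‖fderiv ℝ f x₀ ξ₀‖ ≤ ‖fderiv ℝ f y (‖ξ‖⁻¹ • ξ)‖ :=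
        hmin (a := (y, ‖ξ‖⁻¹ • ξ)) ⟨hy, by simp [norm_smul, hξn.ne']⟩
      rw [map_smul, norm_smul, norm_inv, norm_norm, inv_mul_eq_div, le_div_iff₀ hξn] at h1
      exact h1

theorem exists_contDiff_primitive {f : ℝ → ℝ} (hf : ContDiff ℝ ∞ f) (a : ℝ) :
    ∃ F : ℝ → ℝ, ContDiff ℝ ∞ F ∧ (∀ t, HasDerivAt F (f t) t) ∧ F a = 0 := by
  have hd : ∀ t, HasDerivAt (fun t => ∫ x in a..t, f x) (f t) t := fun t =>
    intervalIntegral.integral_hasDerivAt_right (hf.continuous.intervalIntegrable _ _)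
      hf.continuous.stronglyMeasurable.stronglyMeasurableAtFilter hf.continuous.continuousAt
  refine ⟨fun t => ∫ x in a..t, f x, contDiff_infty_iff_deriv.2
    ⟨fun t => (hd t).differentiableAt, ?_⟩, hd, by simp⟩
  rwa [funext fun t => (hd t).deriv]

theorem exists_sign {f : ℝ → ℝ} (hf : Continuous f) (h0 : ∀ t, f t ≠ 0) :
    ∃ ε : ℝ, (ε = 1 ∨ ε = -1) ∧ ∀ t, 0 < ε * f t := by
  by_cases h : 0 < f 0
  · refine ⟨1, Or.inl rfl, fun t => ?_⟩
    by_contra! ht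
    obtain ⟨s, hs⟩ := mem_range_of_exists_le_of_exists_ge hf ⟨t, by linarith⟩ ⟨0, h.le⟩
    exact h0 s hs
  · refine ⟨-1, Or.inr rfl, fun t => ?_⟩
    by_contra! ht
    obtain ⟨s, hs⟩ := mem_range_of_exists_le_of_exists_ge hf ⟨0, not_lt.1 h⟩ ⟨t, by linarith⟩
    exact h0 s hs

namespace IsEquivariantLegendrian

variable {A : C3 →L[ℝ] C3} {w : ℝ × ℝ → C3} {β γ : ℝ → ℝ}

/-- The profile of a compact surface is complete. -/
theorem surjective_primitive (h : IsEquivariantLegendrian A w β γ) (hw : CoversTorus w)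
    (hs : ContDiff ℝ ∞ w) (himm : ∀ p, Function.Injective (fderiv ℝ w p)) {τ : ℝ → ℝ}
    (hτ : ∀ t, HasDerivAt τ (γ t) t) : Function.Surjective τ := by
  obtain ⟨ψ, hψ, hper⟩ := hw
  obtain ⟨b, hb, hbd, -⟩ := exists_contDiff_primitive h.smooth_left 0
  obtain ⟨ε, hε, hpos⟩ := exists_sign h.smooth_right.continuous h.ne_zero
  have hfs : ContDiff ℝ ∞ (w ∘ ψ) := hs.comp hψ.1
  have hfd : ∀ x, HasFDerivAt (w ∘ ψ) ((fderiv ℝ w (ψ x)).comp (fderiv ℝ ψ x)) x := fun x =>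
    ((hs.differentiable (by simp) (ψ x)).hasFDerivAt).comp x
      (hψ.1.differentiable (by simp) x).hasFDerivAt
  obtain ⟨m, hm, hle⟩ := exists_le_norm_fderiv hfs (fun x => by
    rw [(hfd x).fderiv]
    exact (himm (ψ x)).comp (hψ.injective_fderiv x)) (fun m n x => hper m n x)
  -- An orthogonal trajectory of the orbits: the shift by -b cancels the β term, so w moves along it
  -- with velocity γ times the normal.
  let P : ℝ → ℝ × ℝ := fun t => (-b t, t)
  have hPd : ∀ t, HasDerivAt P (-β t, 1) t := fun t => (hbd t).neg.prodMk (hasDerivAt_id t)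
  have hxs : ContDiff ℝ ∞ fun t => ψ.symm (P t) := hψ.2.comp (hb.neg.prodMk contDiff_id)
  let x : ℝ → ℝ × ℝ := fun t => ψ.symm (P t)
  have hxd : ∀ t, HasDerivAt x (deriv x t) t := fun t =>
    (hxs.differentiable (by simp) t).hasDerivAt
  have hwx : ∀ t, fderiv ℝ (w ∘ ψ) (x t) (deriv x t) =
      γ t • conjCross (w (P t)) (A (w (P t))) := by
    intro t
    have h1 : HasDerivAt (fun t => w (ψ (x t))) (fderiv ℝ (w ∘ ψ) (x t) (deriv x t)) t :=
      (hfs.differentiable (by simp) (x t)).hasFDerivAt.comp_hasDerivAt t (hxd t)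
    have h2 : HasDerivAt (fun t => w (P t)) (fderiv ℝ w (P t) (-β t, 1)) t :=
      (hs.differentiable (by simp) (P t)).hasFDerivAt.comp_hasDerivAt t (hPd t)
    have h3 : (fun t => w (ψ (x t))) = fun t => w (P t) := by
      funext t
      simp [x]
    rw [h3] at h1
    rw [h1.unique h2, fderiv_apply_eq_partial, partialS_eq hs (h.hasDerivAt_fst _ _),
      partialT_eq hs (h.hasDerivAt_snd _ _)]
    simp [P]
  have hbound : ∀ t, ‖deriv x t‖ ≤ ‖A‖ / m * (ε * γ t) := by
    intro t
    have h1 := hle (x t) (deriv x t)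
    have h2 : ‖conjCross (w (P t)) (A (w (P t)))‖ ≤ ‖A‖ := by
      have h3 := norm_conjCross_sq (w (P t)) (A (w (P t)))
      rw [h.norm_eq, h.inner_generator, map_zero, sub_zero, one_pow, one_mul] at h3
      rw [(sq_eq_sq₀ (norm_nonneg _) (norm_nonneg _)).1 h3]
      simpa [h.norm_eq] using A.le_opNorm (w (P t))
    have h4 : |γ t| = ε * γ t := by
      rw [← abs_of_pos (hpos t), abs_mul]
      rcases hε with rfl | rfl <;> simp
    rw [hwx, norm_smul, Real.norm_eq_abs, h4] at h1
    rw [div_mul_eq_mul_div, le_div_iff₀ hm]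
    nlinarith [mul_le_mul_of_nonneg_left h2 (hpos t).le]
  -- The lifted trajectory moves at most ‖A‖/m times the variation of τ. If τ were bounded in one
  -- direction, x and thus P = ψ ∘ x would stay bounded, but the second coordinate of P is t.
  have hlip : ∀ a t, a ≤ t → ‖x t - x a‖ ≤ ‖A‖ / m * (ε * τ t - ε * τ a) := by
    intro a t hat
    refine image_norm_le_of_norm_deriv_right_le_deriv_boundary (f := fun t => x t - x a)
      (f' := fun t => deriv x t) (a := a) (b := t)
      (B := fun t => ‖A‖ / m * (ε * τ t - ε * τ a)) (B' := fun t => ‖A‖ / m * (ε * γ t))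
      (fun t _ => ((hxd t).sub_const (x a)).continuousAt.continuousWithinAt)
      (fun t _ => ((hxd t).sub_const (x a)).hasDerivWithinAt) (by simp)
      (fun t => (((hτ t).const_mul ε).sub_const _).const_mul _) (fun t _ => hbound t)
      (Set.right_mem_Icc.2 hat)
  have hC : 0 ≤ ‖A‖ / m := by positivity
  have hproper : ∀ r, ∃ K, ∀ t, ‖x t - x 0‖ ≤ r → |t| ≤ K := by
    intro r
    obtain ⟨K, hK⟩ := ((isCompact_closedBall (x 0) r).image
      hψ.1.continuous).isBounded.exists_norm_le
    refine ⟨K, fun t ht => ?_⟩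
    have h1 := hK (ψ (x t)) (Set.mem_image_of_mem _ (by rwa [Metric.mem_closedBall, dist_eq_norm]))
    have h2 : ψ (x t) = P t := by simp [x]
    rw [h2] at h1
    exact (norm_snd_le (P t)).trans h1
  have hup : ∀ R, ∃ t, R ≤ ε * τ t := by
    intro R
    by_contra! hlt
    obtain ⟨K, hK⟩ := hproper (‖A‖ / m * (R - ε * τ 0))
    have h1 := hK (|K| + 1) ((hlip 0 _ (by positivity)).trans
      (mul_le_mul_of_nonneg_left (by linarith [hlt (|K| + 1)]) hC))
    rw [abs_of_pos (by positivity)] at h1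
    linarith [le_abs_self K]
  have hdown : ∀ R, ∃ t, ε * τ t ≤ R := by
    intro R
    by_contra! hlt
    obtain ⟨K, hK⟩ := hproper (‖A‖ / m * (ε * τ 0 - R))
    have h1 := hK (-(|K| + 1)) (by
      rw [norm_sub_rev]
      exact (hlip _ 0 (by linarith [abs_nonneg K])).trans
        (mul_le_mul_of_nonneg_left (by linarith [hlt (-(|K| + 1))]) hC))
    rw [abs_neg, abs_of_pos (by positivity)] at h1
    linarith [le_abs_self K]
  have hcont : Continuous fun t => ε * τ t :=
    continuous_iff_continuousAt.2 fun t => ((hτ t).const_mul ε).continuousAt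
  intro y
  obtain ⟨t, ht⟩ := mem_range_of_exists_le_of_exists_ge hcont (hdown (ε * y)) (hup (ε * y))
  refine ⟨t, mul_left_cancel₀ (a := ε) ?_ ht⟩
  rcases hε with rfl | rfl <;> norm_num

end IsEquivariantLegendrian

/-! ### Matching equivariant surfaces with the family. -/

/-- Shears over a diffeomorphism of the second coordinate are diffeomorphisms of the plane. -/
theorem exists_isPlaneDiffeo {b τ τ' : ℝ → ℝ} {k : ℝ} (hk : k ≠ 0) (hb : ContDiff ℝ ∞ b)
    (hτs : ContDiff ℝ ∞ τ) (hτ : ∀ t, HasDerivAt τ (τ' t) t) (h0 : ∀ t, τ' t ≠ 0)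
    (hc : Continuous τ') (hsurj : Function.Surjective τ) :
    ∃ φ : ℝ × ℝ ≃ ℝ × ℝ, IsPlaneDiffeo φ ∧ ∀ p, φ p = (k * p.1 + b p.2, τ p.2) := by
  obtain ⟨ε, hε, hpos⟩ := exists_sign hc h0
  have hε0 : ε ≠ 0 := by rcases hε with rfl | rfl <;> norm_num
  have hmono : StrictMono fun t => ε * τ t :=
    strictMono_of_deriv_pos fun t => by rw [((hτ t).const_mul ε).deriv]; exact hpos t
  have hs' : Function.Surjective fun t => ε * τ t := fun y => by
    obtain ⟨t, ht⟩ := hsurj (y / ε)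
    refine ⟨t, ?_⟩
    simp only [ht]
    field_simp
  let e : ℝ ≃ₜ ℝ := (hmono.orderIsoOfSurjective _ hs').toHomeomorph
  have he : ∀ t, e t = ε * τ t := fun t => rfl
  have hes : ContDiff ℝ ∞ e.symm := e.contDiff_symm_deriv (f' := fun t => ε * τ' t)
    (fun t => (hpos t).ne') (fun t => (hτ t).const_mul ε) (contDiff_const.mul hτs)
  let φ : ℝ × ℝ ≃ ℝ × ℝ :=
    { toFun := fun p => (k * p.1 + b p.2, τ p.2)
      invFun := fun q => ((q.1 - b (e.symm (ε * q.2))) / k, e.symm (ε * q.2))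
      left_inv := fun p => by
        simp only [← he, Homeomorph.symm_apply_apply]
        ext
        · simp only
          field_simp
          ring
        · rfl
      right_inv := fun q => by
        have h1 : τ (e.symm (ε * q.2)) = q.2 := by
          refine mul_left_cancel₀ hε0 ?_
          rw [← he, Homeomorph.apply_symm_apply]
        ext
        · simp only
          field_simp
          ring
        · exact h1 }
  have he2 : ContDiff ℝ ∞ fun q : ℝ × ℝ => e.symm (ε * q.2) :=
    hes.comp (contDiff_const.mul contDiff_snd)
  exact ⟨φ, ⟨((contDiff_const.mul contDiff_fst).add (hb.comp contDiff_snd)).prodMk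
    (hτs.comp contDiff_snd), ((contDiff_fst.sub (hb.comp he2)).div_const k).prodMk he2⟩,
    fun p => rfl⟩

theorem conjCross_generator (α : ℝ) (z : C3) : conjCross z (generator α z) = -flowField α z := by
  ext j
  simp only [conjCross_apply, generator_apply, flowField_apply, PiLp.neg_apply, map_sub, map_mul,
    Complex.conj_I, Complex.conj_ofReal]
  fin_cases j <;> simp [weight, momentVector] <;> ring

theorem inner_generator_skew (α k : ℝ) (x y : C3) :
    inner ℝ ((k • generator α) x) y = -inner ℝ x ((k • generator α) y) := by
  rw [inner_real_C3, inner_real_C3, ← Finset.sum_neg_distrib]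
  refine Finset.sum_congr rfl fun j _ => ?_
  simp
  ring

theorem matAct_diagonal_apply (e : Fin 3 → ℂ) (x : C3) (j : Fin 3) :
    matAct (Matrix.diagonal e) x j = e j * x j := by
  simp [matAct_apply, Matrix.diagonal_apply]

theorem generator_matAct_diagonal (α : ℝ) (e : Fin 3 → ℂ) (x : C3) :
    generator α (matAct (Matrix.diagonal e) x) = matAct (Matrix.diagonal e) (generator α x) := by
  ext j
  simp only [generator_apply, matAct_diagonal_apply]
  ring

/-- For unimodular entries the hypothesis says that their product is ε. For ε = -1 the diagonal map
reverses the time of the flow. -/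
theorem flowField_matAct_diagonal {α ε : ℝ} {e : Fin 3 → ℂ}
    (he : ∀ j, conj (e (j + 1) * e (j + 2)) = ε * e j) (x : C3) :
    flowField α (matAct (Matrix.diagonal e) x) =
      ε • matAct (Matrix.diagonal e) (flowField α x) := by
  ext j
  have := he j
  simp only [flowField_apply, matAct_diagonal_apply, PiLp.smul_apply, Complex.real_smul, map_mul]
    at this ⊢
  linear_combination (I * momentVector α j * conj (x (j + 1)) * conj (x (j + 2))) * this

theorem diagonal_mem_unitaryGroup {e : Fin 3 → ℂ} (he : ∀ j, conj (e j) * e j = 1) :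
    Matrix.diagonal e ∈ Matrix.unitaryGroup (Fin 3) ℂ := by
  rw [Matrix.mem_unitaryGroup_iff', Matrix.star_eq_conjTranspose, Matrix.diagonal_conjTranspose,
    Matrix.diagonal_mul_diagonal, ← Matrix.diagonal_one]
  congr 1
  funext j
  exact he j

/-- For v > 0, a nonnegative derivative bounds v from below and |z₀|² ≥ 0 bounds it by 1/(3(1 +
2α)). Both hold only for α = 0, v = 1/3, where the point is fixed by the group. -/
theorem level_nonpos_of_levelCubicDeriv_nonneg {α v : ℝ} (hα : 0 ≤ α) (hα1 : α ≤ 1)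
    (h : 0 ≤ levelCubicDeriv α v) (h0 : 0 ≤ 1 / 3 + momentVector α 0 * v)
    (hne : ¬ (α = 0 ∧ v = 1 / 3)) : v ≤ 0 := by
  by_contra! hv
  rw [levelCubicDeriv] at h
  simp [momentVector] at h0
  have h1 := nonneg_of_mul_nonneg_right h hv
  have h2 : 0 ≤ (2 + α) * (1 - α) := mul_nonneg (by linarith) (by linarith)
  have h3 : 0 ≤ (2 + α) * (1 - α) * (1 - 3 * (1 + 2 * α) * v) := mul_nonneg h2 (by linarith)
  have h4 : α = 0 := by nlinarith
  subst h4
  exact hne ⟨rfl, by linarith⟩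

/-- A point of the sphere with real coordinate product and vanishing moment is the image of a start
point under a diagonal unitary matrix. -/
theorem exists_diagonal_startPoint {α v ε J : ℝ} (hε : ε = 1 ∨ ε = -1) (hJ : 0 ≤ J)
    (hα : α ∈ Set.Icc (0 : ℝ) 1) (hv : v ≤ 0)
    (hvJ : levelCubic α v = J ^ 2) {z : C3}
    (hz : ∀ j, normSq (z j) = 1 / 3 + momentVector α j * v) (hP : coordProd z = ε * J) :
    ∃ e : Fin 3 → ℂ, (∀ j, conj (e j) * e j = 1) ∧
      (∀ j, conj (e (j + 1) * e (j + 2)) = ε * e j) ∧ e 0 * e 1 * e 2 = ε ∧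
      z = matAct (Matrix.diagonal e) (startPoint α v) := by
  have hnn : ∀ j, 0 ≤ 1 / 3 + momentVector α j * v := fun j => hz j ▸ Complex.normSq_nonneg _
  have h0 : 0 < 1 / 3 + momentVector α 0 * v := by
    simp [momentVector]
    nlinarith [hα.1]
  have h2 : 0 < 1 / 3 + momentVector α 2 * v := by
    simp [momentVector]
    nlinarith [hα.2]
  have hs : ∀ j, startPoint α v j = ((√(1 / 3 + momentVector α j * v) : ℝ) : ℂ) := fun _ => rfl
  have hcp : coordProd (startPoint α v) = J := by
    have e1 : √(1 / 3 + momentVector α 0 * v) * √(1 / 3 + momentVector α 1 * v) *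
        √(1 / 3 + momentVector α 2 * v) = J := by
      rw [← Real.sqrt_mul (hnn 0), ← Real.sqrt_mul (mul_nonneg (hnn 0) (hnn 1))]
      change √(levelCubic α v) = J
      rw [hvJ, Real.sqrt_sq hJ]
    rw [coordProd, hs, hs, hs, ← e1]
    push_cast
    ring
  have hns : ∀ j, conj (startPoint α v j) * startPoint α v j = conj (z j) * z j := fun j => by
    rw [← Complex.normSq_eq_conj_mul_self, ← Complex.normSq_eq_conj_mul_self, normSq_startPoint hnn,
      hz]
  have hr0 : startPoint α v 0 ≠ 0 := by
    rw [hs, Complex.ofReal_ne_zero]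
    exact (Real.sqrt_pos.2 h0).ne'
  have hr2 : startPoint α v 2 ≠ 0 := by
    rw [hs, Complex.ofReal_ne_zero]
    exact (Real.sqrt_pos.2 h2).ne'
  have hcr : ∀ j, conj (startPoint α v j) = startPoint α v j := fun j => by
    rw [hs, Complex.conj_ofReal]
  have hε2 : (ε : ℂ) * ε = 1 := by rcases hε with rfl | rfl <;> norm_num
  simp only [hcr] at hns
  generalize startPoint α v = x at *
  have u0 : conj (z 0 / x 0) * (z 0 / x 0) = 1 := by
    rw [map_div₀, hcr, div_mul_div_comm, hns 0, div_self]
    rw [← hns 0]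
    exact mul_ne_zero hr0 hr0
  have u2 : conj (z 2 / x 2) * (z 2 / x 2) = 1 := by
    rw [map_div₀, hcr, div_mul_div_comm, hns 2, div_self]
    rw [← hns 2]
    exact mul_ne_zero hr2 hr2
  have z0 : z 0 = (z 0 / x 0) * x 0 := by field_simp
  have z2 : z 2 = (z 2 / x 2) * x 2 := by field_simp
  set a := z 0 / x 0 with ha
  set c := z 2 / x 2 with hc
  -- The middle coordinate of the start point is zero when J = 0, so its phase is not taken as a
  -- quotient but prescribed by the product ε.
  have z1 : z 1 = ε * (conj a * conj c) * x 1 := by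
    rw [coordProd] at hcp hP
    rw [← hcp, z0, z2] at hP
    have : x 0 * x 2 * (z 1 - ε * (conj a * conj c) * x 1) = 0 := by
      linear_combination (conj a * conj c) * hP - (x 0 * x 2 * z 1 * (conj c * c)) * u0 -
        x 0 * x 2 * z 1 * u2
    exact sub_eq_zero.1 ((mul_eq_zero.1 this).resolve_left (mul_ne_zero hr0 hr2))
  refine ⟨![a, ε * (conj a * conj c), c], fun j => ?_, fun j => ?_, ?_, ?_⟩
  · fin_cases j
    · exact u0
    · simp
      linear_combination (conj a * a * (conj c * c)) * hε2 + (conj c * c) * u0 + u2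
    · exact u2
  · fin_cases j <;> simp
    · linear_combination (ε * a) * u2
    · linear_combination -(conj a * conj c) * hε2
    · linear_combination (ε * c) * u0
  · simp
    linear_combination (ε * (conj c * c)) * u0 + ε * u2
  · ext j
    rw [matAct_diagonal_apply]
    fin_cases j
    · exact z0
    · exact z1
    · exact z2

theorem IsEquivariantLegendrian.exists_eq_sweep {α k : ℝ} {w : ℝ × ℝ → C3} {β γ : ℝ → ℝ}
    (h : IsEquivariantLegendrian (k • generator α) w β γ) (hα : α ∈ Set.Icc (0 : ℝ) 1)
    (hw : CoversTorus w) (hs : ContDiff ℝ ∞ w) (himm : ∀ p, Function.Injective (fderiv ℝ w p)) :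
    ∃ J ∈ Set.Icc (0 : ℝ) maxJ, ∃ D ∈ Matrix.unitaryGroup (Fin 3) ℂ, (D.det = 1 ∨ D.det = -1) ∧
      ∃ φ : ℝ × ℝ ≃ ℝ × ℝ, IsPlaneDiffeo φ ∧
        ∀ p, w p = matAct D (sweep α (profile α J) (φ p)) := by
  have hkA : ∀ x, (k • generator α) x = k • generator α x := fun x => rfl
  have hk : k ≠ 0 := by
    rintro rfl
    exact h.generator_ne_zero 0 (by rw [hkA, zero_smul])
  have hrot : ∀ s t, w (s, t) = rotate α (k * s) (w (0, t)) := by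
    intro s t
    have h1 := eq_exp_smul_of_hasDerivAt _ (fun s => h.hasDerivAt_fst s t) s
    rw [← h1, ← exp_smul_generator]
    congr 2
    ext1 x
    change s • (k • generator α x) = (k * s) • generator α x
    rw [smul_smul, mul_comm]
  let z : ℝ → C3 := fun t => w (0, t)
  let c : ℝ → ℝ := fun t => -k * γ t
  have hz : ∀ t, HasDerivAt z ((k * β t) • generator α (z t) + c t • flowField α (z t)) t := by
    intro t
    refine (h.hasDerivAt_snd 0 t).congr_deriv ?_
    rw [hkA, conjCross_real_smul_right, conjCross_generator, smul_smul, smul_neg, smul_neg,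
      smul_smul, ← neg_smul]
    congr 2
    · ring
    · simp only [c]
      ring
  have hcs : ContDiff ℝ ∞ c := contDiff_const.mul h.smooth_right
  have hc0 : ∀ t, c t ≠ 0 := fun t => mul_ne_zero (neg_ne_zero.2 hk) (h.ne_zero t)
  have hsum : ∀ t, ∑ j, normSq (z t j) = 1 := fun t => by
    rw [← norm_sq_C3, h.norm_eq, one_pow]
  have hmom : ∀ t, ∑ j, weight α j * normSq (z t j) = 0 := by
    intro t
    have h1 := h.inner_generator (0, t)
    rw [hkA, inner_complex_C3] at h1
    have h2 : (k : ℂ) * I * ((∑ j, weight α j * normSq (z t j) : ℝ) : ℂ) = 0 := by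
      rw [← h1, Fin.sum_univ_three]
      push_cast
      simp only [Complex.normSq_eq_conj_mul_self, PiLp.smul_apply, generator_apply,
        Complex.real_smul, z]
      ring
    have h3 := (mul_eq_zero.1 h2).resolve_left (by simp [hk])
    exact_mod_cast h3
  have hl := fun t => normSq_eq_level hα.1 (hsum t) (hmom t)
  -- Compactness provides a point of minimal level. There Im P = 0, and the second derivative test
  -- gives v ≤ 0, as at the start of a profile.
  obtain ⟨⟨s₀, t₀⟩, hmin₀⟩ := hw.exists_forall_le hs.continuous (f := fun x => normSq (x 1))
    (Complex.continuous_normSq.comp (by fun_prop))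
  have hmin : ∀ t, level α (z t₀) ≤ level α (z t) := by
    intro t
    have h1 := hmin₀ (0, t)
    simp only [hrot s₀ t₀, normSq_rotate] at h1
    have : 0 < 2 + α := by linarith [hα.1]
    unfold level
    gcongr
  have hcd : HasDerivAt c (deriv c t₀) t₀ := (hcs.differentiable (by simp) t₀).hasDerivAt
  obtain ⟨hc1, hc2⟩ := nonneg_of_hasDerivAt_of_forall_le
    (fun t => hasDerivAt_level hα.1 (hz t)) hmin
    ((hcd.const_mul 2).mul (hasDerivAt_coordProd_im (hz t₀) (hl t₀)))
  have him : (coordProd (z t₀)).im = 0 := by simpa [hc0 t₀] using hc1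
  set v := level α (z t₀) with hv
  have hv0 : v ≤ 0 := by
    refine level_nonpos_of_levelCubicDeriv_nonneg hα.1 hα.2 ?_
      (hl t₀ 0 ▸ Complex.normSq_nonneg _) ?_
    · rw [him, mul_zero, zero_add] at hc2
      have h3 : 0 < 2 * c t₀ ^ 2 := by
        have := sq_pos_of_ne_zero (hc0 t₀)
        linarith
      refine nonneg_of_mul_nonneg_right (b := levelCubicDeriv α v) ?_ h3
      linarith
    · rintro ⟨rfl, hv1⟩
      have h0 := hl t₀ 0
      have h2 := hl t₀ 2
      rw [← hv, hv1] at h0 h2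
      norm_num [momentVector] at h0 h2
      apply h.generator_ne_zero (0, t₀)
      rw [hkA]
      ext j
      fin_cases j
      · simpa using Or.inr (Or.inr h0)
      · simp [weight]
      · simpa using Or.inr (Or.inr h2)
  -- The sign of Re P is absorbed by a diagonal unitary matrix of determinant ε, the source of the
  -- determinant -1.
  obtain ⟨ε, hε, hεJ⟩ : ∃ ε : ℝ, (ε = 1 ∨ ε = -1) ∧ 0 ≤ ε * (coordProd (z t₀)).re := by
    rcases le_total 0 (coordProd (z t₀)).re with h0 | h0
    · exact ⟨1, Or.inl rfl, by linarith⟩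
    · exact ⟨-1, Or.inr rfl, by linarith⟩
  set J := ε * (coordProd (z t₀)).re with hJ
  have hε2 : ε * ε = 1 := by rcases hε with rfl | rfl <;> norm_num
  have hPJ : coordProd (z t₀) = ε * J := by
    apply Complex.ext
    · rw [hJ, ← Complex.ofReal_mul, Complex.ofReal_re, ← mul_assoc, hε2, one_mul]
    · rw [him, ← Complex.ofReal_mul, Complex.ofReal_im]
  have hvJ : levelCubic α v = J ^ 2 := by
    have h1 := normSq_coordProd (z t₀)
    rw [hPJ, ← Complex.ofReal_mul, Complex.normSq_ofReal, hl, hl, hl] at h1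
    rw [levelCubic, ← h1]
    linear_combination J ^ 2 * hε2
  have hJmax : J ∈ Set.Icc (0 : ℝ) maxJ := by
    refine ⟨hεJ, (sq_le_sq₀ hεJ maxJ_pos.le).1 ?_⟩
    rw [← hvJ, maxJ_sq, ← levelCubic_zero α]
    rcases hv0.lt_or_eq with hlt | heq
    · exact (levelCubic_lt hα hlt le_rfl).le
    · rw [heq]
  obtain ⟨e, he1, he2, he3, hstart⟩ :=
    exists_diagonal_startPoint hε hεJ hα hv0 hvJ (hl t₀) hPJ
  have hZ := isProfile_profile hα hJmax
  have hlev : level α (profile α J 0) = v :=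
    levelCubic_injOn hα (hZ.level_zero_nonpos hα.1) hv0
      (by rw [hZ.levelCubic_level_zero hα.1, hvJ])
  obtain ⟨b, hbs, hbd, hb0⟩ := exists_contDiff_primitive
    ((contDiff_const (c := k)).mul h.smooth_left) t₀
  obtain ⟨τ, hτs, hτd, hτ0⟩ := exists_contDiff_primitive ((contDiff_const (c := ε)).mul hcs) t₀
  have hD := diagonal_mem_unitaryGroup he1
  -- Both sides solve the same equation: b integrates the rotation term, and in τ' = ε c the sign
  -- compensates the one from the diagonal matrix.
  have hzeq : z = fun t => matAct (Matrix.diagonal e) (rotate α (b t) (profile α J (τ t))) := by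
    refine integralCurve_unique (contDiff_flowField α) (generator α)
      (continuous_const.mul h.smooth_left.continuous) hcs.continuous hz
      (fun t => (h.norm_eq (0, t)).le) (fun t => ?_) (fun t => ?_) (t₀ := t₀) ?_
    · have h1 : HasDerivAt (fun t => rotate α (b t) (profile α J (τ t)))
          ((k * β t) • generator α (rotate α (b t) (profile α J (τ t))) +
            (ε * c t) • flowField α (rotate α (b t) (profile α J (τ t)))) t := by
        have h2 := ((contDiff_sweep α hZ.contDiff).differentiable (by simp)
          (b t, τ t)).hasFDerivAt.comp_hasDerivAt t ((hbd t).prodMk (hτd t))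
        rwa [fderiv_apply_eq_partial, hZ.partialS_sweep, hZ.partialT_sweep] at h2
      refine ((matAct (Matrix.diagonal e)).hasFDerivAt.comp_hasDerivAt t h1).congr_deriv ?_
      rw [generator_matAct_diagonal, flowField_matAct_diagonal he2, map_add, map_smul, map_smul,
        smul_smul, mul_comm (c t)]
      rfl
    · rw [norm_matAct hD, norm_rotate, hZ.norm_eq]
    · simp only [hb0, hτ0, rotate_zero]
      rw [hZ.start_eq hα.1, hlev, hstart]
  have hsurj : Function.Surjective τ := by
    have h1 : Function.Surjective fun t => (-(ε * k))⁻¹ * τ t := by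
      refine h.surjective_primitive hw hs himm fun t => ?_
      refine ((hτd t).const_mul _).congr_deriv ?_
      have : ε ≠ 0 := by rcases hε with rfl | rfl <;> norm_num
      simp only [c]
      field_simp
    intro y
    obtain ⟨t, ht⟩ := h1 ((-(ε * k))⁻¹ * y)
    have : ε ≠ 0 := by rcases hε with rfl | rfl <;> norm_num
    exact ⟨t, mul_left_cancel₀ (inv_ne_zero (neg_ne_zero.2 (mul_ne_zero this hk))) ht⟩
  obtain ⟨φ, hφ, hφe⟩ := exists_isPlaneDiffeo hk hbs hτs hτd
    (fun t => mul_ne_zero (by rcases hε with rfl | rfl <;> norm_num) (hc0 t))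
    (continuous_const.mul hcs.continuous) hsurj
  refine ⟨J, hJmax, Matrix.diagonal e, hD, ?_, φ, hφ, fun p => ?_⟩
  · rw [Matrix.det_diagonal, Fin.prod_univ_three, he3]
    rcases hε with rfl | rfl <;> simp
  · rw [hφe, show w p = rotate α (k * p.1) (z p.2) from hrot p.1 p.2, hzeq]
    simp only [sweep]
    ext j
    simp only [rotate_apply, matAct_diagonal_apply]
    rw [mul_left_comm, ← mul_assoc (Complex.exp _), ← Complex.exp_add]
    congr 3
    push_cast
    ring

theorem CoversTorus.matAct {w : ℝ × ℝ → C3} (hw : CoversTorus w) (B : Matrix (Fin 3) (Fin 3) ℂ) :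
    CoversTorus fun p => matAct B (w p) := by
  obtain ⟨ψ, hψ, hper⟩ := hw
  exact ⟨ψ, hψ, fun m n x => congrArg (_root_.matAct B) (hper m n x)⟩

theorem IsEquivariantForm.matAct {w : ℝ × ℝ → C3} (hw : IsEquivariantForm w)
    {B : Matrix (Fin 3) (Fin 3) ℂ} (hB : B ∈ Matrix.unitaryGroup (Fin 3) ℂ) :
    IsEquivariantForm fun p => matAct B (w p) := by
  obtain ⟨A, hA, z, hz⟩ := hw
  have h1 : ∀ x, _root_.matAct (star B) (_root_.matAct B x) = x := fun x => by
    rw [← matAct_mul, Matrix.mem_unitaryGroup_iff'.1 hB, matAct_one]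
  have h2 : ∀ x, _root_.matAct B (_root_.matAct (star B) x) = x := fun x => by
    rw [← matAct_mul, Matrix.mem_unitaryGroup_iff.1 hB, matAct_one]
  let A' : C3 →L[ℝ] C3 := _root_.matAct B ∘L A ∘L _root_.matAct (star B)
  have hA' : ∀ x, A' x = _root_.matAct B (A (_root_.matAct (star B) x)) := fun x => rfl
  refine ⟨A', fun x y => ?_, fun t => _root_.matAct B (w (0, t)), fun s t => ?_⟩
  · rw [hA', hA']
    conv_lhs => rw [← h2 y]
    conv_rhs => rw [← h2 x]
    rw [inner_matAct hB, inner_matAct hB, hA]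
  · refine (eq_exp_smul_of_hasDerivAt A' (x := fun s => _root_.matAct B (w (s, t)))
      (fun s => ?_) s).symm
    rw [hA', h1]
    have h3 : HasDerivAt (fun s => w (s, t)) (A (w (s, t))) s := by
      simp only [hz]
      exact hasDerivAt_exp_smul_apply A (z t) s
    exact (_root_.matAct B).hasFDerivAt.comp_hasDerivAt s h3

/-- A scalar phase reduces to θ = 0 and an element V of SU(3) diagonalizes the generator. The phase
commutes with all matrices and returns as the one in the family, so the remaining motion is V times
the diagonal matrix. -/
theorem exists_eq_legendrianFamily {θ : ℝ} {w : ℝ × ℝ → C3}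
    (hw : IsSpecialLegendrianImmersion θ w) (hA : IsEquivariantForm w) (ht : CoversTorus w) :
    ∃ α ∈ Set.Icc (0 : ℝ) 1, ∃ J ∈ Set.Icc (0 : ℝ) maxJ,
      ∃ B ∈ Matrix.unitaryGroup (Fin 3) ℂ, (B.det = 1 ∨ B.det = -1) ∧
        ∃ φ : ℝ × ℝ ≃ ℝ × ℝ, IsPlaneDiffeo φ ∧
          ∀ p, w p = matAct B (legendrianFamily θ α J (φ p)) := by
  have hph := conj_phase_mul θ
  have hph' : phase θ * conj (phase θ) = 1 := by rw [mul_comm, hph]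
  have hcu : conj (phase θ) • (1 : Matrix (Fin 3) (Fin 3) ℂ) ∈ Matrix.unitaryGroup (Fin 3) ℂ :=
    smul_one_mem_unitary (by rw [Complex.conj_conj, hph'])
  have hw1 : IsSpecialLegendrianImmersion 0 fun p => matAct (conj (phase θ) • 1) (w p) := by
    refine hw.matAct hcu ?_
    rw [det_smul_one]
    have h1 := phase_cube θ
    have h2 : (phase θ * conj (phase θ)) ^ 3 = 1 := by rw [hph', one_pow]
    simp only [Complex.ofReal_zero, zero_mul, Complex.exp_zero, one_mul]
    linear_combination -(conj (phase θ)) ^ 3 * h1 + Complex.exp (θ * I) * h2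
  obtain ⟨A, hskew, z, hz⟩ := hA.matAct hcu
  obtain ⟨β, γ, h⟩ := hw1.exists_isEquivariantLegendrian hskew hz
  obtain ⟨H, hH, htr, rfl⟩ := h.exists_skewHermitian (ht.matAct _) hw1.smooth.continuous
  have hH0 : H ≠ 0 := by
    rintro rfl
    exact h.generator_ne_zero 0 (by ext j; simp [matAct_apply])
  obtain ⟨α, hα, k, hk, V, hV, hVH⟩ := exists_conj_generator hH htr hH0
  obtain ⟨hVu, hVd⟩ := Matrix.mem_specialUnitaryGroup_iff.1 hV
  have hw2 := hw1.matAct (θ' := 0) (Unitary.star_mem hVu) (by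
    rw [Matrix.star_eq_conjTranspose, Matrix.det_conjTranspose, hVd, star_one, mul_one])
  obtain ⟨β', γ', h'⟩ := hw2.exists_isEquivariantLegendrian (inner_generator_skew α k)
    (z := fun t => matAct (star V) (matAct (conj (phase θ) • 1) (w (0, t)))) (fun s t => by
      refine (eq_exp_smul_of_hasDerivAt (k • generator α)
        (x := fun s => matAct (star V) (matAct (conj (phase θ) • 1) (w (s, t)))) (fun s => ?_)
        s).symm
      refine ((matAct (star V)).hasFDerivAt.comp_hasDerivAt s (h.hasDerivAt_fst s t)).congr_deriv ?_
      exact hVH _)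
  obtain ⟨J, hJ, D, hD, hDd, φ, hφ, hwφ⟩ := h'.exists_eq_sweep hα ((ht.matAct _).matAct _)
    hw2.smooth hw2.immersion
  refine ⟨α, hα, J, hJ, V * D, mul_mem hVu hD, by rwa [Matrix.det_mul, hVd, one_mul], φ, hφ,
    fun p => ?_⟩
  have h1 := congrArg (fun x => matAct (phase θ • 1) (matAct V x)) (hwφ p)
  simp only [← matAct_mul] at h1
  rw [legendrianFamily, ← matAct_mul]
  have e1 : phase θ • (1 : Matrix (Fin 3) (Fin 3) ℂ) * (V * (star V * conj (phase θ) • 1)) = 1 := by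
    rw [← Matrix.mul_assoc V, Matrix.mem_unitaryGroup_iff.1 hVu, one_mul, Matrix.smul_mul, one_mul,
      smul_smul, hph', one_smul]
  rw [← Matrix.mul_assoc, ← Matrix.mul_assoc] at h1
  rw [Matrix.mul_assoc, Matrix.mul_assoc, e1, matAct_one] at h1
  rw [h1, Matrix.smul_mul, one_mul, Matrix.mul_smul, mul_one]

theorem theorem4 (θ : ℝ) :
    ∃ u : ℝ → ℝ → ℝ × ℝ → C3,
      -- a family of conformal `θ`-special Legendrian immersions, invariant under `exp (σ A)`,
      -- in which `J` is the angular momentum parameter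
      (∀ α ∈ Set.Icc (0 : ℝ) 1, ∀ J ∈ Set.Icc (0 : ℝ) maxJ,
        IsSpecialLegendrianImmersion θ (u α J) ∧
        IsInvariantUnder (generator α) (u α J) ∧
        IsConformalParam (u α J) ∧
        HasAngularMomenta (u α J) (fun j => J * momentVector α j)) ∧
      -- for `α = 1` or maximal `J` the surface is a generalized Clifford torus
      (∀ α ∈ Set.Icc (0 : ℝ) 1, ∀ J ∈ Set.Icc (0 : ℝ) maxJ, α = 1 ∨ J = maxJ →
        ∃ φ : ℝ, ∃ B ∈ Matrix.specialUnitaryGroup (Fin 3) ℂ,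
          Set.range (u α J) = matAct B '' cliffordTorus φ) ∧
      -- otherwise the surfaces are pairwise non-congruent, and not congruent to the former ones
      (∀ α ∈ Set.Icc (0 : ℝ) 1, ∀ J ∈ Set.Icc (0 : ℝ) maxJ,
        ∀ α' ∈ Set.Icc (0 : ℝ) 1, ∀ J' ∈ Set.Icc (0 : ℝ) maxJ,
          ¬ (α = 1 ∨ J = maxJ) → (α, J) ≠ (α', J') →
            ¬ AreCongruent (u α J) (u α' J')) ∧
      -- every equivariant `θ`-special Legendrian immersion which covers a torus is in the family
      (∀ w : ℝ × ℝ → C3, IsSpecialLegendrianImmersion θ w → IsEquivariantForm w → CoversTorus w →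
        ∃ α ∈ Set.Icc (0 : ℝ) 1, ∃ J ∈ Set.Icc (0 : ℝ) maxJ,
          ∃ B ∈ Matrix.unitaryGroup (Fin 3) ℂ, (B.det = 1 ∨ B.det = -1) ∧
            ∃ φ : ℝ × ℝ ≃ ℝ × ℝ, IsPlaneDiffeo φ ∧
              ∀ p, w p = matAct B (u α J (φ p))) :=
  ⟨legendrianFamily θ, fun _ hα _ hJ => legendrianFamily_properties θ hα hJ,
    fun _ hα _ hJ h => exists_range_eq_cliffordTorus θ hα hJ h,
    fun _ hα _ hJ _ hα' _ hJ' h hne => not_areCongruent θ hα hJ hα' hJ' h hne,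
    fun _ hw hA ht => exists_eq_legendrianFamily hw hA ht⟩
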